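/- Let $M$ be a smooth oriented 4-manifold, possibly with boundary (Hausdorff, $\sigma$-compact), and let $\jmath:\partial M\hookrightarrow M$ be the inclusion of its boundary. Indices $i,j,k$ run over $1,2,3$, are raised and lowered with $\delta_{ij}$, repeated indices are summed, and $\epsilon_{ijk}$ is the Levi-Civita symbol. For triples $e=(e^i)$, $A=(A^i)$ of smooth 1-forms on $M$ put $$F^i=\mathrm dA^i+\tfrac12\epsilon^i{}_{jk}A^j\wedge A^k,\qquad De^i=\mathrm de^i+\epsilon^i{}_{jk}A^j\wedge e^k .$$ (1) For $\alpha_1,\dots,\alpha_5\in\mathbb R$ let $$S_{\boldsymbol\alpha}(e,A)=\int_M\Big(\alpha_1\epsilon_{ijk}e^i\wedge e^j\wedge F^k+\alpha_2De_i\wedge De^i+\alpha_3F_i\wedge F^i+\alpha_4\epsilon_{ijk}De^i\wedge e^j\wedge e^k+\alpha_5F_i\wedge De^i\Big).$$ Then $(e,A)$ is a stationary point of $S_{\boldsymbol\alpha}$ (with respect to all smooth compactly supported variations of $(e,A)$, not required to vanish on $\partial M$; if $M$ is not compact, the action is taken over any compact set containing the support of the variation) if and only if, for all $i$, $$(\alpha_1-\alpha_2)\,\epsilon_{ijk}e^j\wedge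 F^k=0,\qquad(\alpha_1-\alpha_2)\,\epsilon_{ijk}De^j\wedge e^k=0\qquad\text{on }M,$$ $$\jmath^*\big(2\alpha_2De_i+\alpha_4\epsilon_{ijk}e^j\wedge e^k+\alpha_5F_i\big)=0,\qquad \jmath^*\big(\alpha_1\epsilon_{ijk}e^j\wedge e^k+2\alpha_3F_i+\alpha_5De_i\big)=0\qquad\text{on }\partial M .$$ (2) Let $A_+=(A_+^i)$, $A_-=(A_-^i)$ be triples of smooth 1-forms on $M$ with curvatures $F_\pm^i=\mathrm dA_\pm^i+\frac12\epsilon^i{}_{jk}A_\pm^j\wedge A_\pm^k$, and put $e^i=A_+^i-A_-^i$, $A^i=\alpha A_-^i+(1-\alpha)A_+^i$ with $\alpha=\frac12$. Then $(A_+,A_-)$ is a stationary point (in the same sense) of the two-connection action $S(A_+,A_-)=\int_MF_{+i}\wedge F_-^i$ if and only if, for all $i$, $\epsilon_{ijk}e^j\wedge F^k=0$ and $\epsilon_{ijk}De^j\wedge e^k=0$ on $M$, and $$\jmath^*(De^i)=0,\qquad \jmath^*\big(F_i+\tfrac18\epsilon_{ijk}e^j\wedge e^k\big)=0\qquad\text{on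 }\partial M .$$ These boundary equations hold if and only if the triad $\jmath^*e$ and the connection $\jmath^*A$ on the 3-manifold $\partial M$ satisfy the field equations of 3-dimensional Euclidean general relativity with cosmological constant $\Lambda=\frac14$ in first-order form, which for a triad $e$ and an $SO(3)$-connection $A$ on a 3-manifold are $De^i=0$ and $F_i+\frac{\Lambda}{2}\epsilon_{ijk}e^j\wedge e^k=0$. -/

import Mathlib

open Set Function Topology MeasureTheory
open scoped Manifold ContDiff

noncomputable section

namespace HKModel

/-! ### Exterior algebra of a vector space -/

section Algebra

variable {V : Type*} [AddCommGroup V] [Module ℝ V] [TopologicalSpace V]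

/-- The multilinear map `v ↦ a (v₁, …, v_k) * b (v_{k+1}, …, v_{k+l})`. -/
def mulMultilinear {k l : ℕ} (a : V [⋀^Fin k]→L[ℝ] ℝ) (b : V [⋀^Fin l]→L[ℝ] ℝ) :
    ContinuousMultilinearMap ℝ (fun _ : Fin (k + l) => V) ℝ where
  toMultilinearMap :=
    (LinearMap.mul' ℝ ℝ).compMultilinearMap
      ((MultilinearMap.domCoprod (a.toAlternatingMap : MultilinearMap ℝ (fun _ : Fin k => V) ℝ)
        (b.toAlternatingMap : MultilinearMap ℝ (fun _ : Fin l => V) ℝ)).domDomCongr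
        finSumFinEquiv)
  cont := by
    have h : Continuous fun v : Fin (k + l) → V =>
        a (fun i => v (Fin.castAdd l i)) * b (fun i => v (Fin.natAdd k i)) := by
      refine Continuous.mul ?_ ?_
      · exact a.cont.comp (continuous_pi fun i => continuous_apply _)
      · exact b.cont.comp (continuous_pi fun i => continuous_apply _)
    exact h

theorem mulMultilinear_apply {k l : ℕ} (a : V [⋀^Fin k]→L[ℝ] ℝ) (b : V [⋀^Fin l]→L[ℝ] ℝ)
    (v : Fin (k + l) → V) :
    mulMultilinear a b v =
      a (fun i => v (Fin.castAdd l i)) * b (fun i => v (Fin.natAdd k i)) := rfl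

/-- The wedge product of a `k`-covector and an `l`-covector,
`(a ∧ b)(v) = 1/(k! l!) ∑_σ sign(σ) a(v_{σ(1)}, …, v_{σ(k)}) b(v_{σ(k+1)}, …, v_{σ(k+l)})`. -/
def wedgeAlt {k l : ℕ} (a : V [⋀^Fin k]→L[ℝ] ℝ) (b : V [⋀^Fin l]→L[ℝ] ℝ) :
    V [⋀^Fin (k + l)]→L[ℝ] ℝ :=
  ((1 : ℝ) / ((k.factorial : ℝ) * (l.factorial : ℝ))) •
    ContinuousMultilinearMap.alternatization (mulMultilinear a b)

end Algebra

/-! ### Differential forms on a manifold -/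

section Forms

variable {E : Type*} [NormedAddCommGroup E] [NormedSpace ℝ E]
  {H : Type*} [TopologicalSpace H] (I : ModelWithCorners ℝ E H)
  (M : Type*) [TopologicalSpace M] [ChartedSpace H M]

/-- Real differential `k`-forms on `M` (not necessarily smooth). -/
abbrev Form (k : ℕ) : Type _ := (p : M) → TangentSpace I p [⋀^Fin k]→L[ℝ] ℝ

variable {I M}

/-- The pointwise wedge product of forms. -/
def wedge {k l : ℕ} (α : Form I M k) (β : Form I M l) : Form I M (k + l) :=
  fun p => wedgeAlt (α p) (β p)

/-- The coordinate expression of a form in the preferred chart at `q`, i.e. its pullback by the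
inverse of this chart. It is meaningful on the target of the extended chart. -/
def chartRep {k : ℕ} (q : M) (η : Form I M k) (y : E) : E [⋀^Fin k]→L[ℝ] ℝ :=
  (η ((extChartAt I q).symm y)).compContinuousLinearMap
    (mfderivWithin 𝓘(ℝ, E) I (extChartAt I q).symm (range I) y)

/-- A form is smooth if all its coordinate expressions are (up to the boundary). -/
def IsSmoothForm {k : ℕ} (η : Form I M k) : Prop :=
  ∀ q : M, ContDiffOn ℝ ∞ (chartRep q η) (extChartAt I q).target

/-- The exterior derivative, computed at each point `p` in the preferred chart at `p`. -/
def extD {k : ℕ} (η : Form I M k) : Form I M (k + 1) := fun p =>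
  (extDerivWithin (chartRep p η) (range I) (extChartAt I p p)).compContinuousLinearMap
    (mfderiv I 𝓘(ℝ, E) (extChartAt I p) p)

/-- The pullback of a form by a map `f`. -/
def pullback {E' : Type*} [NormedAddCommGroup E'] [NormedSpace ℝ E']
    {H' : Type*} [TopologicalSpace H'] {J : ModelWithCorners ℝ E' H'}
    {N : Type*} [TopologicalSpace N] [ChartedSpace H' N] {k : ℕ} (f : N → M)
    (η : Form I M k) : Form J N k := fun x =>
  (η (f x)).compContinuousLinearMap (mfderiv J I f x)

end Forms

/-! ### Integration of top-degree forms -/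

section Integration

variable {n : ℕ} {H : Type*} [TopologicalSpace H]
  (I : ModelWithCorners ℝ (EuclideanSpace ℝ (Fin n)) H)
  (M : Type*) [TopologicalSpace M] [ChartedSpace H M]

/-- `M` is oriented by its atlas: all coordinate changes have positive Jacobian determinant. -/
def IsOrientedAtlas : Prop :=
  ∀ c ∈ atlas H M, ∀ c' ∈ atlas H M, ∀ y ∈ (I.extendCoordChange c c').source,
    0 < (fderivWithin ℝ (I.extendCoordChange c c') (I.extendCoordChange c c').source y).det

/-- A smooth partition of unity subordinate to the chart domains of `M`. -/
def chartPartition [IsManifold I ∞ M] [T2Space M] [SigmaCompactSpace M] :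
    SmoothPartitionOfUnity M I M univ :=
  (SmoothPartitionOfUnity.exists_isSubordinate_chartAt_source I M).choose

variable {I M}

/-- The integral `∫_K η` of a form of top degree on a compact part `K` of a manifold `M`
oriented by its atlas (with `K = M` if `M` is compact), by a partition of unity. -/
def integralOn [IsManifold I ∞ M] [T2Space M] [SigmaCompactSpace M]
    (K : Set M) (η : Form I M n) : ℝ :=
  ∑ᶠ q : M, ∫ y in (extChartAt I q).target ∩ (extChartAt I q).symm ⁻¹' K,
    chartPartition I M q ((extChartAt I q).symm y) *
      chartRep q η y (EuclideanSpace.basisFun (Fin n) ℝ)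

end Integration

/-! ### The boundary of a manifold with boundary, as a manifold -/

section Boundary

variable (n : ℕ) (M : Type*) [TopologicalSpace M] [ChartedSpace (EuclideanHalfSpace (n + 1)) M]

/-- The boundary `∂M` of an `(n+1)`-dimensional manifold with boundary, with the subspace
topology. -/
abbrev Boundary : Type _ := {p : M // p ∈ (𝓡∂ (n + 1)).boundary M}

/-- The natural inclusion `∂M ↪ M`. -/
def boundaryIncl (x : Boundary n M) : M := x.1

variable {n M}

/-- The inclusion `y ↦ (0, y)` of `ℝⁿ` in the half-space. -/
def consZero (y : EuclideanSpace ℝ (Fin n)) : EuclideanHalfSpace (n + 1) :=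
  ⟨WithLp.toLp 2 (Fin.cons 0 fun i => y i), by simp⟩

/-- The projection forgetting the first coordinate. -/
def dropZero (z : EuclideanHalfSpace (n + 1)) : EuclideanSpace ℝ (Fin n) :=
  WithLp.toLp 2 fun i => z.1 i.succ

theorem dropZero_consZero (y : EuclideanSpace ℝ (Fin n)) : dropZero (consZero y) = y := by
  ext i
  simp [dropZero, consZero]

theorem consZero_dropZero {z : EuclideanHalfSpace (n + 1)} (hz : z.1 0 = 0) :
    consZero (dropZero z) = z := by
  apply Subtype.ext
  ext i
  refine Fin.cases ?_ (fun j => ?_) i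
  · simpa [consZero] using hz.symm
  · simp [consZero, dropZero]

theorem continuous_consZero : Continuous (consZero (n := n)) := by
  refine Continuous.subtype_mk ?_ _
  refine (PiLp.continuous_toLp 2 _).comp (continuous_pi fun i => ?_)
  refine Fin.cases ?_ (fun j => ?_) i
  · simpa using continuous_const
  · simpa using PiLp.continuous_apply 2 _ j

theorem continuous_dropZero : Continuous (dropZero (n := n)) := by
  refine (PiLp.continuous_toLp 2 _).comp (continuous_pi fun i => ?_)
  exact (PiLp.continuous_apply 2 _ i.succ).comp continuous_subtype_val

/-- In any chart, the boundary points are those whose first coordinate vanishes. -/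
theorem mem_boundary_iff [IsManifold (𝓡∂ (n + 1)) ∞ M]
    {c : OpenPartialHomeomorph M (EuclideanHalfSpace (n + 1))}
    (hc : c ∈ atlas (EuclideanHalfSpace (n + 1)) M) {p : M} (hp : p ∈ c.source) :
    p ∈ (𝓡∂ (n + 1)).boundary M ↔ (c p).1 0 = 0 := by
  have h1 : (𝓡∂ (n + 1)).IsInteriorPoint p ↔
      c.extend (𝓡∂ (n + 1)) p ∈ interior (range (𝓡∂ (n + 1))) := by
    rw [(𝓡∂ (n + 1)).isInteriorPoint_iff_of_mem_atlas (n := ∞) (by simp) hc hp]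
    exact ⟨fun h => c.interior_extend_target_subset_interior_range h,
      fun h => c.mem_interior_extend_target (c.map_source hp) h⟩
  have h2 : p ∈ (𝓡∂ (n + 1)).boundary M ↔ ¬ (𝓡∂ (n + 1)).IsInteriorPoint p :=
    (𝓡∂ (n + 1)).isBoundaryPoint_iff_not_isInteriorPoint p
  rw [h2, h1, interior_range_modelWithCornersEuclideanHalfSpace]
  have h3 : 0 ≤ (c p).1 0 := (c p).2
  change ¬ (0 < (c p).1 0) ↔ _
  constructor
  · intro h; linarith
  · intro h; linarith

/-- The chart of `∂M` around `p` induced by a chart `c` of `M`: `x ↦ (c¹(x), …, cⁿ(x))`. -/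
def boundaryChart [IsManifold (𝓡∂ (n + 1)) ∞ M] (p : Boundary n M)
    (c : OpenPartialHomeomorph M (EuclideanHalfSpace (n + 1)))
    (hc : c ∈ atlas (EuclideanHalfSpace (n + 1)) M) :
    OpenPartialHomeomorph (Boundary n M) (EuclideanSpace ℝ (Fin n)) where
  toFun x := dropZero (c x.1)
  invFun y := by
    classical
    exact if h : c.symm (consZero y) ∈ (𝓡∂ (n + 1)).boundary M then ⟨_, h⟩ else p
  source := {x | x.1 ∈ c.source}
  target := {y | consZero y ∈ c.target}
  map_source' x hx := by
    have h0 := (mem_boundary_iff hc hx).1 x.2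
    simpa [consZero_dropZero h0] using c.map_source hx
  map_target' y hy := by
    have hs : c.symm (consZero y) ∈ c.source := c.map_target hy
    have hb : c.symm (consZero y) ∈ (𝓡∂ (n + 1)).boundary M := by
      rw [mem_boundary_iff hc hs, c.right_inv hy]
      simp [consZero]
    simp only [hb, dite_true]
    exact hs
  left_inv' x hx := by
    have h0 := (mem_boundary_iff hc hx).1 x.2
    have hx' : c.symm (consZero (dropZero (c x.1))) = x.1 := by
      rw [consZero_dropZero h0, c.left_inv hx]
    have hb : c.symm (consZero (dropZero (c x.1))) ∈ (𝓡∂ (n + 1)).boundary M := by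
      rw [hx']; exact x.2
    simp only [hb, dite_true]
    exact Subtype.ext hx'
  right_inv' y hy := by
    have hs : c.symm (consZero y) ∈ c.source := c.map_target hy
    have hb : c.symm (consZero y) ∈ (𝓡∂ (n + 1)).boundary M := by
      rw [mem_boundary_iff hc hs, c.right_inv hy]
      simp [consZero]
    simp only [hb, dite_true]
    rw [c.right_inv hy, dropZero_consZero]
  open_source := c.open_source.preimage continuous_subtype_val
  open_target := c.open_target.preimage continuous_consZero
  continuousOn_toFun :=
    continuous_dropZero.comp_continuousOn
      (c.continuousOn.comp continuous_subtype_val.continuousOn fun _ hx => hx)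
  continuousOn_invFun := by
    refine continuousOn_iff_continuous_domRestrict.2 (Topology.IsInducing.subtypeVal.continuous_iff.2 ?_)
    have h : ContinuousOn (fun y => c.symm (consZero y)) {y | consZero y ∈ c.target} :=
      c.continuousOn_symm.comp continuous_consZero.continuousOn fun _ hy => hy
    refine (continuousOn_iff_continuous_domRestrict.1 h).congr fun y => ?_
    have hs : c.symm (consZero y.1) ∈ c.source := c.map_target y.2
    have hb : c.symm (consZero y.1) ∈ (𝓡∂ (n + 1)).boundary M := by
      rw [mem_boundary_iff hc hs, c.right_inv y.2]
      simp [consZero]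
    simp [Set.domRestrict, hb]

/-- The charts of `∂M` are those induced by the preferred charts of `M` at boundary points. -/
instance [IsManifold (𝓡∂ (n + 1)) ∞ M] :
    ChartedSpace (EuclideanSpace ℝ (Fin n)) (Boundary n M) where
  atlas := range fun p : Boundary n M =>
    boundaryChart p (chartAt (EuclideanHalfSpace (n + 1)) p.1) (chart_mem_atlas _ p.1)
  chartAt p := boundaryChart p (chartAt (EuclideanHalfSpace (n + 1)) p.1) (chart_mem_atlas _ p.1)
  mem_chart_source p := mem_chart_source (EuclideanHalfSpace (n + 1)) p.1
  chart_mem_atlas p := mem_range_self p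

/-- The pullback `j^* η` of a form on `M` by the natural inclusion `j : ∂M ↪ M`. -/
def boundaryPullback [IsManifold (𝓡∂ (n + 1)) ∞ M] {k : ℕ} (η : Form (𝓡∂ (n + 1)) M k) :
    Form (𝓡 n) (Boundary n M) k :=
  pullback (boundaryIncl n M) η

end Boundary

/-! ### Connections, triads and the actions -/

section Fields

variable {E : Type*} [NormedAddCommGroup E] [NormedSpace ℝ E]
  {H : Type*} [TopologicalSpace H] {I : ModelWithCorners ℝ E H}
  {M : Type*} [TopologicalSpace M] [ChartedSpace H M]

/-- The Levi-Civita symbol: the determinant of the `i`-th, `j`-th and `k`-th basis vectors. -/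
def eps (i j k : Fin 3) : ℝ :=
  (Matrix.of fun a : Fin 3 => (Pi.single (![i, j, k] a) 1 : Fin 3 → ℝ)).det

/-- The curvature `Fⁱ = dAⁱ + (1/2) εⁱ_{jk} Aʲ ∧ Aᵏ`. -/
def curv (A : Fin 3 → Form I M 1) : Fin 3 → Form I M 2 := fun i =>
  extD (A i) + (1 / 2 : ℝ) • ∑ j, ∑ k, eps i j k • wedge (A j) (A k)

/-- The covariant exterior derivative `Deⁱ = deⁱ + εⁱ_{jk} Aʲ ∧ eᵏ`. -/
def covD (A e : Fin 3 → Form I M 1) : Fin 3 → Form I M 2 := fun i =>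
  extD (e i) + ∑ j, ∑ k, eps i j k • wedge (A j) (e k)

/-- The 2-forms `ε_{ijk} eʲ ∧ eᵏ`. -/
def epsWedge (e : Fin 3 → Form I M 1) : Fin 3 → Form I M 2 := fun i =>
  ∑ j, ∑ k, eps i j k • wedge (e j) (e k)

/-- The Lagrangian
`α₁ ε_{ijk} eⁱ∧eʲ∧Fᵏ + α₂ De_i∧Deⁱ + α₃ F_i∧Fⁱ + α₄ ε_{ijk} Deⁱ∧eʲ∧eᵏ + α₅ F_i∧Deⁱ`. -/
def lagrangian (α₁ α₂ α₃ α₄ α₅ : ℝ) (e A : Fin 3 → Form I M 1) : Form I M 4 :=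
  α₁ • (∑ i, ∑ j, ∑ k, eps i j k • wedge (wedge (e i) (e j)) (curv A k)) +
    α₂ • (∑ i, wedge (covD A e i) (covD A e i)) +
    α₃ • (∑ i, wedge (curv A i) (curv A i)) +
    α₄ • (∑ i, ∑ j, ∑ k, eps i j k • wedge (wedge (covD A e i) (e j)) (e k)) +
    α₅ • (∑ i, wedge (curv A i) (covD A e i))

/-- The two-connection Lagrangian `F_{+i} ∧ F_-ⁱ`. -/
def twoConnLagrangian (Ap Am : Fin 3 → Form I M 1) : Form I M 4 :=
  ∑ i, wedge (curv Ap i) (curv Am i)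

/-- The 3-forms `ε_{ijk} eʲ ∧ Fᵏ`. -/
def hkCurv (e A : Fin 3 → Form I M 1) : Fin 3 → Form I M 3 := fun i =>
  ∑ j, ∑ k, eps i j k • wedge (e j) (curv A k)

/-- The 3-forms `ε_{ijk} Deʲ ∧ eᵏ`. -/
def hkTorsion (e A : Fin 3 → Form I M 1) : Fin 3 → Form I M 3 := fun i =>
  ∑ j, ∑ k, eps i j k • wedge (covD A e j) (e k)

/-- The field equations of 3-dimensional Euclidean general relativity with cosmological constant
`Λ`, for a triad `e` and an `SO(3)`-connection `A` on a 3-manifold (first-order form):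
`Deⁱ = 0` and `F_i + (Λ/2) ε_{ijk} eʲ ∧ eᵏ = 0`. -/
def EuclideanGR3 {N : Type*} [TopologicalSpace N] [ChartedSpace (EuclideanSpace ℝ (Fin 3)) N]
    (Λ : ℝ) (e A : Fin 3 → Form (𝓡 3) N 1) : Prop :=
  (∀ i, covD A e i = 0) ∧ ∀ i, curv A i + (Λ / 2) • epsWedge e i = 0

end Fields

/-! ### Stationary points -/

section Stationary

variable {H : Type*} [TopologicalSpace H]
  {I : ModelWithCorners ℝ (EuclideanSpace ℝ (Fin 4)) H}
  {M : Type*} [TopologicalSpace M] [ChartedSpace H M]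
  [IsManifold I ∞ M] [T2Space M] [SigmaCompactSpace M]

/-- `(X, Y)` is a stationary point of the action `∫ L(X, Y)`: for every compact `K` and all smooth
variations `x, y` vanishing outside `K`, the derivative of `∫_K L(X + t x, Y + t y)` at `t = 0`
vanishes. The set `K` may meet the boundary of `M`, where the variations are not constrained; for
compact `M` this is the stationarity of `∫_M L` under arbitrary smooth variations. -/
def IsStationary (L : (Fin 3 → Form I M 1) → (Fin 3 → Form I M 1) → Form I M 4)
    (X Y : Fin 3 → Form I M 1) : Prop :=
  ∀ (K : Set M) (x y : Fin 3 → Form I M 1), IsCompact K →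
    (∀ i, IsSmoothForm (x i)) → (∀ i, IsSmoothForm (y i)) →
    (∀ p ∉ K, ∀ i, x i p = 0 ∧ y i p = 0) →
    HasDerivAt (fun t : ℝ => integralOn K (L (X + t • x) (Y + t • y))) 0 0

end Stationary

end HKModel

end

/-!
Every term of the Lagrangian is a constant multiple of a product of two of the triples
`ε_{ijk} eʲ ∧ eᵏ`, `Deⁱ`, `Fⁱ`, which depend quadratically on `(e, A)`. By the Leibniz rule and the
identities `DF = 0`, `D De = F × e` its first variation in the direction `(x, a)` is
`2 (α₁ - α₂) (x_i ∧ ε_{ijk} eʲ ∧ Fᵏ + a_i ∧ ε_{ijk} Deʲ ∧ eᵏ)` plus the differential of a 3-form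
that is linear in `(x, a)`. Stokes' theorem turns the exact term into an integral over the boundary.
Variations supported in the interior then give the field equations on the interior, hence on `M` by
continuity; after that only the boundary integral is left, and arbitrary variations give the
equations on `∂M`.

With `A₊ = A + e / 2` and `A₋ = A - e / 2` the two-connection Lagrangian is the case
`(1/4, -1/4, 1, 0, 0)`, and a linear change of variables preserves stationarity. Pullback to the
boundary commutes with `d` and `∧`, which identifies the boundary equations with those of
3-dimensional gravity.
-/

noncomputable section

namespace HKModel

/-! ### Antisymmetrization -/

section AltSum

variable {ι κ X N : Type*} [Fintype ι] [DecidableEq ι] [Fintype κ] [DecidableEq κ]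
  [AddCommGroup N]

/-- The antisymmetrization `v ↦ ∑_σ sign(σ) f(v ∘ σ)` of a function of several variables, without
a normalizing factor. It extends `MultilinearMap.alternatization` to functions that need not be
multilinear. -/
def altSum (f : (ι → X) → N) (v : ι → X) : N :=
  ∑ σ : Equiv.Perm ι, Equiv.Perm.sign σ • f (v ∘ σ)

theorem altSum_add (f g : (ι → X) → N) (v : ι → X) :
    altSum (fun w => f w + g w) v = altSum f v + altSum g v := by
  simp only [altSum, smul_add, Finset.sum_add_distrib]

theorem altSum_sum {α : Type*} (s : Finset α) (f : α → (ι → X) → N) (v : ι → X) :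
    altSum (fun w => ∑ a ∈ s, f a w) v = ∑ a ∈ s, altSum (f a) v := by
  simp only [altSum, Finset.smul_sum]
  exact Finset.sum_comm

theorem altSum_map {N' : Type*} [AddCommGroup N'] (φ : N →+ N') (f : (ι → X) → N) (v : ι → X) :
    altSum (fun w => φ (f w)) v = φ (altSum f v) := by
  simp only [altSum, map_sum, Units.smul_def, map_zsmul]

theorem altSum_units_smul (c : ℤˣ) (f : (ι → X) → N) (v : ι → X) :
    altSum (fun w => c • f w) v = c • altSum f v :=
  altSum_map (DistribSMul.toAddMonoidHom N c) f v

theorem altSum_smul {R : Type*} [Ring R] [Module R N] (c : R) (f : (ι → X) → N) (v : ι → X) :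
    altSum (fun w => c • f w) v = c • altSum f v :=
  altSum_map (DistribSMul.toAddMonoidHom N c) f v

theorem altSum_const_mul {R : Type*} [Ring R] (c : R) (f : (ι → X) → R) (v : ι → X) :
    altSum (fun w => c * f w) v = c * altSum f v :=
  altSum_smul c f v

theorem altSum_comp_equiv (e : ι ≃ κ) (f : (ι → X) → N) (v : κ → X) :
    altSum (fun w : κ → X => f (w ∘ e)) v = altSum f (v ∘ e) := by
  refine (Equiv.sum_comp e.permCongr _).symm.trans (Finset.sum_congr rfl fun σ _ => ?_)
  have h_arg : (v ∘ e.permCongr σ) ∘ e = (v ∘ e) ∘ σ := by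
    ext i
    simp [Equiv.permCongr_apply]
  rw [Equiv.Perm.sign_permCongr, ← h_arg]

theorem altSum_comp_perm (τ : Equiv.Perm ι) (f : (ι → X) → N) (v : ι → X) :
    altSum (fun w => f (w ∘ τ)) v = Equiv.Perm.sign τ • altSum f v := by
  rw [altSum, altSum, Finset.smul_sum]
  refine (Equiv.sum_comp (Equiv.mulRight τ⁻¹) _).symm.trans (Finset.sum_congr rfl fun σ _ => ?_)
  rw [Equiv.coe_mulRight, Equiv.Perm.sign_mul, Equiv.Perm.sign_inv, mul_comm, mul_smul]
  congr 3
  ext i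
  simp

theorem altSum_alternating {V R : Type*} [CommRing R] [AddCommGroup V] [Module R V] [Module R N]
    (a : V [⋀^ι]→ₗ[R] N) (v : ι → V) : altSum a v = (Fintype.card ι).factorial • a v := by
  simp only [altSum, a.map_perm, smul_smul, Int.units_mul_self, one_smul, Finset.sum_const,
    Finset.card_univ, Fintype.card_perm]

/-- Antisymmetrizing in part of the variables first only multiplies the result by the number of
permutations of these variables. -/
theorem altSum_altSum_embedding (ι' : κ ↪ ι) (G : (ι → X) → (κ → X) → N)
    (hG : ∀ w w' : ι → X, (∀ i ∉ range ι', w i = w' i) → G w = G w') (v : ι → X) :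
    altSum (fun w => altSum (G w) (w ∘ ι')) v =
      (Fintype.card κ).factorial • altSum (fun w => G w (w ∘ ι')) v := by
  have h_extend (τ : Equiv.Perm κ) (w : ι → X) :
      G w ((w ∘ ι') ∘ τ) =
        G (w ∘ τ.viaFintypeEmbedding ι') ((w ∘ τ.viaFintypeEmbedding ι') ∘ ι') := by
    have h_outside : G w = G (w ∘ τ.viaFintypeEmbedding ι') := hG _ _ fun i hi => by
      rw [comp_apply, τ.viaFintypeEmbedding_apply_notMem_range ι' hi]
    rw [← h_outside]
    congr 1
    ext i
    simp
  calc altSum (fun w => altSum (G w) (w ∘ ι')) v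
      = ∑ τ : Equiv.Perm κ, altSum (fun w => Equiv.Perm.sign τ • G w ((w ∘ ι') ∘ τ)) v :=
        altSum_sum _ _ v
    _ = ∑ _τ : Equiv.Perm κ, altSum (fun w => G w (w ∘ ι')) v := by
        refine Finset.sum_congr rfl fun τ _ => ?_
        simp only [altSum_units_smul, h_extend]
        rw [altSum_comp_perm (τ.viaFintypeEmbedding ι') (fun w => G w (w ∘ ι')),
          Equiv.Perm.viaFintypeEmbedding_sign, smul_smul, Int.units_mul_self, one_smul]
    _ = _ := by rw [Finset.sum_const, Finset.card_univ, Fintype.card_perm]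

theorem altSum_altSum_tail {k : ℕ} (G : X → (Fin k → X) → N) (v : Fin (k + 1) → X) :
    altSum (fun w : Fin (k + 1) → X => altSum (G (w 0)) (Fin.tail w)) v =
      k.factorial • altSum (fun w : Fin (k + 1) → X => G (w 0) (Fin.tail w)) v := by
  have h := altSum_altSum_embedding (Fin.succEmb k) (fun w => G (w 0))
    (fun w w' h => by rw [h 0 (by simp)]) v
  rwa [Fintype.card_fin] at h

theorem natAdd_notMem_range_castAddEmb {k l : ℕ} (i : Fin l) :
    Fin.natAdd k i ∉ range (Fin.castAddEmb (n := k) l) := by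
  rintro ⟨j, hj⟩
  exact absurd (congrArg Fin.val hj) (j.2.trans_le (Nat.le_add_right k i)).ne

theorem castAdd_notMem_range_natAddEmb {k l : ℕ} (i : Fin k) :
    Fin.castAdd l i ∉ range (Fin.natAddEmb (m := l) k) := by
  rintro ⟨j, hj⟩
  exact absurd (congrArg Fin.val hj) (i.2.trans_le (Nat.le_add_right k j)).ne'

theorem altSum_altSum_mul {k l : ℕ} (f : (Fin k → X) → ℝ) (g : (Fin l → X) → ℝ)
    (v : Fin (k + l) → X) :
    altSum (fun w : Fin (k + l) → X => altSum f (w ∘ Fin.castAdd l) * g (w ∘ Fin.natAdd k)) v =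
      k.factorial *
        altSum (fun w : Fin (k + l) → X => f (w ∘ Fin.castAdd l) * g (w ∘ Fin.natAdd k)) v := by
  have h := altSum_altSum_embedding (Fin.castAddEmb (n := k) l)
    (fun w u => g (w ∘ Fin.natAdd k) * f u)
    (fun w w' h => by
      have : w ∘ Fin.natAdd k = w' ∘ Fin.natAdd k :=
        funext fun i => h _ (natAdd_notMem_range_castAddEmb i)
      simp only [this]) v
  simp only [altSum_const_mul, Fintype.card_fin, nsmul_eq_mul] at h
  simpa only [mul_comm (g _), Fin.coe_castAddEmb] using h

theorem altSum_mul_altSum {k l : ℕ} (f : (Fin k → X) → ℝ) (g : (Fin l → X) → ℝ)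
    (v : Fin (k + l) → X) :
    altSum (fun w : Fin (k + l) → X => f (w ∘ Fin.castAdd l) * altSum g (w ∘ Fin.natAdd k)) v =
      l.factorial *
        altSum (fun w : Fin (k + l) → X => f (w ∘ Fin.castAdd l) * g (w ∘ Fin.natAdd k)) v := by
  have h := altSum_altSum_embedding (Fin.natAddEmb (m := l) k)
    (fun w u => f (w ∘ Fin.castAdd l) * g u)
    (fun w w' h => by
      have : w ∘ Fin.castAdd l = w' ∘ Fin.castAdd l :=
        funext fun i => h _ (castAdd_notMem_range_natAddEmb i)
      simp only [this]) v
  simp only [altSum_const_mul, Fintype.card_fin, nsmul_eq_mul] at h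
  exact h

theorem norm_altSum_le {E : Type*} [NormedAddCommGroup E] {f : (ι → E) → ℝ} {C : ℝ}
    (hf : ∀ w, ‖f w‖ ≤ C * ∏ i, ‖w i‖) (v : ι → E) :
    ‖altSum f v‖ ≤ (Fintype.card ι).factorial * (C * ∏ i, ‖v i‖) := by
  have h_term (σ : Equiv.Perm ι) : ‖Equiv.Perm.sign σ • f (v ∘ σ)‖ ≤ C * ∏ i, ‖v i‖ := by
    rw [← Equiv.prod_comp σ fun i => ‖v i‖]
    rcases Int.units_eq_one_or (Equiv.Perm.sign σ) with h | h <;> simpa [h] using hf (v ∘ σ)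
  simpa [altSum, Fintype.card_perm] using norm_sum_le_of_le Finset.univ fun σ _ => h_term σ

end AltSum

/-! ### The algebra of the wedge product -/

section WedgeAlt

variable {V : Type*} [AddCommGroup V] [Module ℝ V] [TopologicalSpace V] {k l m : ℕ}

theorem wedgeAlt_apply (a : V [⋀^Fin k]→L[ℝ] ℝ) (b : V [⋀^Fin l]→L[ℝ] ℝ) (v : Fin (k + l) → V) :
    wedgeAlt a b v = (1 / (k.factorial * l.factorial) : ℝ) *
      altSum (fun w : Fin (k + l) → V => a (w ∘ Fin.castAdd l) * b (w ∘ Fin.natAdd k)) v := by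
  simp [wedgeAlt, ContinuousMultilinearMap.alternatization_apply_apply, altSum,
    mulMultilinear_apply, comp_def]

theorem wedgeAlt_add_left (a a' : V [⋀^Fin k]→L[ℝ] ℝ) (b : V [⋀^Fin l]→L[ℝ] ℝ) :
    wedgeAlt (a + a') b = wedgeAlt a b + wedgeAlt a' b := by
  ext v
  simp only [wedgeAlt_apply, ContinuousAlternatingMap.add_apply, ← mul_add, ← altSum_add, add_mul]

theorem wedgeAlt_add_right (a : V [⋀^Fin k]→L[ℝ] ℝ) (b b' : V [⋀^Fin l]→L[ℝ] ℝ) :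
    wedgeAlt a (b + b') = wedgeAlt a b + wedgeAlt a b' := by
  ext v
  simp only [wedgeAlt_apply, ContinuousAlternatingMap.add_apply, ← mul_add, ← altSum_add]

theorem wedgeAlt_smul_left (c : ℝ) (a : V [⋀^Fin k]→L[ℝ] ℝ) (b : V [⋀^Fin l]→L[ℝ] ℝ) :
    wedgeAlt (c • a) b = c • wedgeAlt a b := by
  ext v
  simp only [wedgeAlt_apply, ContinuousAlternatingMap.smul_apply, smul_mul_assoc, altSum_smul,
    mul_smul_comm]

theorem wedgeAlt_smul_right (c : ℝ) (a : V [⋀^Fin k]→L[ℝ] ℝ) (b : V [⋀^Fin l]→L[ℝ] ℝ) :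
    wedgeAlt a (c • b) = c • wedgeAlt a b := by
  ext v
  simp only [wedgeAlt_apply, ContinuousAlternatingMap.smul_apply, altSum_smul, mul_smul_comm]

theorem wedgeAlt_zero_left (b : V [⋀^Fin l]→L[ℝ] ℝ) :
    wedgeAlt (0 : V [⋀^Fin k]→L[ℝ] ℝ) b = 0 := by
  rw [← zero_smul ℝ (0 : V [⋀^Fin k]→L[ℝ] ℝ), wedgeAlt_smul_left, zero_smul]

theorem wedgeAlt_zero_right (a : V [⋀^Fin k]→L[ℝ] ℝ) :
    wedgeAlt a (0 : V [⋀^Fin l]→L[ℝ] ℝ) = 0 := by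
  rw [← zero_smul ℝ (0 : V [⋀^Fin l]→L[ℝ] ℝ), wedgeAlt_smul_right, zero_smul]

theorem wedgeAlt_compContinuousLinearMap {W : Type*} [AddCommGroup W] [Module ℝ W]
    [TopologicalSpace W] (a : V [⋀^Fin k]→L[ℝ] ℝ) (b : V [⋀^Fin l]→L[ℝ] ℝ) (f : W →L[ℝ] V) :
    (wedgeAlt a b).compContinuousLinearMap f =
      wedgeAlt (a.compContinuousLinearMap f) (b.compContinuousLinearMap f) := by
  ext v
  simp only [wedgeAlt_apply, ContinuousAlternatingMap.compContinuousLinearMap_apply]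
  rfl

theorem finAddFlip_trans_finCongr_eq_finRotate_pow (k l : ℕ) :
    finAddFlip.trans (finCongr (add_comm l k)) = finRotate (k + l) ^ l := by
  have h_pow (j : ℕ) (i : Fin (k + l)) :
      ((finRotate (k + l) ^ j) i : ℕ) = (i + j) % (k + l) := by
    induction j with
    | zero => simp [Nat.mod_eq_of_lt i.2]
    | succ j ih =>
      have : NeZero (k + l) := ⟨i.pos.ne'⟩
      rw [pow_succ', Equiv.Perm.mul_apply, finRotate_apply, Fin.val_add, ih, Fin.val_one',
        ← Nat.add_mod, add_assoc]
  ext i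
  rw [h_pow]
  refine Fin.addCases (fun i => ?_) (fun i => ?_) i
  · have : l + (i : ℕ) < k + l := by omega
    simp [add_comm (i : ℕ) l, Nat.mod_eq_of_lt this]
  · have : k + i + l = i + (k + l) := by omega
    simp [this, Nat.mod_eq_of_lt (i.2.trans_le (Nat.le_add_left l k))]

theorem sign_finAddFlip_trans_finCongr (k l : ℕ) :
    Equiv.Perm.sign (finAddFlip.trans (finCongr (add_comm l k))) = (-1) ^ (k * l) := by
  rw [finAddFlip_trans_finCongr_eq_finRotate_pow, map_pow, sign_finRotate, ← pow_mul]
  rcases l with - | l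
  · simp
  · have h : (k + (l + 1) - 1) * (l + 1) = k * (l + 1) + l * (l + 1) := by
      rw [← add_assoc, Nat.add_sub_cancel, add_mul]
    rw [h, pow_add, (Nat.even_mul_succ_self l).neg_one_pow, mul_one]

theorem wedgeAlt_comm (a : V [⋀^Fin k]→L[ℝ] ℝ) (b : V [⋀^Fin l]→L[ℝ] ℝ) (v : Fin (k + l) → V) :
    wedgeAlt a b v = (-1) ^ (k * l) * wedgeAlt b a (v ∘ finCongr (add_comm l k)) := by
  set f : (Fin (k + l) → V) → ℝ := fun w => a (w ∘ Fin.castAdd l) * b (w ∘ Fin.natAdd k) with hf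
  let ρ : Equiv.Perm (Fin (k + l)) := finAddFlip.trans (finCongr (add_comm l k))
  have h_flip (w : Fin (k + l) → V) :
      b ((w ∘ finCongr (add_comm l k)) ∘ Fin.castAdd k) *
        a ((w ∘ finCongr (add_comm l k)) ∘ Fin.natAdd l) = f (w ∘ ρ) := by
    have h_left : (w ∘ ρ) ∘ Fin.castAdd l = (w ∘ finCongr (add_comm l k)) ∘ Fin.natAdd l := by
      ext i
      simp [ρ]
    have h_right : (w ∘ ρ) ∘ Fin.natAdd k = (w ∘ finCongr (add_comm l k)) ∘ Fin.castAdd k := by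
      ext i
      simp [ρ]
    simp only [hf, h_left, h_right, mul_comm]
  have h_swap : altSum (fun w : Fin (l + k) → V => b (w ∘ Fin.castAdd k) * a (w ∘ Fin.natAdd l))
      (v ∘ finCongr (add_comm l k)) = (-1) ^ (k * l) * altSum f v := by
    rw [← altSum_comp_equiv (finCongr (add_comm l k))]
    simp only [h_flip, altSum_comp_perm]
    rw [sign_finAddFlip_trans_finCongr, Units.smul_def, zsmul_eq_mul]
    push_cast
    rfl
  have h_sq : ((-1 : ℝ) ^ (k * l)) * (-1) ^ (k * l) = 1 := by rw [← mul_pow]; simp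
  rw [wedgeAlt_apply, wedgeAlt_apply, h_swap]
  linear_combination -(1 / (k.factorial * l.factorial) : ℝ) * altSum f v * h_sq

theorem wedgeAlt_wedgeAlt_left (a : V [⋀^Fin k]→L[ℝ] ℝ) (b : V [⋀^Fin l]→L[ℝ] ℝ)
    (c : V [⋀^Fin m]→L[ℝ] ℝ) (v : Fin (k + l + m) → V) :
    wedgeAlt (wedgeAlt a b) c v = (1 / (k.factorial * l.factorial * m.factorial) : ℝ) *
      altSum (fun w : Fin (k + l + m) → V => a ((w ∘ Fin.castAdd m) ∘ Fin.castAdd l) *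
        b ((w ∘ Fin.castAdd m) ∘ Fin.natAdd k) * c (w ∘ Fin.natAdd (k + l))) v := by
  simp only [wedgeAlt_apply, mul_assoc (1 / _ : ℝ), altSum_const_mul]
  rw [altSum_altSum_mul (fun u => a (u ∘ Fin.castAdd l) * b (u ∘ Fin.natAdd k)) c]
  field_simp

theorem wedgeAlt_wedgeAlt_right (a : V [⋀^Fin k]→L[ℝ] ℝ) (b : V [⋀^Fin l]→L[ℝ] ℝ)
    (c : V [⋀^Fin m]→L[ℝ] ℝ) (v : Fin (k + (l + m)) → V) :
    wedgeAlt a (wedgeAlt b c) v = (1 / (k.factorial * l.factorial * m.factorial) : ℝ) *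
      altSum (fun w : Fin (k + (l + m)) → V => a (w ∘ Fin.castAdd (l + m)) *
        (b ((w ∘ Fin.natAdd k) ∘ Fin.castAdd m) * c ((w ∘ Fin.natAdd k) ∘ Fin.natAdd l))) v := by
  simp only [wedgeAlt_apply, mul_left_comm (a _) (1 / _ : ℝ), altSum_const_mul]
  rw [altSum_mul_altSum a fun u => b (u ∘ Fin.castAdd m) * c (u ∘ Fin.natAdd l)]
  field_simp

theorem wedgeAlt_assoc (a : V [⋀^Fin k]→L[ℝ] ℝ) (b : V [⋀^Fin l]→L[ℝ] ℝ)
    (c : V [⋀^Fin m]→L[ℝ] ℝ) (v : Fin (k + l + m) → V) :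
    wedgeAlt (wedgeAlt a b) c v =
      wedgeAlt a (wedgeAlt b c) (v ∘ finCongr (add_assoc k l m).symm) := by
  rw [wedgeAlt_wedgeAlt_left, wedgeAlt_wedgeAlt_right, ← altSum_comp_equiv]
  congr 2
  ext w
  rw [mul_assoc]
  congr 3
  all_goals ext i; exact congrArg w (Fin.ext (by simp [add_assoc]))

end WedgeAlt

/-! ### The wedge product as a continuous bilinear map -/

section Normed

variable {E : Type*} [NormedAddCommGroup E] [NormedSpace ℝ E] {k l : ℕ}

theorem norm_wedgeAlt_le (a : E [⋀^Fin k]→L[ℝ] ℝ) (b : E [⋀^Fin l]→L[ℝ] ℝ) :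
    ‖wedgeAlt a b‖ ≤ ((k + l).factorial : ℝ) * ‖a‖ * ‖b‖ := by
  refine ContinuousAlternatingMap.opNorm_le_bound _ (by positivity) fun v => ?_
  have h_term (w : Fin (k + l) → E) :
      ‖a (w ∘ Fin.castAdd l) * b (w ∘ Fin.natAdd k)‖ ≤ ‖a‖ * ‖b‖ * ∏ i, ‖w i‖ := by
    rw [norm_mul, Fin.prod_univ_add, mul_mul_mul_comm]
    exact mul_le_mul (a.le_opNorm _) (b.le_opNorm _) (norm_nonneg _) (by positivity)
  have h_coeff : ‖(1 / (k.factorial * l.factorial) : ℝ)‖ ≤ 1 := by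
    rw [Real.norm_of_nonneg (by positivity), div_le_one (by positivity)]
    exact_mod_cast Nat.mul_pos k.factorial_pos l.factorial_pos
  calc ‖wedgeAlt a b v‖ ≤ 1 * ((k + l).factorial * (‖a‖ * ‖b‖ * ∏ i, ‖v i‖)) := by
        rw [wedgeAlt_apply, norm_mul]
        have h_sum := norm_altSum_le h_term v
        rw [Fintype.card_fin] at h_sum
        exact mul_le_mul h_coeff h_sum (norm_nonneg _) zero_le_one
    _ = (k + l).factorial * ‖a‖ * ‖b‖ * ∏ i, ‖v i‖ := by ring

/-- The wedge product as a continuous bilinear map. -/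
def wedgeCLM (E : Type*) [NormedAddCommGroup E] [NormedSpace ℝ E] (k l : ℕ) :
    E [⋀^Fin k]→L[ℝ] ℝ →L[ℝ] E [⋀^Fin l]→L[ℝ] ℝ →L[ℝ] E [⋀^Fin (k + l)]→L[ℝ] ℝ :=
  LinearMap.mkContinuous₂
    (LinearMap.mk₂ ℝ wedgeAlt wedgeAlt_add_left wedgeAlt_smul_left wedgeAlt_add_right
      wedgeAlt_smul_right) ((k + l).factorial : ℝ) norm_wedgeAlt_le

theorem wedgeCLM_apply (a : E [⋀^Fin k]→L[ℝ] ℝ) (b : E [⋀^Fin l]→L[ℝ] ℝ) :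
    wedgeCLM E k l a b = wedgeAlt a b := rfl

variable {F : Type*} [NormedAddCommGroup F] [NormedSpace ℝ F] {s : Set F}
  {a : F → E [⋀^Fin k]→L[ℝ] ℝ} {b : F → E [⋀^Fin l]→L[ℝ] ℝ}

theorem contDiffOn_wedgeAlt {n : WithTop ℕ∞} (ha : ContDiffOn ℝ n a s) (hb : ContDiffOn ℝ n b s) :
    ContDiffOn ℝ n (fun y => wedgeAlt (a y) (b y)) s :=
  (wedgeCLM E k l).isBoundedBilinearMap.contDiff.comp_contDiffOn (f := fun y => (a y, b y))
    (ha.prodMk hb)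

theorem fderivWithin_wedgeAlt {x : F} (ha : DifferentiableWithinAt ℝ a s x)
    (hb : DifferentiableWithinAt ℝ b s x) (hs : UniqueDiffWithinAt ℝ s x) (v : F) :
    fderivWithin ℝ (fun y => wedgeAlt (a y) (b y)) s x v =
      wedgeAlt (fderivWithin ℝ a s x v) (b x) + wedgeAlt (a x) (fderivWithin ℝ b s x v) := by
  have h := ((wedgeCLM E k l).hasFDerivWithinAt_of_bilinear ha.hasFDerivWithinAt
    hb.hasFDerivWithinAt).fderivWithin hs
  simp only [wedgeCLM_apply] at h
  simp [h, wedgeCLM_apply, add_comm]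

end Normed

/-! ### The Leibniz rule -/

section Leibniz

variable {E : Type*} [NormedAddCommGroup E] [NormedSpace ℝ E] {k l : ℕ}

theorem alternatizeUncurryFin_apply_altSum (φ : E →L[ℝ] E [⋀^Fin k]→L[ℝ] ℝ)
    (v : Fin (k + 1) → E) :
    ContinuousAlternatingMap.alternatizeUncurryFin φ v = (1 / k.factorial : ℝ) *
      altSum (fun w : Fin (k + 1) → E => φ (w 0) (Fin.tail w)) v := by
  set f : (Fin (k + 1) → E) → ℝ := fun w => φ (w 0) (Fin.tail w) with hf
  set dφ := ContinuousAlternatingMap.alternatizeUncurryFin φ with hdφ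
  have h_cycle (w : Fin (k + 1) → E) : dφ w =
      ∑ i : Fin (k + 1), Equiv.Perm.sign i.cycleRange⁻¹ • f (w ∘ ⇑i.cycleRange⁻¹) := by
    rw [hdφ, ContinuousAlternatingMap.alternatizeUncurryFin_apply]
    refine Finset.sum_congr rfl fun i _ => ?_
    rw [Equiv.Perm.inv_def, ← Fin.cons_removeNth_eq_comp_cycleRange_symm,
      Equiv.Perm.sign_symm, Fin.sign_cycleRange, hf, Units.smul_def, Units.val_pow_eq_pow_val]
    simp only [Units.val_neg, Units.val_one, Fin.cons_zero, Fin.tail_cons]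
  have h_count : ((k + 1).factorial : ℝ) * dφ v = (k + 1) * altSum f v := by
    calc ((k + 1).factorial : ℝ) * dφ v = altSum dφ v := by
          simpa using (altSum_alternating dφ.toAlternatingMap v).symm
      _ = ∑ _i : Fin (k + 1), altSum f v := by
          rw [funext h_cycle, altSum_sum]
          refine Finset.sum_congr rfl fun i _ => ?_
          rw [altSum_units_smul, altSum_comp_perm, smul_smul, Int.units_mul_self, one_smul]
      _ = (k + 1) * altSum f v := by simp
  have h_fact : (k.factorial : ℝ) ≠ 0 := by positivity
  rw [Nat.factorial_succ, Nat.cast_mul, Nat.cast_succ, mul_assoc] at h_count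
  rw [one_div, ← mul_left_cancel₀ (Nat.cast_add_one_ne_zero k) h_count, inv_mul_cancel_left₀ h_fact]

theorem alternatizeUncurryFin_wedgeAlt_left (φ : E →L[ℝ] E [⋀^Fin k]→L[ℝ] ℝ)
    (b : E [⋀^Fin l]→L[ℝ] ℝ) (v : Fin (k + l + 1) → E) :
    ContinuousAlternatingMap.alternatizeUncurryFin ((wedgeCLM E k l).flip b ∘L φ) v =
      wedgeAlt (ContinuousAlternatingMap.alternatizeUncurryFin φ) b
        (v ∘ finCongr (Nat.add_right_comm k 1 l)) := by
  have h_cast (w : Fin (k + l + 1) → E) :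
      φ (w 0) (Fin.tail w ∘ Fin.castAdd l) * b (Fin.tail w ∘ Fin.natAdd k) =
        φ (((w ∘ finCongr (Nat.add_right_comm k 1 l)) ∘ Fin.castAdd l) 0)
            (Fin.tail ((w ∘ finCongr (Nat.add_right_comm k 1 l)) ∘ Fin.castAdd l)) *
          b ((w ∘ finCongr (Nat.add_right_comm k 1 l)) ∘ Fin.natAdd (k + 1)) := by
    congr 2
    ext i
    exact congrArg w (Fin.ext (by simp [Nat.add_right_comm]))
  simp only [alternatizeUncurryFin_apply_altSum, ContinuousLinearMap.comp_apply,
    ContinuousLinearMap.flip_apply, wedgeCLM_apply, wedgeAlt_apply, altSum_const_mul,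
    mul_assoc (1 / _ : ℝ)]
  rw [altSum_altSum_tail fun x (u : Fin (k + l) → E) =>
    φ x (u ∘ Fin.castAdd l) * b (u ∘ Fin.natAdd k),
    altSum_altSum_mul (fun u => φ (u 0) (Fin.tail u)) b, ← altSum_comp_equiv]
  simp only [← h_cast, nsmul_eq_mul]
  field_simp

theorem alternatizeUncurryFin_wedgeAlt_right (a : E [⋀^Fin k]→L[ℝ] ℝ)
    (φ : E →L[ℝ] E [⋀^Fin l]→L[ℝ] ℝ) :
    ContinuousAlternatingMap.alternatizeUncurryFin (wedgeCLM E k l a ∘L φ) =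
      (-1 : ℝ) ^ k • wedgeAlt a (ContinuousAlternatingMap.alternatizeUncurryFin φ) := by
  ext v
  let f : (Fin (k + l + 1) → E) → ℝ := fun w =>
    a (w ∘ Fin.castAdd (l + 1)) * φ (w (Fin.natAdd k (0 : Fin (l + 1))))
      (Fin.tail (w ∘ Fin.natAdd k : Fin (l + 1) → E))
  let ρ : Equiv.Perm (Fin (k + l + 1)) := Fin.cycleRange (Fin.natAdd k (0 : Fin (l + 1)))
  have h_cycle (w : Fin (k + l + 1) → E) :
      a (Fin.tail w ∘ Fin.castAdd l) * φ (w 0) (Fin.tail w ∘ Fin.natAdd k) = f (w ∘ ρ) := by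
    have h_first (i : Fin k) : ρ (Fin.castAdd (l + 1) i) = (Fin.castAdd l i).succ :=
      Fin.ext (Fin.coe_cycleRange_of_lt (Fin.lt_def.2 (i.2.trans_le (Nat.le_add_right k 0))))
    have h_middle : ρ (Fin.natAdd k (0 : Fin (l + 1))) = 0 := Fin.cycleRange_self _
    have h_last (i : Fin l) : ρ (Fin.natAdd k i.succ) = (Fin.natAdd k i).succ :=
      Fin.cycleRange_of_gt (Nat.add_lt_add_left i.succ_pos k)
    simp only [f, comp_apply, h_middle]
    congr 2
    · ext i
      simp [Fin.tail, h_first]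
    · ext i
      simp [Fin.tail, h_last]
  have h_absorb : altSum (fun w : Fin (k + (l + 1)) → E => a (w ∘ Fin.castAdd (l + 1)) *
      altSum (fun u : Fin (l + 1) → E => φ (u 0) (Fin.tail u)) (w ∘ Fin.natAdd k)) v =
      l.succ.factorial * altSum f v := altSum_mul_altSum a (fun u => φ (u 0) (Fin.tail u)) v
  simp only [alternatizeUncurryFin_apply_altSum, ContinuousLinearMap.comp_apply,
    wedgeCLM_apply, wedgeAlt_apply, altSum_const_mul, ContinuousAlternatingMap.smul_apply,
    mul_left_comm (a _) (1 / _ : ℝ)]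
  rw [altSum_altSum_tail fun x (u : Fin (k + l) → E) =>
    a (u ∘ Fin.castAdd l) * φ x (u ∘ Fin.natAdd k),
    h_absorb]
  have h_sign : Equiv.Perm.sign ρ = (-1) ^ k := by simp [ρ, Fin.sign_cycleRange]
  simp only [h_cycle, altSum_comp_perm, h_sign, nsmul_eq_mul, Units.smul_def, zsmul_eq_mul,
    smul_eq_mul]
  push_cast
  field_simp

theorem extDerivWithin_wedgeAlt {a : E → E [⋀^Fin k]→L[ℝ] ℝ} {b : E → E [⋀^Fin l]→L[ℝ] ℝ}
    {s : Set E} {x : E} (ha : DifferentiableWithinAt ℝ a s x)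
    (hb : DifferentiableWithinAt ℝ b s x) (hs : UniqueDiffWithinAt ℝ s x)
    (v : Fin (k + l + 1) → E) :
    extDerivWithin (fun y => wedgeAlt (a y) (b y)) s x v =
      wedgeAlt (extDerivWithin a s x) (b x) (v ∘ finCongr (Nat.add_right_comm k 1 l)) +
        (-1) ^ k * wedgeAlt (a x) (extDerivWithin b s x) v := by
  have h : fderivWithin ℝ (fun y => wedgeAlt (a y) (b y)) s x =
      (wedgeCLM E k l).flip (b x) ∘L fderivWithin ℝ a s x +
        wedgeCLM E k l (a x) ∘L fderivWithin ℝ b s x :=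
    ContinuousLinearMap.ext (fderivWithin_wedgeAlt ha hb hs)
  rw [extDerivWithin, h, ContinuousAlternatingMap.alternatizeUncurryFin_add,
    ContinuousAlternatingMap.add_apply, alternatizeUncurryFin_wedgeAlt_left,
    alternatizeUncurryFin_wedgeAlt_right, ContinuousAlternatingMap.smul_apply, smul_eq_mul]
  rfl

end Leibniz

/-! ### Calculus of forms in charts -/

section Charts

variable {E : Type*} [NormedAddCommGroup E] [NormedSpace ℝ E]
  {H : Type*} [TopologicalSpace H] {I : ModelWithCorners ℝ E H}
  {M : Type*} [TopologicalSpace M] [ChartedSpace H M] {k l : ℕ}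

/-- The value of a form, regarded as a covector of the model space. -/
def covec (η : Form I M k) (p : M) : E [⋀^Fin k]→L[ℝ] ℝ := η p

theorem chartRep_wedge (q : M) (α : Form I M k) (β : Form I M l) (y : E) :
    chartRep q (wedge α β) y = wedgeAlt (chartRep q α y) (chartRep q β y) :=
  wedgeAlt_compContinuousLinearMap _ _ _

theorem chartRep_zero (q : M) : chartRep q (0 : Form I M k) = 0 := rfl

theorem chartRep_of_eq_zero (q : M) {α : Form I M k} {y : E}
    (h : α ((extChartAt I q).symm y) = 0) : chartRep q α y = 0 := by
  rw [chartRep, h]; rfl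

/-- The product of a form with a function. -/
def fsmul (f : M → ℝ) (α : Form I M k) : Form I M k := fun p => f p • α p

theorem chartRep_fsmul (q : M) (f : M → ℝ) (α : Form I M k) (y : E) :
    chartRep q (fsmul f α) y = f ((extChartAt I q).symm y) • chartRep q α y := rfl

theorem uniqueDiffWithinAt_range {q : M} {y : E} (hy : y ∈ (extChartAt I q).target) :
    UniqueDiffWithinAt ℝ (range I) y :=
  I.uniqueDiffOn y (extChartAt_target_subset_range q hy)

theorem coordChange_mem_target (p q : M) {y : E}
    (hp : (extChartAt I q).symm y ∈ (chartAt H p).source) :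
    (extChartAt I p ∘ (extChartAt I q).symm) y ∈ (extChartAt I p).target :=
  (extChartAt I p).map_source (by rwa [extChartAt_source])

theorem extChartAt_symm_coordChange (p q : M) {y : E}
    (hp : (extChartAt I q).symm y ∈ (chartAt H p).source) :
    (extChartAt I p).symm ((extChartAt I p ∘ (extChartAt I q).symm) y) =
      (extChartAt I q).symm y :=
  (extChartAt I p).left_inv (by rwa [extChartAt_source])

theorem eventually_mem_source (p q : M) {y : E} (hy : y ∈ (extChartAt I q).target)
    (hp : (extChartAt I q).symm y ∈ (chartAt H p).source) :
    ∀ᶠ x in 𝓝[range I] y, x ∈ (extChartAt I q).target ∧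
      (extChartAt I q).symm x ∈ (chartAt H p).source := by
  refine Filter.Eventually.and (extChartAt_target_mem_nhdsWithin_of_mem hy) ?_
  exact (continuousAt_extChartAt_symm'' hy).continuousWithinAt.eventually
    ((chartAt H p).open_source.mem_nhds hp)

theorem isCompact_image_extChartAt (q : M) {S : Set M} (hS : IsCompact S)
    (hSq : S ⊆ (extChartAt I q).source) : IsCompact (extChartAt I q '' S) :=
  hS.image_of_continuousOn ((continuousOn_extChartAt q).mono hSq)

theorem image_extChartAt_subset_target (q : M) {S : Set M} (hSq : S ⊆ (extChartAt I q).source) :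
    extChartAt I q '' S ⊆ (extChartAt I q).target :=
  ((extChartAt I q).mapsTo.mono_left hSq).image_subset

theorem IsSmoothForm.contDiffWithinAt {η : Form I M k} (hη : IsSmoothForm η) {q : M} {y : E}
    (hy : y ∈ (extChartAt I q).target) : ContDiffWithinAt ℝ ∞ (chartRep q η) (range I) y :=
  (hη q y hy).mono_of_mem_nhdsWithin (extChartAt_target_mem_nhdsWithin_of_mem hy)

theorem IsSmoothForm.differentiableWithinAt {η : Form I M k} (hη : IsSmoothForm η) {q : M} {y : E}
    (hy : y ∈ (extChartAt I q).target) : DifferentiableWithinAt ℝ (chartRep q η) (range I) y :=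
  (hη.contDiffWithinAt hy).differentiableWithinAt (by simp)

variable [IsManifold I ∞ M]

theorem contDiffWithinAt_coordChange (p q : M) {y : E} (hy : y ∈ (extChartAt I q).target)
    (hp : (extChartAt I q).symm y ∈ (chartAt H p).source) :
    ContDiffWithinAt ℝ ∞ (extChartAt I p ∘ (extChartAt I q).symm) (range I) y := by
  refine contDiffWithinAt_ext_coord_change p q ?_
  rw [PartialEquiv.trans_source, PartialEquiv.symm_source]
  exact ⟨hy, by simpa using hp⟩

theorem mfderivWithin_extChartAt_symm_eq (q : M) {y : E} (hy : y ∈ (extChartAt I q).target) :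
    (mfderivWithin 𝓘(ℝ, E) I (extChartAt I q).symm (range I) y : E →L[ℝ] E) =
      fderivWithin ℝ (extChartAt I ((extChartAt I q).symm y) ∘ (extChartAt I q).symm)
        (range I) y := by
  rw [(mdifferentiableWithinAt_extChartAt_symm (I := I) hy).mfderivWithin]
  simp only [writtenInExtChartAt, extChartAt_model_space_eq_id, PartialEquiv.refl_symm,
    PartialEquiv.refl_coe, preimage_id_eq, id_eq, comp_id, modelWithCornersSelf_coe, range_id,
    inter_univ]
  rfl

theorem chartRep_eq (q : M) (η : Form I M k) {y : E} (hy : y ∈ (extChartAt I q).target) :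
    chartRep q η y = (covec η ((extChartAt I q).symm y)).compContinuousLinearMap
      (fderivWithin ℝ (extChartAt I ((extChartAt I q).symm y) ∘ (extChartAt I q).symm)
        (range I) y) := by
  rw [← mfderivWithin_extChartAt_symm_eq q hy]
  rfl

theorem chartRep_self (p : M) (η : Form I M k) :
    chartRep p η (extChartAt I p p) = covec η p := by
  have h_id : (mfderivWithin 𝓘(ℝ, E) I (extChartAt I p).symm (range I) (extChartAt I p p) :
      E →L[ℝ] E) = ContinuousLinearMap.id ℝ E := mfderivWithin_range_extChartAt_symm
  have h_chart : chartRep p η (extChartAt I p p) =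
      (covec η ((extChartAt I p).symm (extChartAt I p p))).compContinuousLinearMap
        (mfderivWithin 𝓘(ℝ, E) I (extChartAt I p).symm (range I) (extChartAt I p p) :
          E →L[ℝ] E) := rfl
  rw [h_chart, h_id, extChartAt_to_inv (I := I) p]
  rfl

theorem fderivWithin_coordChange_comp (p q r : M) {y : E} (hy : y ∈ (extChartAt I q).target)
    (hp : (extChartAt I q).symm y ∈ (chartAt H p).source)
    (hr : (extChartAt I q).symm y ∈ (chartAt H r).source) :
    fderivWithin ℝ (extChartAt I r ∘ (extChartAt I q).symm) (range I) y =
      (fderivWithin ℝ (extChartAt I r ∘ (extChartAt I p).symm) (range I)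
        ((extChartAt I p ∘ (extChartAt I q).symm) y)).comp
      (fderivWithin ℝ (extChartAt I p ∘ (extChartAt I q).symm) (range I) y) := by
  have h_symm := extChartAt_symm_coordChange (I := I) p q hp
  have h_qp := (contDiffWithinAt_coordChange p q hy hp).differentiableWithinAt (by simp)
  have h_pr := (contDiffWithinAt_coordChange r p (coordChange_mem_target p q hp)
    (by rwa [h_symm])).differentiableWithinAt (by simp)
  have h_maps : MapsTo (extChartAt I p ∘ (extChartAt I q).symm) (range I) (range I) :=
    fun x _ => mem_range_self _
  rw [← fderivWithin_comp y h_pr h_qp h_maps (uniqueDiffWithinAt_range hy)]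
  refine Filter.EventuallyEq.fderivWithin_eq ?_ (congrArg (extChartAt I r) h_symm.symm)
  filter_upwards [eventually_mem_source p q hy hp] with x hx
  exact congrArg (extChartAt I r) (extChartAt_symm_coordChange (I := I) p q hx.2).symm

theorem chartRep_coordChange (p q : M) (η : Form I M k) {y : E}
    (hy : y ∈ (extChartAt I q).target) (hp : (extChartAt I q).symm y ∈ (chartAt H p).source) :
    chartRep q η y =
      (chartRep p η ((extChartAt I p ∘ (extChartAt I q).symm) y)).compContinuousLinearMap
        (fderivWithin ℝ (extChartAt I p ∘ (extChartAt I q).symm) (range I) y) := by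
  rw [chartRep_eq q η hy, chartRep_eq p η (coordChange_mem_target p q hp),
    extChartAt_symm_coordChange p q hp,
    fderivWithin_coordChange_comp p q _ hy hp (mem_chart_source H _)]
  rfl

theorem covec_extD (p : M) (η : Form I M k) :
    covec (extD η) p = extDerivWithin (chartRep p η) (range I) (extChartAt I p p) := by
  have h_id : (mfderiv I 𝓘(ℝ, E) (extChartAt I p) p : E →L[ℝ] E) = ContinuousLinearMap.id ℝ E :=
    mfderiv_extChartAt_self
  have h_extD : covec (extD η) p =
      (extDerivWithin (chartRep p η) (range I) (extChartAt I p p)).compContinuousLinearMap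
        (mfderiv I 𝓘(ℝ, E) (extChartAt I p) p : E →L[ℝ] E) := rfl
  rw [h_extD, h_id]
  rfl

theorem minSmoothness_two_le_infty : minSmoothness ℝ 2 ≤ ∞ := by
  rw [minSmoothness_of_isRCLikeNormedField]
  exact WithTop.coe_le_coe.2 le_top

theorem chartRep_extD {η : Form I M k} (hη : IsSmoothForm η) (q : M) {y : E}
    (hy : y ∈ (extChartAt I q).target) :
    chartRep q (extD η) y = extDerivWithin (chartRep q η) (range I) y := by
  set p := (extChartAt I q).symm y
  have hp : (extChartAt I q).symm y ∈ (chartAt H p).source := mem_chart_source H p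
  have hy_range := extChartAt_target_subset_range q hy
  have h_pullback : extDerivWithin (fun x =>
      (chartRep p η ((extChartAt I p ∘ (extChartAt I q).symm) x)).compContinuousLinearMap
        (fderivWithin ℝ (extChartAt I p ∘ (extChartAt I q).symm) (range I) x)) (range I) y =
      (extDerivWithin (chartRep p η) (range I) ((extChartAt I p ∘ (extChartAt I q).symm) y)
        ).compContinuousLinearMap
        (fderivWithin ℝ (extChartAt I p ∘ (extChartAt I q).symm) (range I) y) :=
    extDerivWithin_pullback (r := ∞)
      (hη.differentiableWithinAt (coordChange_mem_target p q hp))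
      (contDiffWithinAt_coordChange p q hy hp) minSmoothness_two_le_infty
      I.uniqueDiffOn (I.range_subset_closure_interior hy_range) hy_range
      fun x _ => mem_range_self _
  have h_covec : covec (extD η) p = extDerivWithin (chartRep p η) (range I)
    ((extChartAt I p ∘ (extChartAt I q).symm) y) := covec_extD p η
  rw [chartRep_eq q _ hy, h_covec, ← h_pullback]
  refine (Filter.EventuallyEq.extDerivWithin_eq_of_mem ?_ hy_range).symm
  filter_upwards [eventually_mem_source p q hy hp] with x hx
  exact chartRep_coordChange p q η hx.1 hx.2

theorem extDerivWithin_contDiffOn {s : Set E} {η : E → E [⋀^Fin k]→L[ℝ] ℝ}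
    (h : ContDiffOn ℝ ∞ η s) (hs : UniqueDiffOn ℝ s) :
    ContDiffOn ℝ ∞ (extDerivWithin η s) s :=
  (ContinuousAlternatingMap.alternatizeUncurryFinCLM ℝ E ℝ).contDiff.comp_contDiffOn
    (h.fderivWithin hs (by simp))

theorem IsSmoothForm.extD {η : Form I M k} (hη : IsSmoothForm η) : IsSmoothForm (extD η) := by
  intro q
  refine (extDerivWithin_contDiffOn (hη q) (uniqueDiffOn_extChartAt_target q)).congr fun y hy => ?_
  rw [chartRep_extD hη q hy, extDerivWithin, extDerivWithin,
    fderivWithin_of_mem_nhdsWithin (extChartAt_target_mem_nhdsWithin_of_mem hy)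
      (uniqueDiffWithinAt_range hy) ((hη q y hy).differentiableWithinAt (by simp))]

omit [IsManifold I ∞ M]

theorem IsSmoothForm.add {α β : Form I M k} (hα : IsSmoothForm α) (hβ : IsSmoothForm β) :
    IsSmoothForm (α + β) := fun q => (hα q).add (hβ q)

theorem IsSmoothForm.sub {α β : Form I M k} (hα : IsSmoothForm α) (hβ : IsSmoothForm β) :
    IsSmoothForm (α - β) := fun q => (hα q).sub (hβ q)

theorem IsSmoothForm.smul {α : Form I M k} (c : ℝ) (hα : IsSmoothForm α) :
    IsSmoothForm (c • α) := fun q => (hα q).const_smul c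

theorem isSmoothForm_zero : IsSmoothForm (0 : Form I M k) := fun q =>
  contDiffOn_const (c := (0 : E [⋀^Fin k]→L[ℝ] ℝ)).congr fun _ _ => by
    rw [chartRep_zero]; rfl

theorem IsSmoothForm.sum {ι : Type*} {s : Finset ι} {α : ι → Form I M k}
    (hα : ∀ i ∈ s, IsSmoothForm (α i)) : IsSmoothForm (∑ i ∈ s, α i) := by
  classical
  induction s using Finset.induction_on with
  | empty => simpa using isSmoothForm_zero
  | insert a s ha ih =>
    rw [Finset.sum_insert ha]
    exact (hα a (by simp)).add (ih fun i hi => hα i (by simp [hi]))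

theorem IsSmoothForm.wedge {α : Form I M k} {β : Form I M l} (hα : IsSmoothForm α)
    (hβ : IsSmoothForm β) : IsSmoothForm (wedge α β) := fun q =>
  (contDiffOn_wedgeAlt (hα q) (hβ q)).congr fun y _ => chartRep_wedge q α β y

theorem contDiffOn_comp_extChartAt_symm [IsManifold I ∞ M] {f : M → ℝ}
    (hf : ContMDiff I 𝓘(ℝ, ℝ) ∞ f) (q : M) :
    ContDiffOn ℝ ∞ (f ∘ (extChartAt I q).symm) (extChartAt I q).target :=
  contMDiffOn_iff_contDiffOn.1 (hf.comp_contMDiffOn (contMDiffOn_extChartAt_symm q))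

theorem IsSmoothForm.fsmul [IsManifold I ∞ M] {f : M → ℝ} {α : Form I M k}
    (hf : ContMDiff I 𝓘(ℝ, ℝ) ∞ f) (hα : IsSmoothForm α) : IsSmoothForm (fsmul f α) := fun q =>
  (contDiffOn_comp_extChartAt_symm hf q).smul (hα q)

theorem uniqueDiffWithinAt_extChartAt (p : M) :
    UniqueDiffWithinAt ℝ (range I) (extChartAt I p p) :=
  uniqueDiffWithinAt_range (mem_extChartAt_target p)

theorem form_ext {α β : Form I M k} (h : ∀ p, covec α p = covec β p) : α = β := funext h

variable [IsManifold I ∞ M]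

theorem extD_add {α β : Form I M k} (hα : IsSmoothForm α) (hβ : IsSmoothForm β) :
    extD (α + β) = extD α + extD β := by
  refine form_ext fun p => ?_
  have h := mem_extChartAt_target (I := I) p
  refine (covec_extD p _).trans ((extDerivWithin_add (uniqueDiffWithinAt_extChartAt p)
    (hα.differentiableWithinAt h) (hβ.differentiableWithinAt h)).trans ?_)
  rw [← covec_extD, ← covec_extD]
  rfl

theorem extD_smul (c : ℝ) (α : Form I M k) : extD (c • α) = c • extD α := by
  refine form_ext fun p => ?_
  refine (covec_extD p _).trans
    ((extDerivWithin_smul c (chartRep p α) (uniqueDiffWithinAt_extChartAt p)).trans ?_)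
  rw [← covec_extD]
  rfl

theorem extD_sum {ι : Type*} {s : Finset ι} {α : ι → Form I M k}
    (hα : ∀ i ∈ s, IsSmoothForm (α i)) : extD (∑ i ∈ s, α i) = ∑ i ∈ s, extD (α i) := by
  classical
  induction s using Finset.induction_on with
  | empty => simpa using extD_smul (0 : ℝ) (0 : Form I M k)
  | insert a s ha ih =>
    have hs : ∀ i ∈ s, IsSmoothForm (α i) := fun i hi => hα i (by simp [hi])
    rw [Finset.sum_insert ha, Finset.sum_insert ha,
      extD_add (hα a (by simp)) (IsSmoothForm.sum hs), ih hs]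

theorem extD_wedge_apply {α : Form I M k} {β : Form I M l} (hα : IsSmoothForm α)
    (hβ : IsSmoothForm β) (p : M) (v : Fin (k + l + 1) → E) :
    covec (extD (wedge α β)) p v =
      covec (wedge (extD α) β) p (v ∘ finCongr (Nat.add_right_comm k 1 l)) +
        (-1) ^ k * covec (wedge α (extD β)) p v := by
  have hp := mem_extChartAt_target (I := I) p
  rw [covec_extD, show chartRep p (wedge α β) = _ from funext (chartRep_wedge p α β),
    extDerivWithin_wedgeAlt (hα.differentiableWithinAt hp) (hβ.differentiableWithinAt hp)
      (uniqueDiffWithinAt_extChartAt p), ← covec_extD, ← covec_extD,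
    chartRep_self, chartRep_self]
  rfl

theorem extD_wedge_one_one {α β : Form I M 1} (hα : IsSmoothForm α) (hβ : IsSmoothForm β) :
    extD (wedge α β) = (wedge (extD α) β : Form I M 3) - (wedge α (extD β) : Form I M 3) :=
  form_ext fun p => ContinuousAlternatingMap.ext fun v =>
    (extD_wedge_apply hα hβ p v).trans (by rw [pow_one, neg_one_mul, ← sub_eq_add_neg]; rfl)

theorem extD_wedge_one_two {α : Form I M 1} {β : Form I M 2} (hα : IsSmoothForm α)
    (hβ : IsSmoothForm β) :
    extD (wedge α β) = (wedge (extD α) β : Form I M 4) - (wedge α (extD β) : Form I M 4) :=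
  form_ext fun p => ContinuousAlternatingMap.ext fun v =>
    (extD_wedge_apply hα hβ p v).trans (by rw [pow_one, neg_one_mul, ← sub_eq_add_neg]; rfl)

theorem extD_extD {α : Form I M k} (hα : IsSmoothForm α) : extD (extD α) = 0 := by
  refine form_ext fun p => ?_
  have hp := mem_extChartAt_target (I := I) p
  have hp_range := extChartAt_target_subset_range p hp
  have h_near : chartRep p (extD α) =ᶠ[𝓝[range I] (extChartAt I p p)]
      extDerivWithin (chartRep p α) (range I) := by
    filter_upwards [extChartAt_target_mem_nhdsWithin p] with y hy
    exact chartRep_extD hα p hy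
  rw [covec_extD, h_near.extDerivWithin_eq_of_mem hp_range]
  exact extDerivWithin_extDerivWithin_apply (hα.contDiffWithinAt hp) minSmoothness_two_le_infty
    I.uniqueDiffOn (I.range_subset_closure_interior hp_range) hp_range

theorem extD_eq_zero {α : Form I M k} {p : M} (h : ∀ᶠ r in 𝓝 p, α r = 0) : extD α p = 0 := by
  have h_near : chartRep p α =ᶠ[𝓝[range I] (extChartAt I p p)] fun _ => 0 := by
    have h_cont : ContinuousAt (extChartAt I p).symm (extChartAt I p p) :=
      continuousAt_extChartAt_symm p
    rw [ContinuousAt, extChartAt_to_inv] at h_cont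
    filter_upwards [nhdsWithin_le_nhds (h_cont.eventually h)] with y hy
    exact chartRep_of_eq_zero p hy
  refine (covec_extD p _).trans ((h_near.extDerivWithin_eq_of_mem
    (extChartAt_target_subset_range p (mem_extChartAt_target p))).trans ?_)
  simp only [extDerivWithin, fderivWithin_fun_const, Pi.zero_apply]
  exact map_zero (ContinuousAlternatingMap.alternatizeUncurryFinCLM ℝ E ℝ)

end Charts

/-! ### The algebra of triples of forms -/

section TripleForms

variable {E : Type*} [NormedAddCommGroup E] [NormedSpace ℝ E]
  {H : Type*} [TopologicalSpace H] {I : ModelWithCorners ℝ E H}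
  {M : Type*} [TopologicalSpace M] [ChartedSpace H M] {k l : ℕ}

theorem wedge_add_left (a a' : Form I M k) (b : Form I M l) :
    wedge (a + a') b = wedge a b + wedge a' b := funext fun _ => wedgeAlt_add_left _ _ _

theorem wedge_add_right (a : Form I M k) (b b' : Form I M l) :
    wedge a (b + b') = wedge a b + wedge a b' := funext fun _ => wedgeAlt_add_right _ _ _

theorem wedge_smul_left (c : ℝ) (a : Form I M k) (b : Form I M l) :
    wedge (c • a) b = c • wedge a b := funext fun _ => wedgeAlt_smul_left _ _ _

theorem wedge_smul_right (c : ℝ) (a : Form I M k) (b : Form I M l) :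
    wedge a (c • b) = c • wedge a b := funext fun _ => wedgeAlt_smul_right _ _ _

theorem wedge_neg_left (a : Form I M k) (b : Form I M l) : wedge (-a) b = -wedge a b :=
  map_neg (AddMonoidHom.mk' (wedge · b) fun a a' => wedge_add_left a a' b) a

theorem wedge_sub_left (a a' : Form I M k) (b : Form I M l) :
    wedge (a - a') b = wedge a b - wedge a' b :=
  map_sub (AddMonoidHom.mk' (wedge · b) fun a a' => wedge_add_left a a' b) a a'

theorem wedge_sub_right (a : Form I M k) (b b' : Form I M l) :
    wedge a (b - b') = wedge a b - wedge a b' :=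
  map_sub (AddMonoidHom.mk' (wedge a) (wedge_add_right a)) b b'

theorem wedge_zero_left (b : Form I M l) : wedge (0 : Form I M k) b = 0 :=
  funext fun _ => wedgeAlt_zero_left _

theorem wedge_zero_right (a : Form I M k) : wedge a (0 : Form I M l) = 0 :=
  funext fun _ => wedgeAlt_zero_right _

theorem wedge_sum_left {ι : Type*} (s : Finset ι) (f : ι → Form I M k) (b : Form I M l) :
    wedge (∑ i ∈ s, f i) b = ∑ i ∈ s, wedge (f i) b :=
  map_sum (AddMonoidHom.mk' (wedge · b) fun a a' => wedge_add_left a a' b) f s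

theorem wedge_sum_right {ι : Type*} (s : Finset ι) (a : Form I M k) (f : ι → Form I M l) :
    wedge a (∑ i ∈ s, f i) = ∑ i ∈ s, wedge a (f i) :=
  map_sum (AddMonoidHom.mk' (wedge a) (wedge_add_right a)) f s

theorem wedge_comm_one_one (a b : Form I M 1) : wedge a b = -wedge b a :=
  form_ext fun p => ContinuousAlternatingMap.ext fun v =>
    (wedgeAlt_comm (covec a p) (covec b p) v).trans (by norm_num; rfl)

theorem wedge_comm_two_one (a : Form I M 2) (b : Form I M 1) :
    (wedge a b : Form I M 3) = wedge b a :=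
  form_ext fun p => ContinuousAlternatingMap.ext fun v =>
    (wedgeAlt_comm (covec a p) (covec b p) v).trans (by norm_num; rfl)

theorem wedge_comm_two_two (a b : Form I M 2) : wedge a b = wedge b a :=
  form_ext fun p => ContinuousAlternatingMap.ext fun v =>
    (wedgeAlt_comm (covec a p) (covec b p) v).trans (by norm_num; rfl)

theorem wedge_assoc_one_one_one (a b c : Form I M 1) :
    (wedge (wedge a b) c : Form I M 3) = wedge a (wedge b c) :=
  form_ext fun p => ContinuousAlternatingMap.ext fun v =>
    (wedgeAlt_assoc (covec a p) (covec b p) (covec c p) v).trans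
      (congrArg (wedgeAlt (covec a p) (wedgeAlt (covec b p) (covec c p))) (funext fun _ => rfl))

theorem wedge_assoc_one_one_two (a b : Form I M 1) (c : Form I M 2) :
    (wedge (wedge a b) c : Form I M 4) = wedge a (wedge b c) :=
  form_ext fun p => ContinuousAlternatingMap.ext fun v =>
    (wedgeAlt_assoc (covec a p) (covec b p) (covec c p) v).trans
      (congrArg (wedgeAlt (covec a p) (wedgeAlt (covec b p) (covec c p))) (funext fun _ => rfl))

theorem wedge_assoc_two_one_one (a : Form I M 2) (b c : Form I M 1) :
    (wedge (wedge a b) c : Form I M 4) = wedge a (wedge b c) :=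
  form_ext fun p => ContinuousAlternatingMap.ext fun v =>
    (wedgeAlt_assoc (covec a p) (covec b p) (covec c p) v).trans
      (congrArg (wedgeAlt (covec a p) (wedgeAlt (covec b p) (covec c p))) (funext fun _ => rfl))

theorem wedge_left_comm_one_one_one (a b c : Form I M 1) :
    (wedge a (wedge b c) : Form I M 3) = -wedge b (wedge a c) := by
  rw [← wedge_assoc_one_one_one, wedge_comm_one_one a b, wedge_neg_left, wedge_assoc_one_one_one]

theorem sum_eps_smul {N : Type*} [AddCommGroup N] [Module ℝ N] (f : Fin 3 → Fin 3 → N)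
    (i : Fin 3) : ∑ j, ∑ k, eps i j k • f j k = f (i + 1) (i + 2) - f (i + 2) (i + 1) := by
  fin_cases i <;> simp [Fin.sum_univ_three, eps, Matrix.det_fin_three, Pi.single_apply] <;> abel

/-- The bracket `ε_{ijk} aʲ ∧ bᵏ` of triples of forms. -/
def bracket (a : Fin 3 → Form I M k) (b : Fin 3 → Form I M l) : Fin 3 → Form I M (k + l) :=
  fun i => ∑ j, ∑ k, eps i j k • wedge (a j) (b k)

/-- The contraction `a_i ∧ bⁱ` of triples of forms. -/
def pair (a : Fin 3 → Form I M k) (b : Fin 3 → Form I M l) : Form I M (k + l) :=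
  ∑ i, wedge (a i) (b i)

theorem bracket_apply (a : Fin 3 → Form I M k) (b : Fin 3 → Form I M l) (i : Fin 3) :
    bracket a b i = wedge (a (i + 1)) (b (i + 2)) - wedge (a (i + 2)) (b (i + 1)) :=
  sum_eps_smul _ i

theorem bracket_add_left (a a' : Fin 3 → Form I M k) (b : Fin 3 → Form I M l) :
    bracket (a + a') b = bracket a b + bracket a' b := by
  ext1 i
  simp only [bracket, Pi.add_apply, wedge_add_left, smul_add, Finset.sum_add_distrib]

theorem bracket_add_right (a : Fin 3 → Form I M k) (b b' : Fin 3 → Form I M l) :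
    bracket a (b + b') = bracket a b + bracket a b' := by
  ext1 i
  simp only [bracket, Pi.add_apply, wedge_add_right, smul_add, Finset.sum_add_distrib]

theorem bracket_smul_left (c : ℝ) (a : Fin 3 → Form I M k) (b : Fin 3 → Form I M l) :
    bracket (c • a) b = c • bracket a b := by
  ext1 i
  simp only [bracket, Pi.smul_apply, wedge_smul_left, smul_comm _ c, Finset.smul_sum]

theorem bracket_smul_right (c : ℝ) (a : Fin 3 → Form I M k) (b : Fin 3 → Form I M l) :
    bracket a (c • b) = c • bracket a b := by
  ext1 i
  simp only [bracket, Pi.smul_apply, wedge_smul_right, smul_comm _ c, Finset.smul_sum]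

theorem pair_add_left (a a' : Fin 3 → Form I M k) (b : Fin 3 → Form I M l) :
    pair (a + a') b = pair a b + pair a' b := by
  simp only [pair, Pi.add_apply, wedge_add_left, Finset.sum_add_distrib]

theorem pair_add_right (a : Fin 3 → Form I M k) (b b' : Fin 3 → Form I M l) :
    pair a (b + b') = pair a b + pair a b' := by
  simp only [pair, Pi.add_apply, wedge_add_right, Finset.sum_add_distrib]

theorem pair_smul_left (c : ℝ) (a : Fin 3 → Form I M k) (b : Fin 3 → Form I M l) :
    pair (c • a) b = c • pair a b := by
  simp only [pair, Pi.smul_apply, wedge_smul_left, Finset.smul_sum]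

theorem pair_smul_right (c : ℝ) (a : Fin 3 → Form I M k) (b : Fin 3 → Form I M l) :
    pair a (c • b) = c • pair a b := by
  simp only [pair, Pi.smul_apply, wedge_smul_right, Finset.smul_sum]

theorem pair_neg_right (a : Fin 3 → Form I M k) (b : Fin 3 → Form I M l) :
    pair a (-b) = -pair a b :=
  (AddMonoidHom.mk' (pair a) (pair_add_right a)).map_neg b

theorem bracket_comm (a b : Fin 3 → Form I M 1) : bracket a b = bracket b a := by
  ext1 i
  rw [bracket_apply, bracket_apply, wedge_comm_one_one (b _), wedge_comm_one_one (b _)]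
  abel

theorem bracket_two_one (a : Fin 3 → Form I M 1) (b : Fin 3 → Form I M 2) :
    (bracket b a : Fin 3 → Form I M 3) = -(bracket a b : Fin 3 → Form I M 3) := by
  ext1 i
  refine (bracket_apply b a i).trans ?_
  rw [Pi.neg_apply, wedge_comm_two_one (b _), wedge_comm_two_one (b _)]
  exact ((congrArg Neg.neg (bracket_apply a b i)).trans (neg_sub _ _)).symm

theorem bracket_jacobi (a b c : Fin 3 → Form I M 1) :
    (bracket a (bracket b c) : Fin 3 → Form I M 3) =
      (bracket (bracket a b) c : Fin 3 → Form I M 3) - bracket b (bracket a c) := by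
  ext1 i
  rw [Pi.sub_apply]
  refine (bracket_apply a (bracket b c) i).trans (Eq.trans ?_ (congrArg₂ HSub.hSub
    (bracket_apply (bracket a b) c i) (bracket_apply b (bracket a c) i)).symm)
  simp only [bracket_apply, wedge_sub_left, wedge_sub_right, wedge_assoc_one_one_one,
    wedge_left_comm_one_one_one (b _) (a _)]
  fin_cases i <;> simp <;> abel

theorem pair_comm (b c : Fin 3 → Form I M 2) : pair b c = pair c b :=
  Finset.sum_congr rfl fun _ _ => wedge_comm_two_two _ _

theorem pair_bracket_left (a x : Fin 3 → Form I M 1) (b : Fin 3 → Form I M 2) :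
    (pair (bracket a x) b : Form I M 4) =
      (pair x (bracket a b : Fin 3 → Form I M 3) : Form I M 4) := by
  have h_right (i : Fin 3) := congrArg (wedge (x i)) (bracket_apply a b i)
  rw [bracket_comm]
  refine Eq.trans ?_ (Finset.sum_congr rfl fun i _ => h_right i).symm
  simp only [pair, Fin.sum_univ_three, bracket_apply, wedge_sub_left, wedge_sub_right,
    wedge_assoc_one_one_two]
  simp
  abel

theorem bracket_bracket_self_left (a b : Fin 3 → Form I M 1) :
    (2 : ℝ) • (bracket a (bracket a b) : Fin 3 → Form I M 3) =
      (bracket (bracket a a) b : Fin 3 → Form I M 3) := by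
  rw [two_smul]
  nth_rewrite 1 [bracket_jacobi a a b]
  abel

theorem bracket_bracket_self_right (a b : Fin 3 → Form I M 1) :
    (bracket a (bracket b b) : Fin 3 → Form I M 3) =
      (2 : ℝ) • (bracket (bracket a b) b : Fin 3 → Form I M 3) := by
  rw [bracket_jacobi a b b, bracket_two_one b (bracket a b)]
  module

theorem bracket_bracket_self (a : Fin 3 → Form I M 1) :
    (bracket a (bracket a a) : Fin 3 → Form I M 3) = 0 := by
  have h_jacobi := bracket_bracket_self_left a a
  rw [bracket_two_one] at h_jacobi
  have h_three : (3 : ℝ) • (bracket a (bracket a a) : Fin 3 → Form I M 3) = 0 := by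
    rw [show (3 : ℝ) = 2 + 1 by norm_num, add_smul, h_jacobi, one_smul]
    exact neg_add_cancel _
  simpa using h_three

theorem pair_bracket_bracket (a b : Fin 3 → Form I M 1) :
    pair (bracket a b) (bracket b b) = 0 := by
  rw [bracket_comm, pair_bracket_left, bracket_bracket_self]
  exact Finset.sum_eq_zero fun i _ => wedge_zero_right (a i)

theorem epsWedge_eq (e : Fin 3 → Form I M 1) : epsWedge e = bracket e e := rfl

theorem hkCurv_eq (e A : Fin 3 → Form I M 1) : hkCurv e A = bracket e (curv A) := rfl

theorem hkTorsion_eq (e A : Fin 3 → Form I M 1) : hkTorsion e A = bracket (covD A e) e := rfl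

/-- The exterior derivative of a triple of forms. -/
def extD3 (a : Fin 3 → Form I M k) : Fin 3 → Form I M (k + 1) := fun i => extD (a i)

theorem curv_eq (A : Fin 3 → Form I M 1) :
    curv A = extD3 A + (1 / 2 : ℝ) • (bracket A A : Fin 3 → Form I M 2) := rfl

theorem covD_eq (A e : Fin 3 → Form I M 1) :
    covD A e = extD3 e + (bracket A e : Fin 3 → Form I M 2) := rfl

theorem IsSmoothForm.bracket {a : Fin 3 → Form I M k} {b : Fin 3 → Form I M l}
    (ha : ∀ i, IsSmoothForm (a i)) (hb : ∀ i, IsSmoothForm (b i)) (i : Fin 3) :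
    IsSmoothForm (bracket a b i) :=
  IsSmoothForm.sum fun j _ => IsSmoothForm.sum fun k _ => ((ha j).wedge (hb k)).smul _

theorem IsSmoothForm.pair {a : Fin 3 → Form I M k} {b : Fin 3 → Form I M l}
    (ha : ∀ i, IsSmoothForm (a i)) (hb : ∀ i, IsSmoothForm (b i)) :
    IsSmoothForm (pair a b) := IsSmoothForm.sum fun j _ => (ha j).wedge (hb j)

/-- The covariant exterior derivative `Dbⁱ = dbⁱ + εⁱ_{jk} Aʲ ∧ bᵏ` of a triple of 2-forms. -/
def covDTwo (A : Fin 3 → Form I M 1) (b : Fin 3 → Form I M 2) : Fin 3 → Form I M 3 :=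
  extD3 b + (bracket A b : Fin 3 → Form I M 3)

variable [IsManifold I ∞ M]

theorem IsSmoothForm.curv {A : Fin 3 → Form I M 1} (hA : ∀ i, IsSmoothForm (A i)) (i : Fin 3) :
    IsSmoothForm (curv A i) := (hA i).extD.add ((IsSmoothForm.bracket hA hA i).smul _)

theorem IsSmoothForm.covD {A e : Fin 3 → Form I M 1} (hA : ∀ i, IsSmoothForm (A i))
    (he : ∀ i, IsSmoothForm (e i)) (i : Fin 3) :
    IsSmoothForm (covD A e i) := (he i).extD.add (IsSmoothForm.bracket hA he i)

theorem extD3_add {a b : Fin 3 → Form I M k} (ha : ∀ i, IsSmoothForm (a i))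
    (hb : ∀ i, IsSmoothForm (b i)) : extD3 (a + b) = extD3 a + extD3 b :=
  funext fun i => extD_add (ha i) (hb i)

theorem extD3_smul (c : ℝ) (a : Fin 3 → Form I M k) : extD3 (c • a) = c • extD3 a :=
  funext fun i => extD_smul c (a i)

theorem extD3_extD3 {a : Fin 3 → Form I M k} (ha : ∀ i, IsSmoothForm (a i)) :
    extD3 (extD3 a) = 0 := funext fun i => extD_extD (ha i)

theorem extD3_bracket {a b : Fin 3 → Form I M 1} (ha : ∀ i, IsSmoothForm (a i))
    (hb : ∀ i, IsSmoothForm (b i)) :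
    extD3 (bracket a b) = (bracket (extD3 a) b : Fin 3 → Form I M 3) - bracket a (extD3 b) := by
  ext1 i
  have h (j k : Fin 3) := ((ha j).wedge (hb k)).smul (eps i j k)
  change extD (∑ j, ∑ k, eps i j k • wedge (a j) (b k)) = _
  rw [extD_sum fun j _ => IsSmoothForm.sum fun k _ => h j k]
  simp only [extD_sum fun k _ => h _ k, extD_smul, extD_wedge_one_one (ha _) (hb _), smul_sub,
    Finset.sum_sub_distrib]
  rfl

theorem extD_pair {a : Fin 3 → Form I M 1} {b : Fin 3 → Form I M 2} (ha : ∀ i, IsSmoothForm (a i))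
    (hb : ∀ i, IsSmoothForm (b i)) :
    extD (pair a b) = (pair (extD3 a) b : Form I M 4) - pair a (extD3 b) := by
  rw [pair, extD_sum fun j _ => (ha j).wedge (hb j)]
  simp only [extD_wedge_one_two (ha _) (hb _), Finset.sum_sub_distrib]
  rfl

theorem covDTwo_add (A : Fin 3 → Form I M 1) {b c : Fin 3 → Form I M 2}
    (hb : ∀ i, IsSmoothForm (b i)) (hc : ∀ i, IsSmoothForm (c i)) :
    covDTwo A (b + c) = covDTwo A b + covDTwo A c := by
  rw [covDTwo, extD3_add hb hc, bracket_add_right]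
  exact add_add_add_comm _ _ _ _

theorem covDTwo_smul (A : Fin 3 → Form I M 1) (r : ℝ) (b : Fin 3 → Form I M 2) :
    covDTwo A (r • b) = r • covDTwo A b := by
  rw [covDTwo, extD3_smul, bracket_smul_right]
  exact (smul_add _ _ _).symm

theorem extD_pair_covD {x : Fin 3 → Form I M 1} {b : Fin 3 → Form I M 2}
    (hx : ∀ i, IsSmoothForm (x i)) (hb : ∀ i, IsSmoothForm (b i)) (A : Fin 3 → Form I M 1) :
    extD (pair x b) = (pair (covD A x) b : Form I M 4) - pair x (covDTwo A b) := by
  rw [extD_pair hx hb, covD_eq, covDTwo, pair_add_left, pair_add_right, pair_bracket_left]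
  abel

theorem covDTwo_curv {A : Fin 3 → Form I M 1} (hA : ∀ i, IsSmoothForm (A i)) :
    covDTwo A (curv A) = 0 := by
  rw [curv_eq, covDTwo_add (b := extD3 A) (c := (1 / 2 : ℝ) • bracket A A) A (fun i => (hA i).extD)
    (fun i => (IsSmoothForm.bracket hA hA i).smul _), covDTwo_smul]
  simp only [covDTwo, extD3_extD3 hA, extD3_bracket hA hA, bracket_bracket_self,
    bracket_two_one A (extD3 A)]
  module

theorem covDTwo_covD {A e : Fin 3 → Form I M 1} (hA : ∀ i, IsSmoothForm (A i))
    (he : ∀ i, IsSmoothForm (e i)) :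
    covDTwo A (covD A e) = bracket (curv A) e := by
  rw [covD_eq, covDTwo_add (b := extD3 e) A (fun i => (he i).extD)
    (IsSmoothForm.bracket hA he)]
  simp only [covDTwo, extD3_extD3 he, extD3_bracket hA he, curv_eq, bracket_add_left,
    bracket_smul_left, ← bracket_bracket_self_left]
  module

theorem covDTwo_epsWedge (A : Fin 3 → Form I M 1) {e : Fin 3 → Form I M 1}
    (he : ∀ i, IsSmoothForm (e i)) :
    covDTwo A (epsWedge e) = (2 : ℝ) • (bracket (covD A e) e : Fin 3 → Form I M 3) := by
  rw [epsWedge_eq, covDTwo, extD3_bracket he he, bracket_bracket_self_right, covD_eq,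
    bracket_add_left, bracket_two_one e (extD3 e)]
  module

end TripleForms

/-! ### The first variation of the action -/

section Variation

variable {E : Type*} [NormedAddCommGroup E] [NormedSpace ℝ E]
  {H : Type*} [TopologicalSpace H] {I : ModelWithCorners ℝ E H}
  {M : Type*} [TopologicalSpace M] [ChartedSpace H M]

theorem eps_cyclic (i j k : Fin 3) : eps i j k = eps k i j := by
  fin_cases i <;> fin_cases j <;> fin_cases k <;>
    simp [eps, Matrix.det_fin_three]

theorem sum_eps_smul_wedge_wedge_left (e : Fin 3 → Form I M 1) (b : Fin 3 → Form I M 2) :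
    (∑ i, ∑ j, ∑ k, eps i j k • wedge (wedge (e i) (e j)) (b k) : Form I M 4) =
      pair (epsWedge e) b := by
  simp only [pair, epsWedge, wedge_sum_left, wedge_smul_left]
  rw [Finset.sum_comm_cycle]
  simp only [eps_cyclic]

theorem sum_eps_smul_wedge_wedge_right (b : Fin 3 → Form I M 2) (e : Fin 3 → Form I M 1) :
    (∑ i, ∑ j, ∑ k, eps i j k • wedge (wedge (b i) (e j)) (e k) : Form I M 4) =
      pair b (epsWedge e) := by
  simp only [pair, epsWedge, wedge_sum_right, wedge_smul_right, wedge_assoc_two_one_one]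

/-- The triples `ε_{ijk} eʲ ∧ eᵏ`, `Deⁱ` and `Fⁱ`, of which the Lagrangian is a quadratic
expression. -/
def fieldStrength (e A : Fin 3 → Form I M 1) : Fin 3 → Fin 3 → Form I M 2 :=
  ![epsWedge e, covD A e, curv A]

/-- The first-order part of the change of `fieldStrength` in the direction `(x, a)`. -/
def fieldStrengthVariation (e A x a : Fin 3 → Form I M 1) : Fin 3 → Fin 3 → Form I M 2 :=
  ![(2 : ℝ) • bracket e x, covD A x + bracket a e, covD A a]

/-- The second-order part of the change of `fieldStrength` in the direction `(x, a)`. -/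
def fieldStrengthRemainder (x a : Fin 3 → Form I M 1) : Fin 3 → Fin 3 → Form I M 2 :=
  ![epsWedge x, bracket a x, (1 / 2 : ℝ) • epsWedge a]

/-- The coefficients of the Lagrangian as a quadratic expression in `fieldStrength`. -/
def lagrangianCoeff (α₁ α₂ α₃ α₄ α₅ : ℝ) : Matrix (Fin 3) (Fin 3) ℝ :=
  !![0, 0, α₁; α₄, α₂, 0; 0, α₅, α₃]

theorem lagrangian_eq (α₁ α₂ α₃ α₄ α₅ : ℝ) (e A : Fin 3 → Form I M 1) :
    lagrangian α₁ α₂ α₃ α₄ α₅ e A = α₁ • pair (epsWedge e) (curv A) +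
      α₂ • pair (covD A e) (covD A e) + α₃ • pair (curv A) (curv A) +
      α₄ • pair (covD A e) (epsWedge e) + α₅ • pair (curv A) (covD A e) := by
  rw [lagrangian, sum_eps_smul_wedge_wedge_left, sum_eps_smul_wedge_wedge_right]
  rfl

theorem lagrangian_eq_sum (α₁ α₂ α₃ α₄ α₅ : ℝ) (e A : Fin 3 → Form I M 1) :
    lagrangian α₁ α₂ α₃ α₄ α₅ e A = ∑ i, ∑ j, lagrangianCoeff α₁ α₂ α₃ α₄ α₅ i j •
      (pair (fieldStrength e A i) (fieldStrength e A j) : Form I M 4) := by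
  simp only [lagrangian_eq, Fin.sum_univ_three, lagrangianCoeff, fieldStrength, Matrix.of_apply,
    Matrix.cons_val, zero_smul]
  abel

theorem epsWedge_add_smul (e x : Fin 3 → Form I M 1) (t : ℝ) :
    epsWedge (e + t • x) = epsWedge e + t • ((2 : ℝ) • (bracket e x : Fin 3 → Form I M 2)) +
      t ^ 2 • epsWedge x := by
  simp only [epsWedge_eq, bracket_add_left, bracket_add_right, bracket_smul_left,
    bracket_smul_right, bracket_comm x e]
  module

/-- The first variation of the Lagrangian in the direction `(x, a)`. -/
def firstVariation (α₁ α₂ α₃ α₄ α₅ : ℝ) (e A x a : Fin 3 → Form I M 1) : Form I M 4 :=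
  ∑ i, ∑ j, lagrangianCoeff α₁ α₂ α₃ α₄ α₅ i j •
    (pair (fieldStrength e A i) (fieldStrengthVariation e A x a j) +
      pair (fieldStrengthVariation e A x a i) (fieldStrength e A j))

/-- The triple of boundary 2-forms `c₁ De_i + c₂ ε_{ijk} eʲ ∧ eᵏ + c₃ F_i`; the triples conjugate
to the variations of `e` and of `A` are of this form. -/
def boundaryForm (c₁ c₂ c₃ : ℝ) (e A : Fin 3 → Form I M 1) : Fin 3 → Form I M 2 :=
  c₁ • covD A e + c₂ • epsWedge e + c₃ • curv A

variable [IsManifold I ∞ M]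

theorem curv_add_smul {A a : Fin 3 → Form I M 1} (hA : ∀ i, IsSmoothForm (A i))
    (ha : ∀ i, IsSmoothForm (a i)) (t : ℝ) :
    curv (A + t • a) = curv A + t • covD A a + t ^ 2 • ((1 / 2 : ℝ) • epsWedge a) := by
  rw [curv_eq, curv_eq, covD_eq, extD3_add (b := t • a) hA fun i => (ha i).smul t, extD3_smul]
  simp only [epsWedge_eq, bracket_add_left, bracket_add_right, bracket_smul_left,
    bracket_smul_right, bracket_comm a A]
  module

theorem covD_add_smul {A e a x : Fin 3 → Form I M 1} (he : ∀ i, IsSmoothForm (e i))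
    (hx : ∀ i, IsSmoothForm (x i)) (t : ℝ) :
    covD (A + t • a) (e + t • x) = covD A e +
      t • (covD A x + (bracket a e : Fin 3 → Form I M 2)) +
      t ^ 2 • (bracket a x : Fin 3 → Form I M 2) := by
  rw [covD_eq, covD_eq, covD_eq, extD3_add (b := t • x) he fun i => (hx i).smul t, extD3_smul]
  simp only [bracket_add_left, bracket_add_right, bracket_smul_left, bracket_smul_right]
  module

theorem fieldStrength_add_smul {e A x a : Fin 3 → Form I M 1} (he : ∀ i, IsSmoothForm (e i))
    (hA : ∀ i, IsSmoothForm (A i)) (hx : ∀ i, IsSmoothForm (x i)) (ha : ∀ i, IsSmoothForm (a i))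
    (t : ℝ) (i : Fin 3) :
    fieldStrength (e + t • x) (A + t • a) i = fieldStrength e A i +
      t • fieldStrengthVariation e A x a i + t ^ 2 • fieldStrengthRemainder x a i :=
  match i with
  | 0 => epsWedge_add_smul e x t
  | 1 => covD_add_smul he hx t
  | 2 => curv_add_smul hA ha t

theorem IsSmoothForm.fieldStrength {e A : Fin 3 → Form I M 1} (he : ∀ i, IsSmoothForm (e i))
    (hA : ∀ i, IsSmoothForm (A i)) (i j : Fin 3) : IsSmoothForm (fieldStrength e A i j) :=
  match i with
  | 0 => IsSmoothForm.bracket he he j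
  | 1 => IsSmoothForm.covD hA he j
  | 2 => IsSmoothForm.curv hA j

theorem IsSmoothForm.fieldStrengthVariation {e A x a : Fin 3 → Form I M 1}
    (he : ∀ i, IsSmoothForm (e i)) (hA : ∀ i, IsSmoothForm (A i)) (hx : ∀ i, IsSmoothForm (x i))
    (ha : ∀ i, IsSmoothForm (a i)) (i j : Fin 3) :
    IsSmoothForm (fieldStrengthVariation e A x a i j) :=
  match i with
  | 0 => (IsSmoothForm.bracket he hx j).smul 2
  | 1 => (IsSmoothForm.covD hA hx j).add (IsSmoothForm.bracket ha he j)
  | 2 => IsSmoothForm.covD hA ha j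

omit [IsManifold I ∞ M] in
theorem IsSmoothForm.fieldStrengthRemainder {x a : Fin 3 → Form I M 1}
    (hx : ∀ i, IsSmoothForm (x i)) (ha : ∀ i, IsSmoothForm (a i)) (i j : Fin 3) :
    IsSmoothForm (fieldStrengthRemainder x a i j) :=
  match i with
  | 0 => IsSmoothForm.bracket hx hx j
  | 1 => IsSmoothForm.bracket ha hx j
  | 2 => (IsSmoothForm.bracket ha ha j).smul _

theorem IsSmoothForm.boundaryForm (c₁ c₂ c₃ : ℝ) {e A : Fin 3 → Form I M 1}
    (he : ∀ i, IsSmoothForm (e i)) (hA : ∀ i, IsSmoothForm (A i)) (i : Fin 3) :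
    IsSmoothForm (boundaryForm c₁ c₂ c₃ e A i) :=
  (((IsSmoothForm.covD hA he i).smul c₁).add ((IsSmoothForm.bracket he he i).smul c₂)).add
    ((IsSmoothForm.curv hA i).smul c₃)

theorem covDTwo_boundaryForm (c₁ c₂ c₃ : ℝ) {e A : Fin 3 → Form I M 1}
    (he : ∀ i, IsSmoothForm (e i)) (hA : ∀ i, IsSmoothForm (A i)) :
    covDTwo A (boundaryForm c₁ c₂ c₃ e A) =
      c₁ • (bracket (curv A) e : Fin 3 → Form I M 3) +
        (2 * c₂) • (bracket (covD A e) e : Fin 3 → Form I M 3) := by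
  have hT (i) := (IsSmoothForm.covD hA he i).smul c₁
  have hW (i) := (IsSmoothForm.bracket he he i).smul c₂
  have hF (i) := (IsSmoothForm.curv hA i).smul c₃
  rw [boundaryForm, covDTwo_add (b := c₁ • covD A e + c₂ • epsWedge e) (c := c₃ • curv A) A
      (fun i => (hT i).add (hW i)) hF,
    covDTwo_add (b := c₁ • covD A e) (c := c₂ • epsWedge e) A hT hW]
  simp only [covDTwo_smul, covDTwo_curv hA, covDTwo_covD hA he, covDTwo_epsWedge A he]
  module

theorem firstVariation_eq (α₁ α₂ α₃ α₄ α₅ : ℝ) {e A x a : Fin 3 → Form I M 1}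
    (he : ∀ i, IsSmoothForm (e i)) (hA : ∀ i, IsSmoothForm (A i))
    (hx : ∀ i, IsSmoothForm (x i)) (ha : ∀ i, IsSmoothForm (a i)) :
    firstVariation α₁ α₂ α₃ α₄ α₅ e A x a =
      (2 * (α₁ - α₂)) • (pair x (hkCurv e A) + pair a (hkTorsion e A) : Form I M 4) +
      extD (pair x (boundaryForm (2 * α₂) α₄ α₅ e A) +
        pair a (boundaryForm α₅ α₁ (2 * α₃) e A) : Form I M 3) := by
  have hX := IsSmoothForm.boundaryForm (2 * α₂) α₄ α₅ he hA
  have hB := IsSmoothForm.boundaryForm α₅ α₁ (2 * α₃) he hA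
  have pair_bracket_epsWedge :
      (pair a (bracket e (epsWedge e) : Fin 3 → Form I M 3) : Form I M 4) = 0 := by
    rw [← pair_bracket_left, bracket_comm, epsWedge_eq, pair_bracket_bracket]
  rw [extD_add (IsSmoothForm.pair hx hX) (IsSmoothForm.pair ha hB),
    extD_pair_covD hx hX A, extD_pair_covD ha hB A, covDTwo_boundaryForm _ _ _ he hA,
    covDTwo_boundaryForm _ _ _ he hA, hkCurv_eq, hkTorsion_eq]
  simp only [firstVariation, Fin.sum_univ_three, lagrangianCoeff, fieldStrength,
    fieldStrengthVariation, Matrix.of_apply, Matrix.cons_val, zero_smul, boundaryForm]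
  simp only [pair_comm (covD A e), pair_comm (curv A), pair_comm (epsWedge e), bracket_comm a e,
    pair_add_left, pair_add_right, pair_neg_right, pair_smul_left, pair_smul_right,
    pair_bracket_left e x, pair_bracket_left e a, pair_bracket_epsWedge,
    bracket_two_one e (curv A), bracket_two_one e (covD A e)]
  module

theorem twoConnLagrangian_eq {e A : Fin 3 → Form I M 1} (he : ∀ i, IsSmoothForm (e i))
    (hA : ∀ i, IsSmoothForm (A i)) :
    twoConnLagrangian (A + (1 / 2 : ℝ) • e) (A + (-(1 / 2) : ℝ) • e) =
      lagrangian (1 / 4) (-(1 / 4)) 1 0 0 e A := by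
  have pair_epsWedge : pair (epsWedge e) (epsWedge e) = 0 := pair_bracket_bracket e e
  rw [show twoConnLagrangian _ _ = pair (curv _) (curv _) from rfl, lagrangian_eq,
    curv_add_smul hA he, curv_add_smul hA he]
  simp only [pair_add_left, pair_add_right, pair_smul_left, pair_smul_right, pair_epsWedge,
    pair_comm (curv A) (epsWedge e), pair_comm (covD A e) (epsWedge e),
    pair_comm (covD A e) (curv A)]
  module

theorem twoConnLagrangian_add_smul {e A x a : Fin 3 → Form I M 1} (he : ∀ i, IsSmoothForm (e i))
    (hA : ∀ i, IsSmoothForm (A i)) (hx : ∀ i, IsSmoothForm (x i)) (ha : ∀ i, IsSmoothForm (a i))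
    (t : ℝ) :
    twoConnLagrangian (A + (1 / 2 : ℝ) • e + t • (a + (1 / 2 : ℝ) • x))
        (A + (-(1 / 2) : ℝ) • e + t • (a + (-(1 / 2) : ℝ) • x)) =
      lagrangian (1 / 4) (-(1 / 4)) 1 0 0 (e + t • x) (A + t • a) := by
  rw [← twoConnLagrangian_eq (e := e + t • x) (A := A + t • a)
    (fun i => (he i).add ((hx i).smul t)) (fun i => (hA i).add ((ha i).smul t))]
  congr 1 <;> module

end Variation

section TwoConnections

variable {H : Type*} [TopologicalSpace H]
  {I : ModelWithCorners ℝ (EuclideanSpace ℝ (Fin 4)) H}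
  {M : Type*} [TopologicalSpace M] [ChartedSpace H M]
  [IsManifold I ∞ M] [T2Space M] [SigmaCompactSpace M]

theorem isStationary_twoConnLagrangian_iff {e A : Fin 3 → Form I M 1}
    (he : ∀ i, IsSmoothForm (e i)) (hA : ∀ i, IsSmoothForm (A i)) :
    IsStationary twoConnLagrangian (A + (1 / 2 : ℝ) • e) (A + (-(1 / 2) : ℝ) • e) ↔
      IsStationary (lagrangian (1 / 4) (-(1 / 4)) 1 0 0) e A := by
  constructor
  · intro h K x a hK hx ha hvanish
    have hderiv := h K (a + (1 / 2 : ℝ) • x) (a + (-(1 / 2) : ℝ) • x) hK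
      (fun i => (ha i).add ((hx i).smul _)) (fun i => (ha i).add ((hx i).smul _))
      fun p hp i => by
        simp only [Pi.add_apply, Pi.smul_apply, (hvanish p hp i).1, (hvanish p hp i).2]
        exact ⟨by module, by module⟩
    simpa only [twoConnLagrangian_add_smul he hA hx ha] using hderiv
  · intro h K y z hK hy hz hvanish
    have hx : ∀ i, IsSmoothForm ((y - z) i) := fun i => (hy i).sub (hz i)
    have ha : ∀ i, IsSmoothForm (((1 / 2 : ℝ) • (y + z)) i) := fun i => ((hy i).add (hz i)).smul _
    have hderiv := h K (y - z) ((1 / 2 : ℝ) • (y + z)) hK hx ha fun p hp i => by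
        simp only [Pi.add_apply, Pi.smul_apply, Pi.sub_apply, (hvanish p hp i).1,
          (hvanish p hp i).2]
        exact ⟨by module, by module⟩
    have hy_eq : (1 / 2 : ℝ) • (y + z) + (1 / 2 : ℝ) • (y - z) = y := by module
    have hz_eq : (1 / 2 : ℝ) • (y + z) + (-(1 / 2) : ℝ) • (y - z) = z := by module
    simpa only [← twoConnLagrangian_add_smul he hA hx ha, hy_eq, hz_eq] using hderiv

end TwoConnections

/-! ### Integration of forms of top degree -/

theorem alternatingMap_comp_basis {ι R V : Type*} [Finite ι] [CommRing R] [AddCommGroup V]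
    [Module R V] (b : Module.Basis ι R V) (f : V [⋀^ι]→ₗ[R] R) (T : V →ₗ[R] V) :
    f (T ∘ b) = LinearMap.det T * f b := by
  classical
  have := Fintype.ofFinite ι
  rw [f.eq_smul_basis_det b, AlternatingMap.smul_apply, AlternatingMap.smul_apply, b.det_comp,
    b.det_self, mul_one, smul_eq_mul, smul_eq_mul, mul_one, mul_comm]

section Integral

variable {n : ℕ} {H : Type*} [TopologicalSpace H]
  {I : ModelWithCorners ℝ (EuclideanSpace ℝ (Fin n)) H}
  {M : Type*} [TopologicalSpace M] [ChartedSpace H M]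

/-- The density of a form of top degree in the preferred chart at `q`. -/
def density (q : M) (η : Form I M n) (y : EuclideanSpace ℝ (Fin n)) : ℝ :=
  chartRep q η y (EuclideanSpace.basisFun (Fin n) ℝ)

theorem density_add (q : M) (η ζ : Form I M n) (y : EuclideanSpace ℝ (Fin n)) :
    density q (η + ζ) y = density q η y + density q ζ y := rfl

theorem density_smul (q : M) (c : ℝ) (η : Form I M n) (y : EuclideanSpace ℝ (Fin n)) :
    density q (c • η) y = c * density q η y := rfl

theorem density_of_eq_zero {q : M} {η : Form I M n} {y : EuclideanSpace ℝ (Fin n)}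
    (h : η ((extChartAt I q).symm y) = 0) : density q η y = 0 := by
  rw [density, chartRep_of_eq_zero q h]; rfl

theorem IsSmoothForm.continuousOn_density {η : Form I M n} (hη : IsSmoothForm η) (q : M) :
    ContinuousOn (density q η) (extChartAt I q).target :=
  (ContinuousAlternatingMap.apply ℝ (EuclideanSpace ℝ (Fin n)) ℝ
    (EuclideanSpace.basisFun (Fin n) ℝ)).continuous.comp_continuousOn (hη q).continuousOn

theorem measurableSet_target (q : M) : MeasurableSet (extChartAt I q).target := by
  rw [extChartAt_target]
  exact ((chartAt H q).open_target.preimage I.continuous_symm).measurableSet.inter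
    I.isClosed_range.measurableSet

theorem measurableSet_target_inter_preimage_of_isOpen (q : M) {U : Set M} (hU : IsOpen U) :
    MeasurableSet ((extChartAt I q).target ∩ (extChartAt I q).symm ⁻¹' U) := by
  obtain ⟨u, hu, hu_eq⟩ := continuousOn_iff'.1 (continuousOn_extChartAt_symm (I := I) q) U hU
  rw [inter_comm, hu_eq]
  exact hu.measurableSet.inter (measurableSet_target q)

theorem measurableSet_target_inter_preimage_of_isClosed (q : M) {K : Set M} (hK : IsClosed K) :
    MeasurableSet ((extChartAt I q).target ∩ (extChartAt I q).symm ⁻¹' K) := by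
  obtain ⟨u, hu, hu_eq⟩ :=
    continuousOn_iff_isClosed.1 (continuousOn_extChartAt_symm (I := I) q) K hK
  rw [inter_comm, hu_eq]
  exact hu.measurableSet.inter (measurableSet_target q)

theorem integrableOn_of_continuousOn_target (q : M) {g : EuclideanSpace ℝ (Fin n) → ℝ}
    {B : Set (EuclideanSpace ℝ (Fin n))} {S : Set M}
    (hg : ContinuousOn g (extChartAt I q).target) (hB : MeasurableSet B)
    (hBt : B ⊆ (extChartAt I q).target) (hS : IsCompact S) (hSq : S ⊆ (extChartAt I q).source)
    (h0 : ∀ y ∈ B, (extChartAt I q).symm y ∉ S → g y = 0) : IntegrableOn g B :=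
  ((hg.mono (image_extChartAt_subset_target q hSq)).integrableOn_compact
    (isCompact_image_extChartAt q hS hSq)).of_forall_sdiff_eq_zero hB fun y hy =>
      h0 y hy.1 fun hyS => hy.2 ⟨_, hyS, (extChartAt I q).right_inv (hBt hy.1)⟩

theorem setIntegral_mul_density_eq_of_subset (q : M) {η : Form I M n} {S U : Set M}
    (h0 : ∀ p ∉ S, η p = 0) (hSU : S ⊆ U) (f : M → ℝ)
    (hU : MeasurableSet ((extChartAt I q).target ∩ (extChartAt I q).symm ⁻¹' U)) :
    ∫ y in (extChartAt I q).target ∩ (extChartAt I q).symm ⁻¹' U,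
      f ((extChartAt I q).symm y) * density q η y =
    ∫ y in (extChartAt I q).target ∩ (extChartAt I q).symm ⁻¹' S,
      f ((extChartAt I q).symm y) * density q η y := by
  refine setIntegral_eq_of_subset_of_forall_sdiff_eq_zero hU
    (inter_subset_inter_right _ (preimage_mono hSU)) fun y hy => ?_
  rw [density_of_eq_zero (h0 _ fun h => hy.2 ⟨hy.1.1, h⟩), mul_zero]

theorem extendCoordChange_source_eq (p q : M) :
    (I.extendCoordChange (chartAt H q) (chartAt H p)).source =
      (extChartAt I q).target ∩ (extChartAt I q).symm ⁻¹' (chartAt H p).source := by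
  rw [PartialEquiv.trans_source, ← extChartAt_source I p]
  rfl

variable [IsManifold I ∞ M]

theorem density_coordChange (p q : M) (η : Form I M n) {y : EuclideanSpace ℝ (Fin n)}
    (hy : y ∈ (extChartAt I q).target) (hp : (extChartAt I q).symm y ∈ (chartAt H p).source) :
    density q η y =
      (fderivWithin ℝ (extChartAt I p ∘ (extChartAt I q).symm) (range I) y).det *
        density p η ((extChartAt I p ∘ (extChartAt I q).symm) y) := by
  rw [density, density, chartRep_coordChange p q η hy hp, ← OrthonormalBasis.coe_toBasis]
  exact alternatingMap_comp_basis (EuclideanSpace.basisFun (Fin n) ℝ).toBasis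
    (chartRep p η ((extChartAt I p ∘ (extChartAt I q).symm) y)).toAlternatingMap _

theorem hasFDerivWithinAt_coordChange (p q : M) {y : EuclideanSpace ℝ (Fin n)}
    (hy : y ∈ (I.extendCoordChange (chartAt H q) (chartAt H p)).source) :
    HasFDerivWithinAt (extChartAt I p ∘ (extChartAt I q).symm)
      (fderivWithin ℝ (extChartAt I p ∘ (extChartAt I q).symm) (range I) y)
      (I.extendCoordChange (chartAt H q) (chartAt H p)).source y := by
  have hy' := hy
  rw [extendCoordChange_source_eq] at hy'
  refine ((contDiffWithinAt_coordChange p q hy'.1 hy'.2).differentiableWithinAt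
    (by simp)).hasFDerivWithinAt.mono ?_
  rw [extendCoordChange_source_eq]
  exact inter_subset_left.trans (extChartAt_target_subset_range q)

theorem IsOrientedAtlas.det_fderivWithin_pos (hM : IsOrientedAtlas I M) (p q : M)
    {y : EuclideanSpace ℝ (Fin n)}
    (hy : y ∈ (I.extendCoordChange (chartAt H q) (chartAt H p)).source) :
    0 < (fderivWithin ℝ (extChartAt I p ∘ (extChartAt I q).symm) (range I) y).det := by
  have hy' := hy
  rw [extendCoordChange_source_eq] at hy'
  rw [fderivWithin_of_mem_nhdsWithin (I.extendCoordChange_source_mem_nhdsWithin hy)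
    (uniqueDiffWithinAt_range hy'.1) (hasFDerivWithinAt_coordChange p q hy).differentiableWithinAt]
  exact hM _ (chart_mem_atlas H q) _ (chart_mem_atlas H p) y hy

theorem setIntegral_density_coordChange (hM : IsOrientedAtlas I M) (p q : M) (η : Form I M n)
    (f : M → ℝ) :
    ∫ y in (extChartAt I p).target ∩ (extChartAt I p).symm ⁻¹' (chartAt H q).source,
      f ((extChartAt I p).symm y) * density p η y =
    ∫ y in (extChartAt I q).target ∩ (extChartAt I q).symm ⁻¹' (chartAt H p).source,
      f ((extChartAt I q).symm y) * density q η y := by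
  set φ := I.extendCoordChange (chartAt H q) (chartAt H p) with hφ
  have hsource : φ.source =
      (extChartAt I q).target ∩ (extChartAt I q).symm ⁻¹' (chartAt H p).source :=
    extendCoordChange_source_eq p q
  have htarget : φ.target =
      (extChartAt I p).target ∩ (extChartAt I p).symm ⁻¹' (chartAt H q).source := by
    rw [hφ, ← I.extendCoordChange_symm, PartialEquiv.symm_target, extendCoordChange_source_eq]
  have hmeas : MeasurableSet φ.source := hsource ▸
    measurableSet_target_inter_preimage_of_isOpen q (chartAt H p).open_source
  rw [← hsource, ← htarget, ← φ.image_source_eq_target,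
    integral_image_eq_integral_abs_det_fderiv_smul (f := φ) volume hmeas
      (fun y hy => hasFDerivWithinAt_coordChange p q hy) φ.injOn]
  refine setIntegral_congr_fun hmeas fun y hy => ?_
  have hy' := hy
  rw [hsource] at hy'
  have hφy : φ y = (extChartAt I p ∘ (extChartAt I q).symm) y := rfl
  simp only [smul_eq_mul, abs_of_pos (hM.det_fderivWithin_pos p q hy), hφy,
    extChartAt_symm_coordChange p q hy'.2, density_coordChange p q η hy'.1 hy'.2]
  ring

variable [T2Space M] [SigmaCompactSpace M]

theorem tsupport_chartPartition_subset (q : M) :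
    tsupport (chartPartition I M q) ⊆ (chartAt H q).source :=
  (SmoothPartitionOfUnity.exists_isSubordinate_chartAt_source I M).choose_spec q

theorem finite_chartPartition_inter {K : Set M} (hK : IsCompact K) :
    {q : M | (support (chartPartition I M q) ∩ K).Nonempty}.Finite :=
  (chartPartition I M).locallyFinite.finite_nonempty_inter_compact hK

theorem continuousOn_chartPartition_mul_density {η : Form I M n} (hη : IsSmoothForm η) (r q : M) :
    ContinuousOn (fun y => chartPartition I M r ((extChartAt I q).symm y) * density q η y)
      (extChartAt I q).target :=
  (contDiffOn_comp_extChartAt_symm (chartPartition I M r).contMDiff q).continuousOn.mul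
    (hη.continuousOn_density q)

theorem integralOn_eq_sum {K : Set M} (hK : IsCompact K) (η : Form I M n) :
    integralOn K η = ∑ q ∈ (finite_chartPartition_inter (I := I) hK).toFinset,
      ∫ y in (extChartAt I q).target ∩ (extChartAt I q).symm ⁻¹' K,
        chartPartition I M q ((extChartAt I q).symm y) * density q η y := by
  refine finsum_eq_sum_of_support_subset _ fun q hq => ?_
  rw [Finite.coe_toFinset]
  by_contra hne
  refine hq (setIntegral_eq_zero_of_forall_eq_zero fun y hy => ?_)
  have hvanish : chartPartition I M q ((extChartAt I q).symm y) = 0 :=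
    by_contra fun h => hne ⟨_, h, hy.2⟩
  rw [hvanish, zero_mul]

theorem integrableOn_chartPartition_mul {K : Set M} (hK : IsCompact K) {η : Form I M n}
    (hη : IsSmoothForm η) (q : M) :
    IntegrableOn (fun y => chartPartition I M q ((extChartAt I q).symm y) * density q η y)
      ((extChartAt I q).target ∩ (extChartAt I q).symm ⁻¹' K) := by
  refine integrableOn_of_continuousOn_target q (S := K ∩ tsupport (chartPartition I M q))
    (continuousOn_chartPartition_mul_density hη q q)
    (measurableSet_target_inter_preimage_of_isClosed q hK.isClosed) inter_subset_left
    (hK.inter_right (isClosed_tsupport _)) ?_ fun y hy hyS => ?_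
  · rw [extChartAt_source]
    exact inter_subset_right.trans (tsupport_chartPartition_subset q)
  · rw [image_eq_zero_of_notMem_tsupport fun h => hyS ⟨hy.2, h⟩, zero_mul]

theorem integralOn_add {K : Set M} (hK : IsCompact K) {η ζ : Form I M n}
    (hη : IsSmoothForm η) (hζ : IsSmoothForm ζ) :
    integralOn K (η + ζ) = integralOn K η + integralOn K ζ := by
  simp only [integralOn_eq_sum hK, density_add, mul_add]
  rw [← Finset.sum_add_distrib]
  exact Finset.sum_congr rfl fun q _ => integral_add (integrableOn_chartPartition_mul hK hη q)
    (integrableOn_chartPartition_mul hK hζ q)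

theorem integralOn_smul {K : Set M} (hK : IsCompact K) (c : ℝ) (η : Form I M n) :
    integralOn K (c • η) = c * integralOn K η := by
  simp only [integralOn_eq_sum hK, density_smul, mul_left_comm _ c, integral_const_mul,
    Finset.mul_sum]

theorem integralOn_sum {K : Set M} (hK : IsCompact K) {ι : Type*} {s : Finset ι}
    {η : ι → Form I M n} (hη : ∀ i ∈ s, IsSmoothForm (η i)) :
    integralOn K (∑ i ∈ s, η i) = ∑ i ∈ s, integralOn K (η i) := by
  classical
  induction s using Finset.induction_on with
  | empty => simpa using integralOn_smul hK 0 (0 : Form I M n)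
  | insert i s hi ih =>
    have hs : ∀ j ∈ s, IsSmoothForm (η j) := fun j hj => hη j (Finset.mem_insert_of_mem hj)
    rw [Finset.sum_insert hi, Finset.sum_insert hi,
      integralOn_add hK (hη i (Finset.mem_insert_self i s)) (IsSmoothForm.sum hs), ih hs]

theorem setIntegral_chartPartition_mul_density (hM : IsOrientedAtlas I M) {K S : Set M}
    (hK : IsClosed K) (hSK : S ⊆ K) {q : M} (hSq : S ⊆ (chartAt H q).source) {η : Form I M n}
    (h0 : ∀ p ∉ S, η p = 0) (r : M) :
    ∫ y in (extChartAt I r).target ∩ (extChartAt I r).symm ⁻¹' K,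
      chartPartition I M r ((extChartAt I r).symm y) * density r η y =
    ∫ y in (extChartAt I q).target,
      chartPartition I M r ((extChartAt I q).symm y) * density q η y := by
  rw [setIntegral_mul_density_eq_of_subset r h0 hSK _
      (measurableSet_target_inter_preimage_of_isClosed r hK),
    ← setIntegral_mul_density_eq_of_subset r h0 hSq _
      (measurableSet_target_inter_preimage_of_isOpen r (chartAt H q).open_source),
    setIntegral_density_coordChange hM r q η (chartPartition I M r)]
  refine (setIntegral_eq_of_subset_of_forall_sdiff_eq_zero (measurableSet_target q)
    inter_subset_left fun y hy => ?_).symm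
  rw [image_eq_zero_of_notMem_tsupport fun h =>
    hy.2 ⟨hy.1, tsupport_chartPartition_subset r h⟩, zero_mul]

theorem integralOn_eq_setIntegral_density (hM : IsOrientedAtlas I M) {K S : Set M}
    (hK : IsCompact K) (hS : IsCompact S) (hSK : S ⊆ K) {q : M}
    (hSq : S ⊆ (chartAt H q).source) {η : Form I M n} (hη : IsSmoothForm η)
    (h0 : ∀ p ∉ S, η p = 0) :
    integralOn K η = ∫ y in (extChartAt I q).target, density q η y := by
  simp only [integralOn_eq_sum hK,
    setIntegral_chartPartition_mul_density hM hK.isClosed hSK hSq h0]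
  rw [← integral_finsetSum]
  · refine setIntegral_congr_fun (measurableSet_target q) fun y _ => ?_
    by_cases hyS : (extChartAt I q).symm y ∈ S
    · rw [← Finset.sum_mul, (chartPartition I M).sum_finsupport' _ (mem_univ _), one_mul]
      intro r hr
      rw [Finite.mem_toFinset]
      exact ⟨_, (chartPartition I M).mem_finsupport _ |>.1 hr, hSK hyS⟩
    · simp [density_of_eq_zero (h0 _ hyS)]
  · exact fun r _ => integrableOn_of_continuousOn_target q
      (continuousOn_chartPartition_mul_density hη r q) (measurableSet_target q) Subset.rfl hS
      (by rwa [extChartAt_source]) fun y _ hyS => by rw [density_of_eq_zero (h0 _ hyS), mul_zero]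

end Integral

/-! ### Stokes' formula -/

section HalfSpace

variable {n : ℕ}

theorem eventuallyEq_zero_of_notMem {X F : Type*} [TopologicalSpace X] [Zero F] {f : X → F}
    {s C : Set X} (hC : IsClosed C) (h0 : ∀ x ∈ s, x ∉ C → f x = 0) {x : X} (hx : x ∉ C) :
    f =ᶠ[𝓝[s] x] 0 := by
  filter_upwards [self_mem_nhdsWithin, mem_nhdsWithin_of_mem_nhds
    (hC.isOpen_compl.mem_nhds hx)] with y hy hyC using h0 y hy hyC

theorem uniqueDiffOn_halfSpace : UniqueDiffOn ℝ {x : Fin (n + 1) → ℝ | 0 ≤ x 0} := by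
  refine uniqueDiffOn_convex (convex_halfSpace_ge (LinearMap.proj 0).isLinear 0)
    ⟨fun _ => 1, mem_interior_iff_mem_nhds.2 ?_⟩
  filter_upwards [(continuous_apply 0).continuousAt.eventually (lt_mem_nhds zero_lt_one)]
    with x hx using le_of_lt hx

variable {E : Type*} [NormedAddCommGroup E] [NormedSpace ℝ E]

theorem integral_divergence_box {R : ℝ} (hR : 0 < R) {f : (Fin (n + 1) → ℝ) → Fin (n + 1) → E}
    {f' : (Fin (n + 1) → ℝ) → (Fin (n + 1) → ℝ) →L[ℝ] Fin (n + 1) → E}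
    (hf : ∀ x, 0 ≤ x 0 → HasFDerivWithinAt f (f' x) {x | 0 ≤ x 0} x)
    (hf' : ContinuousOn f' {x | 0 ≤ x 0})
    (h0 : ∀ x, 0 ≤ x 0 → (∃ i, R ≤ |x i|) → f x = 0) :
    ∫ x in Icc (Fin.cons 0 fun _ => -R) (fun _ => R), ∑ i, f' x (Pi.single i 1) i =
      -∫ z in Icc (fun _ => -R) (fun _ : Fin n => R), f (Fin.cons 0 z) 0 := by
  set a : Fin (n + 1) → ℝ := Fin.cons 0 fun _ => -R with ha
  set b : Fin (n + 1) → ℝ := fun _ => R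
  have hab : a ≤ b := Fin.cases hR.le fun _ => (neg_lt_self hR).le
  have hbox {x : Fin (n + 1) → ℝ} (hx : x ∈ Icc a b) : 0 ≤ x 0 := hx.1 0
  have hface (i : Fin (n + 1)) {c : ℝ} (hc : c ∈ Icc (a i) (b i)) (habs : R ≤ |c|) :
      ∫ x in Icc (a ∘ i.succAbove) (b ∘ i.succAbove), f (i.insertNth c x) i = 0 := by
    refine setIntegral_eq_zero_of_forall_eq_zero fun x hx => ?_
    rw [h0 _ (hbox (Fin.insertNth_mem_Icc.2 ⟨hc, hx⟩))
      ⟨i, by rwa [Fin.insertNth_apply_same]⟩, Pi.zero_apply]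
  rw [integral_divergence_of_hasFDerivAt_off_countable a b hab f f' ∅ countable_empty
    (fun x hx => ((hf x (hbox hx)).continuousWithinAt).mono fun y => hbox)
    (fun x hx => (hf x (hx.1 0 (mem_univ _)).1.le).hasFDerivAt <| by
      filter_upwards [(continuous_apply 0).continuousAt.eventually
        (lt_mem_nhds (hx.1 0 (mem_univ _)).1)] with y hy using le_of_lt hy)
    (ContinuousOn.integrableOn_compact isCompact_Icc <| continuousOn_finsetSum _ fun i _ =>
      (continuous_apply i).comp_continuousOn
        ((hf'.mono fun y => hbox).clm_apply continuousOn_const))]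
  have hback (i : Fin n) := hface i.succ (left_mem_Icc.2 (hab i.succ))
    (by simp [ha, abs_of_pos hR])
  have hfront (i : Fin (n + 1)) := hface i (right_mem_Icc.2 (hab i)) (le_abs_self R)
  simp only [hfront, zero_sub]
  rw [Fin.sum_univ_succ, Finset.sum_eq_zero fun i _ => by rw [hback i, neg_zero], add_zero]
  simp only [Fin.insertNth_zero']
  rfl

theorem setIntegral_divergence_halfSpace {f : (Fin (n + 1) → ℝ) → Fin (n + 1) → E}
    {f' : (Fin (n + 1) → ℝ) → (Fin (n + 1) → ℝ) →L[ℝ] Fin (n + 1) → E}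
    (hf : ∀ x, 0 ≤ x 0 → HasFDerivWithinAt f (f' x) {x | 0 ≤ x 0} x)
    (hf' : ContinuousOn f' {x | 0 ≤ x 0}) {C : Set (Fin (n + 1) → ℝ)} (hC : IsCompact C)
    (h0 : ∀ x, 0 ≤ x 0 → x ∉ C → f x = 0) :
    ∫ x in {x | 0 ≤ x 0}, ∑ i, f' x (Pi.single i 1) i = -∫ z, f (Fin.cons 0 z) 0 := by
  obtain ⟨R, hR, hCR⟩ : ∃ R, 0 < R ∧ ∀ x ∈ C, ∀ i, |x i| < R := by
    obtain ⟨R, hR⟩ := hC.isBounded.exists_norm_le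
    exact ⟨max R 0 + 1, by positivity, fun x hx i =>
      (((norm_le_pi_norm x i).trans (hR x hx)).trans (le_max_left R 0)).trans_lt (lt_add_one _)⟩
  have hnotC {x : Fin (n + 1) → ℝ} : (∃ i, R ≤ |x i|) → x ∉ C :=
    fun ⟨i, hi⟩ hx => (hCR x hx i).not_ge hi
  have hf'0 {x : Fin (n + 1) → ℝ} (hx : 0 ≤ x 0) (hxC : x ∉ C) : f' x = 0 := by
    refine uniqueDiffOn_halfSpace.eq hx (hf x hx)
      ((hasFDerivWithinAt_const (0 : Fin (n + 1) → E) x _).congr_of_eventuallyEq ?_ (h0 x hx hxC))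
    exact eventuallyEq_zero_of_notMem hC.isClosed h0 hxC
  have hinterior : ∫ x in {x : Fin (n + 1) → ℝ | 0 ≤ x 0}, ∑ i, f' x (Pi.single i 1) i =
      ∫ x in Icc (Fin.cons 0 fun _ => -R) (fun _ => R), ∑ i, f' x (Pi.single i 1) i := by
    refine setIntegral_eq_of_subset_of_forall_sdiff_eq_zero
      (measurableSet_le measurable_const (measurable_pi_apply 0)) (fun x hx => hx.1 0)
      fun x ⟨hx, hxbox⟩ => ?_
    have hxC : x ∉ C := fun h => hxbox
      ⟨Fin.cases hx fun i => (abs_lt.1 (hCR x h i.succ)).1.le, fun i => (abs_lt.1 (hCR x h i)).2.le⟩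
    simp [hf'0 hx hxC]
  have hboundary : ∫ z in Icc (fun _ => -R) (fun _ : Fin n => R), f (Fin.cons 0 z) 0 =
      ∫ z, f (Fin.cons 0 z) 0 := by
    refine setIntegral_eq_integral_of_forall_compl_eq_zero fun z hz => ?_
    have hzC : (Fin.cons 0 z : Fin (n + 1) → ℝ) ∉ C := fun h => hz
      ⟨fun i => (abs_lt.1 (hCR _ h i.succ)).1.le, fun i => (abs_lt.1 (hCR _ h i.succ)).2.le⟩
    rw [h0 _ le_rfl hzC, Pi.zero_apply]
  rw [hinterior, integral_divergence_box hR hf hf' fun x hx h => h0 x hx (hnotC h), hboundary]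

/-- The inclusion `y ↦ (0, y)` of the boundary of the half space, as a continuous linear map. -/
def consZeroL (n : ℕ) : EuclideanSpace ℝ (Fin n) →L[ℝ] EuclideanSpace ℝ (Fin (n + 1)) :=
  LinearMap.toContinuousLinearMap
    { toFun y := WithLp.toLp 2 (Fin.cons 0 fun i => y i)
      map_add' x y := by ext i; refine Fin.cases ?_ (fun j => ?_) i <;> simp
      map_smul' c x := by ext i; refine Fin.cases ?_ (fun j => ?_) i <;> simp }

theorem consZeroL_apply_zero (y : EuclideanSpace ℝ (Fin n)) : consZeroL n y 0 = 0 := rfl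

theorem consZeroL_apply_succ (y : EuclideanSpace ℝ (Fin n)) (i : Fin n) :
    consZeroL n y i.succ = y i := rfl

theorem mem_range_halfSpace {y : EuclideanSpace ℝ (Fin (n + 1))} :
    y ∈ range (𝓡∂ (n + 1)) ↔ 0 ≤ y 0 := by
  rw [range_modelWithCornersEuclideanHalfSpace, mem_ofPred]

theorem consZeroL_mem_range (y : EuclideanSpace ℝ (Fin n)) :
    consZeroL n y ∈ range (𝓡∂ (n + 1)) :=
  mem_range_halfSpace.2 (consZeroL_apply_zero y).ge

theorem consZeroL_basisFun (i : Fin n) :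
    consZeroL n (EuclideanSpace.basisFun (Fin n) ℝ i) =
      EuclideanSpace.basisFun (Fin (n + 1)) ℝ i.succ := by
  ext j
  refine Fin.cases ?_ (fun j => ?_) j
  · simp [consZeroL_apply_zero, EuclideanSpace.basisFun_apply]
  · simp [consZeroL_apply_succ, EuclideanSpace.basisFun_apply]

variable (n) in
/-- The signed components of an `n`-form on `ℝⁿ⁺¹`: the `i`-th one is `(-1)ⁱ` times its value on the
standard basis with the `i`-th vector left out, so that the exterior derivative is their divergence.
-/
def signedComponents :
    (EuclideanSpace ℝ (Fin (n + 1)) [⋀^Fin n]→L[ℝ] ℝ) →L[ℝ] Fin (n + 1) → ℝ :=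
  ContinuousLinearMap.pi fun i => (-1 : ℝ) ^ (i : ℕ) •
    ContinuousAlternatingMap.apply ℝ _ ℝ (i.removeNth (EuclideanSpace.basisFun (Fin (n + 1)) ℝ))

theorem signedComponents_zero (f : EuclideanSpace ℝ (Fin (n + 1)) [⋀^Fin n]→L[ℝ] ℝ) :
    signedComponents n f 0 =
      f fun i => consZeroL n (EuclideanSpace.basisFun (Fin n) ℝ i) := by
  simp only [consZeroL_basisFun]
  exact one_mul _

theorem extDerivWithin_apply_basisFun (s : Set (EuclideanSpace ℝ (Fin (n + 1))))
    (w : EuclideanSpace ℝ (Fin (n + 1)) → EuclideanSpace ℝ (Fin (n + 1)) [⋀^Fin n]→L[ℝ] ℝ)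
    (y : EuclideanSpace ℝ (Fin (n + 1))) :
    extDerivWithin w s y (EuclideanSpace.basisFun (Fin (n + 1)) ℝ) =
      ∑ i, signedComponents n (fderivWithin ℝ w s y (EuclideanSpace.basisFun _ ℝ i)) i := by
  rw [extDerivWithin, ContinuousAlternatingMap.alternatizeUncurryFin_apply]
  simp [signedComponents]

theorem setIntegral_extDerivWithin_halfSpace
    {w : EuclideanSpace ℝ (Fin (n + 1)) → EuclideanSpace ℝ (Fin (n + 1)) [⋀^Fin n]→L[ℝ] ℝ}
    (hw : ContDiffOn ℝ 1 w (range (𝓡∂ (n + 1)))) {C : Set (EuclideanSpace ℝ (Fin (n + 1)))}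
    (hC : IsCompact C) (h0 : ∀ y ∈ range (𝓡∂ (n + 1)), y ∉ C → w y = 0) :
    ∫ y in range (𝓡∂ (n + 1)), extDerivWithin w (range (𝓡∂ (n + 1))) y
        (EuclideanSpace.basisFun (Fin (n + 1)) ℝ) =
      -∫ z : EuclideanSpace ℝ (Fin n), w (consZeroL n z)
        (fun i => consZeroL n (EuclideanSpace.basisFun (Fin n) ℝ i)) := by
  set s := range (𝓡∂ (n + 1))
  let L := (PiLp.continuousLinearEquiv 2 ℝ fun _ : Fin (n + 1) => ℝ).symm
  have hLs : L ⁻¹' s = {x | 0 ≤ x 0} := ext fun x => mem_range_halfSpace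
  have hderiv (x : Fin (n + 1) → ℝ) (hx : 0 ≤ x 0) :
      HasFDerivWithinAt (signedComponents n ∘ w ∘ L)
        (signedComponents n ∘L fderivWithin ℝ w s (L x) ∘L (L : (Fin (n + 1) → ℝ) →L[ℝ] _))
        {x | 0 ≤ x 0} x := by
    have hxs : L x ∈ s := mem_range_halfSpace.2 hx
    exact (signedComponents n).hasFDerivAt.comp_hasFDerivWithinAt x <|
      ((hw _ hxs).differentiableWithinAt one_ne_zero).hasFDerivWithinAt.comp x
        L.hasFDerivWithinAt hLs.ge
  have hcont : ContinuousOn (fun x => signedComponents n ∘L fderivWithin ℝ w s (L x) ∘L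
      (L : (Fin (n + 1) → ℝ) →L[ℝ] _)) {x | 0 ≤ x 0} :=
    continuousOn_const.clm_comp (((hw.continuousOn_fderivWithin (𝓡∂ (n + 1)).uniqueDiffOn
      le_rfl).comp L.continuous.continuousOn hLs.ge).clm_comp continuousOn_const)
  have hdiv := setIntegral_divergence_halfSpace hderiv hcont (hC.image L.symm.continuous)
    fun x hx hxC => by
      have hLx : w (L x) = 0 :=
        h0 _ (mem_range_halfSpace.2 hx) fun h => hxC ⟨_, h, L.symm_apply_apply x⟩
      rw [comp_apply, comp_apply, hLx, map_zero]
  have hvol (m : ℕ) := (EuclideanSpace.volume_preserving_symm_measurableEquiv_toLp (Fin m)).symm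
  have hinterior : ∫ y in s, extDerivWithin w s y (EuclideanSpace.basisFun (Fin (n + 1)) ℝ) =
      ∫ x in {x | 0 ≤ x 0}, ∑ i, (signedComponents n ∘L fderivWithin ℝ w s (L x) ∘L
        (L : (Fin (n + 1) → ℝ) →L[ℝ] _)) (Pi.single i 1) i := by
    rw [← (hvol _).setIntegral_preimage_emb (MeasurableEquiv.measurableEmbedding _), ← hLs]
    refine integral_congr_ae (.of_forall fun x => (extDerivWithin_apply_basisFun s w _).trans ?_)
    simp only [EuclideanSpace.basisFun_apply]
    rfl
  have hboundary : ∫ z, signedComponents n (w (L (Fin.cons 0 z))) 0 =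
      ∫ z : EuclideanSpace ℝ (Fin n),
        w (consZeroL n z) (fun i => consZeroL n (EuclideanSpace.basisFun (Fin n) ℝ i)) := by
    rw [← (hvol _).integral_comp (MeasurableEquiv.measurableEmbedding _)]
    exact integral_congr_ae (.of_forall fun z => signedComponents_zero _)
  exact hinterior.trans (hdiv.trans (congrArg Neg.neg hboundary))

end HalfSpace

section Extension

variable {E : Type*} [NormedAddCommGroup E] [NormedSpace ℝ E]
  {H : Type*} [TopologicalSpace H] {I : ModelWithCorners ℝ E H}
  {M : Type*} [TopologicalSpace M] [ChartedSpace H M] {k : ℕ}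

/-- The extension by zero to the whole model space of the representative of a form in the preferred
chart at `q`; it is smooth on `range I` if the form is compactly supported in the chart domain. -/
def chartRepExtension (q : M) (α : Form I M k) : E → E [⋀^Fin k]→L[ℝ] ℝ :=
  (extChartAt I q).target.indicator (chartRep q α)

theorem chartRepExtension_of_mem {q : M} {y : E} (hy : y ∈ (extChartAt I q).target)
    (α : Form I M k) : chartRepExtension q α y = chartRep q α y :=
  indicator_of_mem hy _

theorem chartRepExtension_of_notMem {q : M} {y : E} (hy : y ∉ (extChartAt I q).target)
    (α : Form I M k) : chartRepExtension q α y = 0 :=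
  indicator_of_notMem hy _

theorem chartRepExtension_eventuallyEq {q : M} {y : E} (hy : y ∈ (extChartAt I q).target)
    (α : Form I M k) : chartRepExtension q α =ᶠ[𝓝[range I] y] chartRep q α := by
  filter_upwards [extChartAt_target_mem_nhdsWithin_of_mem hy] with z hz
    using chartRepExtension_of_mem hz α

variable {q : M} {S : Set M} {α : Form I M k}

theorem chartRepExtension_eq_zero (h0 : ∀ p ∉ S, α p = 0) {y : E} (hy : y ∉ extChartAt I q '' S) :
    chartRepExtension q α y = 0 := by
  by_cases hyt : y ∈ (extChartAt I q).target
  · rw [chartRepExtension_of_mem hyt]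
    exact chartRep_of_eq_zero q (h0 _ fun h => hy ⟨_, h, (extChartAt I q).right_inv hyt⟩)
  · exact chartRepExtension_of_notMem hyt α

theorem chartRepExtension_eventuallyEq_zero (hS : IsCompact S)
    (hSq : S ⊆ (extChartAt I q).source) (h0 : ∀ p ∉ S, α p = 0) {y : E}
    (hy : y ∉ (extChartAt I q).target) : chartRepExtension q α =ᶠ[𝓝[range I] y] 0 :=
  eventuallyEq_zero_of_notMem (isCompact_image_extChartAt q hS hSq).isClosed
    (fun _ _ => chartRepExtension_eq_zero h0)
    fun h => hy (image_extChartAt_subset_target q hSq h)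

theorem IsSmoothForm.contDiffOn_chartRepExtension (hα : IsSmoothForm α) (hS : IsCompact S)
    (hSq : S ⊆ (extChartAt I q).source) (h0 : ∀ p ∉ S, α p = 0) :
    ContDiffOn ℝ ∞ (chartRepExtension q α) (range I) := fun y _ => by
  by_cases hyt : y ∈ (extChartAt I q).target
  · exact (hα.contDiffWithinAt hyt).congr_of_eventuallyEq
      (chartRepExtension_eventuallyEq hyt α) (chartRepExtension_of_mem hyt α)
  · exact contDiffWithinAt_const.congr_of_eventuallyEq
      (chartRepExtension_eventuallyEq_zero hS hSq h0 hyt) (chartRepExtension_of_notMem hyt α)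

theorem extDerivWithin_chartRepExtension [IsManifold I ∞ M] (hα : IsSmoothForm α) {y : E}
    (hy : y ∈ (extChartAt I q).target) :
    extDerivWithin (chartRepExtension q α) (range I) y = chartRep q (extD α) y := by
  rw [chartRep_extD hα q hy, (chartRepExtension_eventuallyEq hy α).extDerivWithin_eq_of_mem
    (extChartAt_target_subset_range q hy)]

theorem extDerivWithin_chartRepExtension_eq_zero (hS : IsCompact S)
    (hSq : S ⊆ (extChartAt I q).source) (h0 : ∀ p ∉ S, α p = 0) {y : E} (hyr : y ∈ range I)
    (hy : y ∉ (extChartAt I q).target) :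
    extDerivWithin (chartRepExtension q α) (range I) y = 0 := by
  rw [(chartRepExtension_eventuallyEq_zero hS hSq h0 hy).extDerivWithin_eq_of_mem hyr]
  simp only [extDerivWithin, fderivWithin_zero, Pi.zero_apply]
  exact map_zero (ContinuousAlternatingMap.alternatizeUncurryFinCLM ℝ E ℝ)

end Extension

section Stokes

variable {n : ℕ} {M : Type*} [TopologicalSpace M] [ChartedSpace (EuclideanHalfSpace (n + 1)) M]

/-- The density on the boundary hyperplane of a form of codegree one in the preferred chart at `q`,
extended by zero outside the chart. -/
def boundaryDensity (q : M) (θ : Form (𝓡∂ (n + 1)) M n) (z : EuclideanSpace ℝ (Fin n)) : ℝ :=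
  chartRepExtension q θ (consZeroL n z) fun i => consZeroL n (EuclideanSpace.basisFun (Fin n) ℝ i)

theorem integralOn_extD [IsManifold (𝓡∂ (n + 1)) ∞ M] [T2Space M] [SigmaCompactSpace M]
    (hM : IsOrientedAtlas (𝓡∂ (n + 1)) M) {K S : Set M}
    (hK : IsCompact K) (hS : IsCompact S) (hSK : S ⊆ K) {q : M}
    (hSq : S ⊆ (chartAt (EuclideanHalfSpace (n + 1)) q).source) {θ : Form (𝓡∂ (n + 1)) M n}
    (hθ : IsSmoothForm θ) (h0 : ∀ p ∉ S, θ p = 0) :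
    integralOn K (extD θ) = -∫ z, boundaryDensity q θ z := by
  have hSq' : S ⊆ (extChartAt (𝓡∂ (n + 1)) q).source := by rwa [extChartAt_source]
  have hd0 : ∀ p ∉ S, extD θ p = 0 := fun p hp => extD_eq_zero <| by
    filter_upwards [hS.isClosed.isOpen_compl.mem_nhds hp] with r hr using h0 r hr
  calc integralOn K (extD θ)
      = ∫ y in (extChartAt (𝓡∂ (n + 1)) q).target, density q (extD θ) y :=
        integralOn_eq_setIntegral_density hM hK hS hSK hSq hθ.extD hd0
    _ = ∫ y in (extChartAt (𝓡∂ (n + 1)) q).target, extDerivWithin (chartRepExtension q θ)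
          (range (𝓡∂ (n + 1))) y (EuclideanSpace.basisFun (Fin (n + 1)) ℝ) :=
        setIntegral_congr_fun (measurableSet_target q) fun y hy => by
          rw [density, extDerivWithin_chartRepExtension hθ hy]
    _ = ∫ y in range (𝓡∂ (n + 1)), extDerivWithin (chartRepExtension q θ)
          (range (𝓡∂ (n + 1))) y (EuclideanSpace.basisFun (Fin (n + 1)) ℝ) :=
        (setIntegral_eq_of_subset_of_forall_sdiff_eq_zero
          (𝓡∂ (n + 1)).isClosed_range.measurableSet (extChartAt_target_subset_range q)
          fun y hy => by
            rw [extDerivWithin_chartRepExtension_eq_zero hS hSq' h0 hy.1 hy.2]; rfl).symm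
    _ = -∫ z, boundaryDensity q θ z :=
        setIntegral_extDerivWithin_halfSpace
          ((hθ.contDiffOn_chartRepExtension hS hSq' h0).of_le (by simp))
          (isCompact_image_extChartAt q hS hSq') fun y _ hy => chartRepExtension_eq_zero h0 hy

end Stokes

/-! ### The derivative of the action -/

section ActionDerivative

variable {n : ℕ} {H : Type*} [TopologicalSpace H]
  {I : ModelWithCorners ℝ (EuclideanSpace ℝ (Fin n)) H}
  {M : Type*} [TopologicalSpace M] [ChartedSpace H M]
  [IsManifold I ∞ M] [T2Space M] [SigmaCompactSpace M] {K : Set M}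

theorem integralOn_sum_sum_smul (hK : IsCompact K) {ι κ : Type*} [Fintype ι] [Fintype κ]
    (c : ι → κ → ℝ) {η : ι → κ → Form I M n} (hη : ∀ i j, IsSmoothForm (η i j)) :
    integralOn K (∑ i, ∑ j, c i j • η i j) =
      ∑ i, ∑ j, c i j * integralOn K (η i j) := by
  simp only [integralOn_sum hK fun i _ => IsSmoothForm.sum fun j _ => (hη i j).smul (c i j),
    integralOn_sum hK fun j _ => (hη _ j).smul _, integralOn_smul hK]

theorem hasDerivAt_integralOn_sum_pow (hK : IsCompact K) {N : ℕ} {f : Fin (N + 2) → Form I M n}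
    (hf : ∀ m, IsSmoothForm (f m)) :
    HasDerivAt (fun t : ℝ => integralOn K (∑ m : Fin (N + 2), t ^ (m : ℕ) • f m))
      (integralOn K (f 1)) 0 := by
  simp only [integralOn_sum hK fun m _ => (hf m).smul _, integralOn_smul hK]
  refine (HasDerivAt.fun_sum fun (m : Fin (N + 2)) _ =>
    (hasDerivAt_pow (m : ℕ) (0 : ℝ)).mul_const (integralOn K (f m))).congr_deriv ?_
  rw [Finset.sum_eq_single 1 (fun m _ hm => ?_) fun h => (h (Finset.mem_univ _)).elim]
  · simp
  · rcases m.val.eq_zero_or_pos with hm0 | hmpos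
    · simp [hm0]
    · have hm1 : (m : ℕ) - 1 ≠ 0 := fun h => hm (Fin.ext (by simp; omega))
      simp [hm1]

end ActionDerivative

section FirstVariation

variable {H : Type*} [TopologicalSpace H]
  {I : ModelWithCorners ℝ (EuclideanSpace ℝ (Fin 4)) H}
  {M : Type*} [TopologicalSpace M] [ChartedSpace H M]
  [IsManifold I ∞ M] [T2Space M] [SigmaCompactSpace M] {K : Set M}

theorem hasDerivAt_integralOn_pair (hK : IsCompact K)
    {P₀ P₁ P₂ Q₀ Q₁ Q₂ : Fin 3 → Form I M 2}
    (hP₀ : ∀ i, IsSmoothForm (P₀ i)) (hP₁ : ∀ i, IsSmoothForm (P₁ i))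
    (hP₂ : ∀ i, IsSmoothForm (P₂ i)) (hQ₀ : ∀ i, IsSmoothForm (Q₀ i))
    (hQ₁ : ∀ i, IsSmoothForm (Q₁ i)) (hQ₂ : ∀ i, IsSmoothForm (Q₂ i)) :
    HasDerivAt (fun t : ℝ => integralOn K (pair (P₀ + t • P₁ + t ^ 2 • P₂)
      (Q₀ + t • Q₁ + t ^ 2 • Q₂) : Form I M 4))
      (integralOn K (pair P₀ Q₁ + pair P₁ Q₀ : Form I M 4)) 0 := by
  let coeff : Fin 5 → Form I M 4 := ![pair P₀ Q₀, pair P₀ Q₁ + pair P₁ Q₀,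
    pair P₀ Q₂ + pair P₁ Q₁ + pair P₂ Q₀, pair P₁ Q₂ + pair P₂ Q₁, pair P₂ Q₂]
  have hcoeff : ∀ m, IsSmoothForm (coeff m)
    | 0 => .pair hP₀ hQ₀
    | 1 => (IsSmoothForm.pair hP₀ hQ₁).add (.pair hP₁ hQ₀)
    | 2 => ((IsSmoothForm.pair hP₀ hQ₂).add (.pair hP₁ hQ₁)).add (.pair hP₂ hQ₀)
    | 3 => (IsSmoothForm.pair hP₁ hQ₂).add (.pair hP₂ hQ₁)
    | 4 => .pair hP₂ hQ₂
  refine (hasDerivAt_integralOn_sum_pow hK hcoeff).congr_of_eventuallyEq (.of_forall fun t => ?_)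
  refine congrArg (integralOn K) (a₂ := ∑ m : Fin 5, t ^ (m : ℕ) • coeff m) ?_
  simp only [pair_add_left, pair_add_right, pair_smul_left, pair_smul_right,
    Fin.sum_univ_five, coeff, Matrix.cons_val,
    Fin.coe_ofNat_eq_mod, Nat.reduceMod]
  module

theorem hasDerivAt_integralOn_lagrangian (hK : IsCompact K) (α₁ α₂ α₃ α₄ α₅ : ℝ)
    {e A x a : Fin 3 → Form I M 1} (he : ∀ i, IsSmoothForm (e i)) (hA : ∀ i, IsSmoothForm (A i))
    (hx : ∀ i, IsSmoothForm (x i)) (ha : ∀ i, IsSmoothForm (a i)) :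
    HasDerivAt (fun t : ℝ => integralOn K (lagrangian α₁ α₂ α₃ α₄ α₅ (e + t • x) (A + t • a)))
      (integralOn K (firstVariation α₁ α₂ α₃ α₄ α₅ e A x a)) 0 := by
  have hG := IsSmoothForm.fieldStrength he hA
  have hG' := IsSmoothForm.fieldStrengthVariation he hA hx ha
  have hG'' := IsSmoothForm.fieldStrengthRemainder hx ha
  have hGt (t : ℝ) := IsSmoothForm.fieldStrength (e := e + t • x) (A := A + t • a)
    (fun i => (he i).add ((hx i).smul t)) (fun i => (hA i).add ((ha i).smul t))
  have hpair (t : ℝ) (i j : Fin 3) : IsSmoothForm (pair (fieldStrength (e + t • x) (A + t • a) i)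
      (fieldStrength (e + t • x) (A + t • a) j) : Form I M 4) := .pair (hGt t i) (hGt t j)
  have hvar (i j : Fin 3) : IsSmoothForm (pair (fieldStrength e A i)
      (fieldStrengthVariation e A x a j) + pair (fieldStrengthVariation e A x a i)
        (fieldStrength e A j) : Form I M 4) :=
    (IsSmoothForm.pair (hG i) (hG' j)).add (.pair (hG' i) (hG j))
  have hexpand (t : ℝ) := (congrArg (integralOn K) (lagrangian_eq_sum α₁ α₂ α₃ α₄ α₅ _ _)).trans
    (integralOn_sum_sum_smul hK (lagrangianCoeff α₁ α₂ α₃ α₄ α₅) (hpair t))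
  simp only [fieldStrength_add_smul he hA hx ha] at hexpand
  refine .congr_deriv ?_ (integralOn_sum_sum_smul hK _ hvar).symm
  refine .congr_of_eventuallyEq ?_ (.of_forall hexpand)
  exact HasDerivAt.fun_sum fun i _ => HasDerivAt.fun_sum fun j _ =>
    (hasDerivAt_integralOn_pair hK (hG i) (hG' i) (hG'' i) (hG j) (hG' j) (hG'' j)).const_mul _

theorem isStationary_lagrangian_iff (α₁ α₂ α₃ α₄ α₅ : ℝ)
    {e A : Fin 3 → Form I M 1} (he : ∀ i, IsSmoothForm (e i)) (hA : ∀ i, IsSmoothForm (A i)) :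
    IsStationary (lagrangian α₁ α₂ α₃ α₄ α₅) e A ↔
      ∀ (K : Set M) (x a : Fin 3 → Form I M 1), IsCompact K →
        (∀ i, IsSmoothForm (x i)) → (∀ i, IsSmoothForm (a i)) →
        (∀ p ∉ K, ∀ i, x i p = 0 ∧ a i p = 0) →
        integralOn K (firstVariation α₁ α₂ α₃ α₄ α₅ e A x a) = 0 := by
  refine forall₃_congr fun K x a => forall₄_congr fun hK hx ha _ => ?_
  have hderiv := hasDerivAt_integralOn_lagrangian hK α₁ α₂ α₃ α₄ α₅ he hA hx ha
  exact ⟨fun h => hderiv.unique h, fun h => h ▸ hderiv⟩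

end FirstVariation

/-! ### Exterior multiplication by linear forms -/

section OneCovec

variable {E : Type*} [NormedAddCommGroup E] [NormedSpace ℝ E] {k : ℕ}

/-- A continuous linear form, viewed as an alternating form of degree one. -/
def oneCovec (lam : E →L[ℝ] ℝ) : E [⋀^Fin 1]→L[ℝ] ℝ :=
  ContinuousAlternatingMap.ofSubsingleton ℝ E ℝ 0 lam

theorem wedgeAlt_oneCovec (lam : E →L[ℝ] ℝ) (f : E [⋀^Fin k]→L[ℝ] ℝ) (v : Fin (1 + k) → E) :
    wedgeAlt (oneCovec lam) f v =
      ContinuousAlternatingMap.alternatizeUncurryFin (lam.smulRight f)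
        (v ∘ finCongr (add_comm k 1)) := by
  have h_tail (w : Fin (1 + k) → E) :
      w ∘ Fin.natAdd 1 = Fin.tail (w ∘ finCongr (add_comm k 1)) :=
    funext fun i => congrArg w (Fin.ext (add_comm 1 (i : ℕ)))
  rw [alternatizeUncurryFin_apply_altSum, wedgeAlt_apply, ← altSum_comp_equiv,
    Nat.factorial_one, Nat.cast_one, one_mul]
  simp only [h_tail]
  rfl

theorem wedgeAlt_oneCovec_cons {lam : E →L[ℝ] ℝ} {u : Fin k → E} (hu : ∀ i, lam (u i) = 0)
    (f : E [⋀^Fin k]→L[ℝ] ℝ) (w : E) :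
    wedgeAlt (oneCovec lam) f ((Fin.cons w u : Fin (k + 1) → E) ∘ finCongr (add_comm 1 k)) =
      lam w * f u := by
  have h_cast : ((Fin.cons w u : Fin (k + 1) → E) ∘ finCongr (add_comm 1 k)) ∘
      finCongr (add_comm k 1) = Fin.cons w u := rfl
  rw [wedgeAlt_oneCovec, h_cast, ContinuousAlternatingMap.alternatizeUncurryFin_apply,
    Fin.sum_univ_succ, Finset.sum_eq_zero fun i _ => by simp [hu]]
  simp

theorem eq_zero_of_forall_wedgeAlt_oneCovec [FiniteDimensional ℝ E]
    (hk : k < Module.finrank ℝ E) {f : E [⋀^Fin k]→L[ℝ] ℝ}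
    (hf : ∀ lam : E →L[ℝ] ℝ, wedgeAlt (oneCovec lam) f = 0) : f = 0 := by
  ext u
  have h_span : Submodule.span ℝ (range u) < ⊤ := by
    refine lt_top_iff_ne_top.2 fun h => hk.not_ge ?_
    have h_card := finrank_range_le_card (R := ℝ) u
    rwa [Set.finrank, h, finrank_top, Fintype.card_fin] at h_card
  obtain ⟨lam, hlam, hle⟩ := Submodule.exists_le_ker_of_lt_top _ h_span
  obtain ⟨w, hw⟩ : ∃ w, lam w ≠ 0 := by
    by_contra! h
    exact hlam (LinearMap.ext h)
  have hu (i : Fin k) : lam.toContinuousLinearMap (u i) = 0 :=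
    hle (Submodule.subset_span (mem_range_self i))
  have h_wedge := wedgeAlt_oneCovec_cons hu f w
  rw [hf] at h_wedge
  exact (mul_eq_zero.1 h_wedge.symm).resolve_left hw

theorem eq_zero_of_map_basisFun_eq_zero {n : ℕ} {f : EuclideanSpace ℝ (Fin n) [⋀^Fin n]→L[ℝ] ℝ}
    (hf : f (EuclideanSpace.basisFun (Fin n) ℝ) = 0) : f = 0 := by
  refine ContinuousAlternatingMap.toAlternatingMap_injective ?_
  refine (f.toAlternatingMap.map_basis_eq_zero_iff (EuclideanSpace.basisFun (Fin n) ℝ).toBasis).1 ?_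
  rwa [OrthonormalBasis.coe_toBasis]

end OneCovec

/-! ### Test forms -/

section TestForms

variable {E : Type*} [NormedAddCommGroup E] [NormedSpace ℝ E]
  {H : Type*} [TopologicalSpace H] {I : ModelWithCorners ℝ E H}
  {M : Type*} [TopologicalSpace M] [ChartedSpace H M]

variable (I M) in
/-- The constant function `1` as a form of degree zero. -/
def oneForm : Form I M 0 := fun _ => ContinuousAlternatingMap.constOfIsEmpty ℝ _ (Fin 0) 1

theorem isSmoothForm_oneForm : IsSmoothForm (oneForm I M) := fun _ =>
  contDiffOn_const (c := ContinuousAlternatingMap.constOfIsEmpty ℝ E (Fin 0) 1)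

variable [IsManifold I ∞ M]

theorem chartRep_extD_fsmul_oneForm {g : M → ℝ} (hg : ContMDiff I 𝓘(ℝ, ℝ) ∞ g) (q : M) {y : E}
    (hy : y ∈ (extChartAt I q).target) :
    chartRep q (extD (fsmul g (oneForm I M))) y =
      oneCovec (fderivWithin ℝ (g ∘ (extChartAt I q).symm) (range I) y) := by
  have hdiff : DifferentiableWithinAt ℝ (g ∘ (extChartAt I q).symm) (range I) y :=
    ((contDiffOn_comp_extChartAt_symm hg q y hy).mono_of_mem_nhdsWithin
      (extChartAt_target_mem_nhdsWithin_of_mem hy)).differentiableWithinAt (by simp)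
  have hrep : chartRep q (fsmul g (oneForm I M)) = fun z => (g ∘ (extChartAt I q).symm) z •
    ContinuousAlternatingMap.constOfIsEmpty ℝ E (Fin 0) (1 : ℝ) := rfl
  rw [chartRep_extD (isSmoothForm_oneForm.fsmul hg) q hy, hrep, extDerivWithin,
    HasFDerivWithinAt.fderivWithin (hdiff.hasFDerivWithinAt.smul_const
      (ContinuousAlternatingMap.constOfIsEmpty ℝ E (Fin 0) (1 : ℝ))) (uniqueDiffWithinAt_range hy)]
  ext v
  simp [ContinuousAlternatingMap.alternatizeUncurryFin_apply, oneCovec]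

variable [FiniteDimensional ℝ E] [T2Space M]

theorem exists_isSmoothForm_eventually_chartRep_eq (p : M) (lam : E →L[ℝ] ℝ) :
    ∃ ζ : Form I M 1, IsSmoothForm ζ ∧
      ∀ᶠ r in 𝓝 p, chartRep p ζ (extChartAt I p r) = oneCovec lam := by
  obtain ⟨ψ⟩ : Nonempty (SmoothBumpFunction I p) := inferInstance
  have hg : ContMDiff I 𝓘(ℝ, ℝ) ∞ (fun r => ψ r • lam (extChartAt I p r)) :=
    ψ.contMDiff_smul (g := fun r => lam (extChartAt I p r))
      (lam.contDiff.contMDiff.comp_contMDiffOn contMDiffOn_extChartAt)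
  refine ⟨extD (fsmul _ (oneForm I M)), (isSmoothForm_oneForm.fsmul hg).extD, ?_⟩
  filter_upwards [eventually_eventually_nhds.2 ψ.eventuallyEq_one,
    extChartAt_source_mem_nhds (I := I) p] with r hr hrp
  have hy := (extChartAt I p).map_source hrp
  have h_eq : (fun r => ψ r • lam (extChartAt I p r)) ∘ (extChartAt I p).symm
      =ᶠ[𝓝[range I] extChartAt I p r] lam := by
    rw [← (extChartAt I p).left_inv hrp] at hr
    filter_upwards [(continuousAt_extChartAt_symm'' hy).continuousWithinAt.eventually hr,
      extChartAt_target_mem_nhdsWithin_of_mem hy] with z hz hzt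
    rw [comp_apply, hz, Pi.one_apply, one_smul, (extChartAt I p).right_inv hzt]
  rw [chartRep_extD_fsmul_oneForm hg p hy,
    h_eq.fderivWithin_eq_of_mem (extChartAt_target_subset_range p hy),
    lam.fderivWithin (uniqueDiffWithinAt_range hy)]

theorem exists_isSmoothForm_chartRep_eq (p : M) {s : Set M} (hs : s ∈ 𝓝 p) (lam : E →L[ℝ] ℝ)
    {c : E → ℝ} (hc : ContDiffOn ℝ ∞ c (extChartAt I p).target) :
    ∃ (f : SmoothBumpFunction I p) (x : Form I M 1), tsupport f ⊆ s ∧ IsSmoothForm x ∧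
      (∀ r ∉ tsupport f, x r = 0) ∧ ∀ y ∈ (extChartAt I p).target,
        chartRep p x y = (f ((extChartAt I p).symm y) * c y) • oneCovec lam := by
  obtain ⟨ζ, hζ, hζp⟩ := exists_isSmoothForm_eventually_chartRep_eq (I := I) p lam
  obtain ⟨f, -, hf⟩ := (SmoothBumpFunction.nhds_basis_tsupport (I := I) p).mem_iff.1
    (Filter.inter_mem hs hζp)
  have hfc : ContMDiff I 𝓘(ℝ, ℝ) ∞ (fun r => f r • c (extChartAt I p r)) :=
    f.contMDiff_smul (g := fun r => c (extChartAt I p r)) <|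
      ContMDiffOn.comp (t := (extChartAt I p).target) (contMDiffOn_iff_contDiffOn.2 hc)
        contMDiffOn_extChartAt fun r hr =>
          (extChartAt I p).map_source (by rwa [extChartAt_source])
  refine ⟨f, fsmul _ ζ, hf.trans inter_subset_left, hζ.fsmul hfc, fun r hr => ?_, fun y hy => ?_⟩
  · rw [fsmul, image_eq_zero_of_notMem_tsupport hr, zero_smul, zero_smul]
  · rw [chartRep_fsmul, (extChartAt I p).right_inv hy, smul_eq_mul]
    by_cases hfy : f ((extChartAt I p).symm y) = 0
    · rw [hfy, zero_mul, zero_smul, zero_smul]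
    · have hζy := (hf (subset_tsupport _ hfy)).2
      rw [mem_ofPred, (extChartAt I p).right_inv hy] at hζy
      rw [hζy]

end TestForms

/-! ### Forms restricted to the boundary -/

section BoundaryValues

variable {n : ℕ}

theorem consZeroL_injective : Injective (consZeroL n) := fun x y h => by
  ext i
  rw [← consZeroL_apply_succ x, h, consZeroL_apply_succ]

theorem isClosedEmbedding_consZeroL : IsClosedEmbedding (consZeroL n) :=
  (consZeroL n).toLinearMap.isClosedEmbedding_of_injective
    (LinearMap.ker_eq_bot.2 consZeroL_injective)

theorem exists_leftInverse_consZeroL :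
    ∃ g : EuclideanSpace ℝ (Fin (n + 1)) →L[ℝ] EuclideanSpace ℝ (Fin n),
      LeftInverse g (consZeroL n) := by
  obtain ⟨g, hg⟩ := (consZeroL n).toLinearMap.exists_leftInverse_of_injective
    (LinearMap.ker_eq_bot.2 consZeroL_injective)
  exact ⟨LinearMap.toContinuousLinearMap g, LinearMap.congr_fun hg⟩

theorem exists_consZeroL_eq {y : EuclideanSpace ℝ (Fin (n + 1))} (hy : y 0 = 0) :
    ∃ z, consZeroL n z = y := by
  refine ⟨WithLp.toLp 2 fun i => y i.succ, ?_⟩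
  ext i
  cases i using Fin.cases with
  | zero => rw [consZeroL_apply_zero, hy]
  | succ j => rw [consZeroL_apply_succ]

variable {M : Type*} [TopologicalSpace M] [ChartedSpace (EuclideanHalfSpace (n + 1)) M]
  [IsManifold (𝓡∂ (n + 1)) ∞ M]

theorem mem_boundary_iff_extChartAt (q : M) {p : M}
    (hp : p ∈ (chartAt (EuclideanHalfSpace (n + 1)) q).source) :
    p ∈ (𝓡∂ (n + 1)).boundary M ↔ extChartAt (𝓡∂ (n + 1)) q p 0 = 0 :=
  mem_boundary_iff (chart_mem_atlas _ q) hp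

theorem extChartAt_symm_mem_boundary_iff (q : M) {y : EuclideanSpace ℝ (Fin (n + 1))}
    (hy : y ∈ (extChartAt (𝓡∂ (n + 1)) q).target) :
    (extChartAt (𝓡∂ (n + 1)) q).symm y ∈ (𝓡∂ (n + 1)).boundary M ↔ y 0 = 0 := by
  have hsource := (extChartAt (𝓡∂ (n + 1)) q).map_target hy
  rw [extChartAt_source] at hsource
  rw [mem_boundary_iff_extChartAt q hsource, (extChartAt (𝓡∂ (n + 1)) q).right_inv hy]

/-- Coordinate changes preserve the boundary hyperplane, hence so do their derivatives. -/
theorem fderivWithin_coordChange_consZeroL (p q : M) {z : EuclideanSpace ℝ (Fin n)}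
    (hz : consZeroL n z ∈ (extChartAt (𝓡∂ (n + 1)) q).target)
    (hp : (extChartAt (𝓡∂ (n + 1)) q).symm (consZeroL n z) ∈
      (chartAt (EuclideanHalfSpace (n + 1)) p).source) (v : EuclideanSpace ℝ (Fin n)) :
    fderivWithin ℝ (extChartAt (𝓡∂ (n + 1)) p ∘ (extChartAt (𝓡∂ (n + 1)) q).symm)
      (range (𝓡∂ (n + 1))) (consZeroL n z) (consZeroL n v) 0 = 0 := by
  set φ := extChartAt (𝓡∂ (n + 1)) p ∘ (extChartAt (𝓡∂ (n + 1)) q).symm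
  let firstCoord : EuclideanSpace ℝ (Fin (n + 1)) →L[ℝ] ℝ := EuclideanSpace.proj 0
  have hφ : HasFDerivWithinAt φ (fderivWithin ℝ φ (range (𝓡∂ (n + 1))) (consZeroL n z))
      (range (𝓡∂ (n + 1))) (consZeroL n z) :=
    ((contDiffWithinAt_coordChange p q hz hp).differentiableWithinAt (by simp)).hasFDerivWithinAt
  have hcomp : HasFDerivAt (fun w => firstCoord (φ (consZeroL n w)))
      (firstCoord ∘L fderivWithin ℝ φ (range (𝓡∂ (n + 1))) (consZeroL n z) ∘L consZeroL n) z := by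
    rw [← hasFDerivWithinAt_univ]
    exact firstCoord.hasFDerivAt.comp_hasFDerivWithinAt z <|
      hφ.comp z (consZeroL n).hasFDerivWithinAt fun w _ => consZeroL_mem_range w
  have htendsto : Filter.Tendsto (consZeroL n) (𝓝 z) (𝓝[range (𝓡∂ (n + 1))] (consZeroL n z)) :=
    tendsto_nhdsWithin_iff.2
      ⟨(consZeroL n).continuous.continuousAt, .of_forall fun w => consZeroL_mem_range w⟩
  have hzero : (fun w => firstCoord (φ (consZeroL n w))) =ᶠ[𝓝 z] fun _ => 0 := by
    filter_upwards [htendsto.eventually (eventually_mem_source p q hz hp)] with w hw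
    exact (mem_boundary_iff_extChartAt p hw.2).1
      ((extChartAt_symm_mem_boundary_iff q hw.1).2 (consZeroL_apply_zero w))
  exact congrArg (fun L => L v)
    (hcomp.unique ((hasFDerivAt_const (0 : ℝ) z).congr_of_eventuallyEq hzero))

theorem boundaryDensity_eq_zero {θ : Form (𝓡∂ (n + 1)) M n}
    (hθ : ∀ p ∈ (𝓡∂ (n + 1)).boundary M,
      (covec θ p).compContinuousLinearMap (consZeroL n) = 0) (q : M)
    (z : EuclideanSpace ℝ (Fin n)) : boundaryDensity q θ z = 0 := by
  rw [boundaryDensity]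
  by_cases hz : consZeroL n z ∈ (extChartAt (𝓡∂ (n + 1)) q).target
  · choose w hw using fun i : Fin n => exists_consZeroL_eq (fderivWithin_coordChange_consZeroL
      ((extChartAt (𝓡∂ (n + 1)) q).symm (consZeroL n z)) q hz (mem_chart_source _ _)
      (EuclideanSpace.basisFun (Fin n) ℝ i))
    have hzero := congrArg (fun f => f w)
      (hθ _ ((extChartAt_symm_mem_boundary_iff q hz).2 (consZeroL_apply_zero z)))
    rw [chartRepExtension_of_mem hz, chartRep_eq q θ hz,
      ContinuousAlternatingMap.compContinuousLinearMap_apply]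
    exact (congrArg _ (funext fun i => (hw i).symm)).trans hzero
  · rw [chartRepExtension_of_notMem hz]
    rfl

end BoundaryValues

section PartitionOfUnity

variable {n k : ℕ} {H : Type*} [TopologicalSpace H]
  {I : ModelWithCorners ℝ (EuclideanSpace ℝ (Fin n)) H}
  {M : Type*} [TopologicalSpace M] [ChartedSpace H M]
  [IsManifold I ∞ M] [T2Space M] [SigmaCompactSpace M]

theorem sum_fsmul_chartPartition {K : Set M} (hK : IsCompact K) {θ : Form I M k}
    (h0 : ∀ p ∉ K, θ p = 0) :
    ∑ q ∈ (finite_chartPartition_inter (I := I) hK).toFinset, fsmul (chartPartition I M q) θ =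
      θ := by
  funext p
  rw [Finset.sum_apply]
  simp only [fsmul]
  by_cases hp : p ∈ K
  · rw [← Finset.sum_smul, ← finsum_eq_sum_of_support_subset,
      (chartPartition I M).sum_eq_one (mem_univ p), one_smul]
    intro q hq
    rw [Finite.coe_toFinset]
    exact ⟨p, hq, hp⟩
  · simp only [h0 p hp, smul_zero, Finset.sum_const_zero]

end PartitionOfUnity

section Stokes

variable {n : ℕ} {M : Type*} [TopologicalSpace M] [ChartedSpace (EuclideanHalfSpace (n + 1)) M]
  [IsManifold (𝓡∂ (n + 1)) ∞ M] [T2Space M] [SigmaCompactSpace M]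

theorem integralOn_extD_eq_zero (hM : IsOrientedAtlas (𝓡∂ (n + 1)) M) {K : Set M}
    (hK : IsCompact K) {θ : Form (𝓡∂ (n + 1)) M n} (hθ : IsSmoothForm θ)
    (h0 : ∀ p ∉ K, θ p = 0)
    (hθ_boundary : ∀ p ∈ (𝓡∂ (n + 1)).boundary M,
      (covec θ p).compContinuousLinearMap (consZeroL n) = 0) :
    integralOn K (extD θ) = 0 := by
  let ρ := chartPartition (𝓡∂ (n + 1)) M
  have hρθ (q : M) : IsSmoothForm (fsmul (ρ q) θ) := hθ.fsmul (ρ q).contMDiff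
  rw [← sum_fsmul_chartPartition hK h0, extD_sum fun q _ => hρθ q,
    integralOn_sum hK fun q _ => (hρθ q).extD]
  refine Finset.sum_eq_zero fun q _ => ?_
  have hsupp : ∀ p ∉ K ∩ tsupport (ρ q), fsmul (ρ q) θ p = 0 := fun p hp => by
    by_cases hpK : p ∈ K
    · rw [fsmul, image_eq_zero_of_notMem_tsupport fun h => hp ⟨hpK, h⟩, zero_smul]
    · rw [fsmul, h0 p hpK, smul_zero]
  have hρθ_boundary : ∀ p ∈ (𝓡∂ (n + 1)).boundary M,
      (covec (fsmul (ρ q) θ) p).compContinuousLinearMap (consZeroL n) = 0 := fun p hp => by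
    have : (covec (fsmul (ρ q) θ) p).compContinuousLinearMap (consZeroL n) =
      ρ q p • (covec θ p).compContinuousLinearMap (consZeroL n) := rfl
    rw [this, hθ_boundary p hp, smul_zero]
  rw [integralOn_extD hM hK (hK.inter_right (isClosed_tsupport (ρ q))) inter_subset_left
    (inter_subset_right.trans (tsupport_chartPartition_subset q)) (hρθ q) hsupp]
  simp only [boundaryDensity_eq_zero hρθ_boundary, integral_zero, neg_zero]

end Stokes

/-! ### The fundamental lemma of the calculus of variations -/

section TestWedge

variable {E : Type*} [NormedAddCommGroup E] [NormedSpace ℝ E]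
  {H : Type*} [TopologicalSpace H] {I : ModelWithCorners ℝ E H}
  {M : Type*} [TopologicalSpace M] [ChartedSpace H M] {k l : ℕ}

theorem wedge_apply_eq_zero {α : Form I M k} {p : M} (hα : α p = 0) (β : Form I M l) :
    wedge α β p = 0 :=
  (congrArg (wedgeAlt · (covec β p)) hα).trans (wedgeAlt_zero_left _)

/-- The second factor `wedgeAlt (oneCovec lam) (chartRep p η y) v` comes from choosing the test form
proportional to the quantity that is to be shown to vanish. -/
theorem exists_isSmoothForm_chartRep_wedge_eq [IsManifold I ∞ M] [FiniteDimensional ℝ E]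
    [T2Space M] {η : Form I M k} (hη : IsSmoothForm η) (p : M) {s : Set M} (hs : s ∈ 𝓝 p)
    (lam : E →L[ℝ] ℝ) (v : Fin (1 + k) → E) :
    ∃ (f : SmoothBumpFunction I p) (x : Form I M 1), tsupport f ⊆ s ∧ IsSmoothForm x ∧
      (∀ r ∉ tsupport f, x r = 0) ∧ ∀ y ∈ (extChartAt I p).target,
        chartRep p (wedge x η) y v =
          f ((extChartAt I p).symm y) * wedgeAlt (oneCovec lam) (chartRep p η y) v ^ 2 := by
  have hc : ContDiffOn ℝ ∞ (fun y => wedgeAlt (oneCovec lam) (chartRep p η y) v)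
      (extChartAt I p).target :=
    (ContinuousAlternatingMap.apply ℝ _ ℝ v).contDiff.comp_contDiffOn
      (contDiffOn_wedgeAlt contDiffOn_const (hη p))
  obtain ⟨f, x, hfs, hx, hx0, hxc⟩ := exists_isSmoothForm_chartRep_eq p hs lam hc
  refine ⟨f, x, hfs, hx, hx0, fun y hy => ?_⟩
  rw [chartRep_wedge, hxc y hy, wedgeAlt_smul_left, ContinuousAlternatingMap.smul_apply,
    smul_eq_mul]
  ring

end TestWedge

section Interior

variable {k : ℕ} {H : Type*} [TopologicalSpace H]
  {I : ModelWithCorners ℝ (EuclideanSpace ℝ (Fin (1 + k))) H}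
  {M : Type*} [TopologicalSpace M] [ChartedSpace H M]
  [IsManifold I ∞ M] [T2Space M] [SigmaCompactSpace M]

theorem covec_eq_zero_of_integralOn_wedge (hM : IsOrientedAtlas I M)
    {η : Form I M k} (hη : IsSmoothForm η) {p : M} {s : Set M} (hs : s ∈ 𝓝 p)
    (h : ∀ (S : Set M) (x : Form I M 1), IsCompact S → S ⊆ s → IsSmoothForm x →
      (∀ r ∉ S, x r = 0) → integralOn S (wedge x η) = 0) : covec η p = 0 := by
  rw [← chartRep_self]
  refine eq_zero_of_forall_wedgeAlt_oneCovec (by simp) fun lam =>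
    eq_zero_of_map_basisFun_eq_zero ?_
  obtain ⟨f, x, hfs, hx, hx0, hxη⟩ := exists_isSmoothForm_chartRep_wedge_eq hη p hs lam
    (EuclideanSpace.basisFun (Fin (1 + k)) ℝ)
  have hf_compact : IsCompact (tsupport f) := f.hasCompactSupport
  have hf_source := f.tsupport_subset_extChartAt_source
  have hwedge_zero (r : M) (hr : r ∉ tsupport f) : wedge x η r = 0 :=
    wedge_apply_eq_zero (hx0 r hr) η
  have hint : ∫ y in (extChartAt I p).target, density p (wedge x η) y = 0 := by
    rw [← integralOn_eq_setIntegral_density hM hf_compact hf_compact Subset.rfl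
      f.tsupport_subset_chartAt_source (hx.wedge hη) hwedge_zero]
    exact h (tsupport f) x hf_compact hfs hx hx0
  have hcont : ContinuousOn (density p (wedge x η)) (extChartAt I p).target :=
    ((ContinuousAlternatingMap.apply ℝ _ ℝ _).continuous.comp_continuousOn
      ((hx.wedge hη) p).continuousOn)
  have hintegrable : IntegrableOn (density p (wedge x η)) (extChartAt I p).target :=
    integrableOn_of_continuousOn_target p hcont (measurableSet_target p) Subset.rfl hf_compact
      hf_source fun y _ hy => by
        rw [density, chartRep_of_eq_zero p (hwedge_zero _ hy)]
        rfl
  have hnonneg : 0 ≤ᵐ[volume.restrict (extChartAt I p).target] density p (wedge x η) :=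
    ae_restrict_of_forall_mem (measurableSet_target p) fun y hy => by
      rw [density, hxη y hy]
      exact mul_nonneg f.nonneg (sq_nonneg _)
  have hzero : EqOn (density p (wedge x η)) 0 (extChartAt I p).target :=
    Measure.eqOn_of_ae_eq ((setIntegral_eq_zero_iff_of_nonneg_ae hnonneg hintegrable).1 hint)
      hcont continuousOn_const extChartAt_target_subset_closure_interior
  have hp := hzero (mem_extChartAt_target p)
  rw [density, hxη _ (mem_extChartAt_target p), extChartAt_to_inv, f.eq_one, one_mul] at hp
  exact pow_eq_zero_iff two_ne_zero |>.1 hp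

end Interior

section Boundary

theorem exists_comp_consZeroL_eq {n : ℕ} (μ : EuclideanSpace ℝ (Fin n) →L[ℝ] ℝ) :
    ∃ lam : EuclideanSpace ℝ (Fin (n + 1)) →L[ℝ] ℝ, lam ∘L consZeroL n = μ := by
  obtain ⟨g, hg⟩ := exists_leftInverse_consZeroL (n := n)
  exact ⟨μ ∘L g, ContinuousLinearMap.ext fun z => congrArg μ (hg z)⟩

theorem eq_zero_of_covec_eq_zero {n k : ℕ} {M : Type*} [TopologicalSpace M]
    [ChartedSpace (EuclideanHalfSpace (n + 1)) M] [IsManifold (𝓡∂ (n + 1)) ∞ M]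
    {η : Form (𝓡∂ (n + 1)) M k} (hη : IsSmoothForm η)
    (h : ∀ p ∉ (𝓡∂ (n + 1)).boundary M, covec η p = 0) : η = 0 := by
  refine form_ext fun p => ?_
  rw [← chartRep_self]
  have hp := mem_extChartAt_target (I := 𝓡∂ (n + 1)) p
  have hmaps : MapsTo (chartRep p η) (interior (extChartAt (𝓡∂ (n + 1)) p).target) {0} := by
    refine fun y hy => chartRep_of_eq_zero p (h _ fun hboundary => ?_)
    have hy_pos := interior_mono (extChartAt_target_subset_range p) hy
    rw [interior_range_modelWithCornersEuclideanHalfSpace] at hy_pos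
    exact hy_pos.ne' ((extChartAt_symm_mem_boundary_iff p (interior_subset hy)).1 hboundary)
  have hclosure := (((hη p).continuousOn _ hp).mono interior_subset).mem_closure
    (extChartAt_target_subset_closure_interior hp) hmaps
  rwa [closure_singleton] at hclosure

section BoundaryDensity

variable {n : ℕ} {M : Type*} [TopologicalSpace M] [ChartedSpace (EuclideanHalfSpace (n + 1)) M]
  {q : M} {S : Set M} {θ : Form (𝓡∂ (n + 1)) M n}

theorem continuous_boundaryDensity (hS : IsCompact S)
    (hSq : S ⊆ (extChartAt (𝓡∂ (n + 1)) q).source) (hθ : IsSmoothForm θ)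
    (h0 : ∀ p ∉ S, θ p = 0) : Continuous (boundaryDensity q θ) :=
  (ContinuousAlternatingMap.apply ℝ _ ℝ _).continuous.comp
    ((hθ.contDiffOn_chartRepExtension hS hSq h0).continuousOn.comp_continuous
      (consZeroL n).continuous consZeroL_mem_range)

theorem hasCompactSupport_boundaryDensity (hS : IsCompact S)
    (hSq : S ⊆ (extChartAt (𝓡∂ (n + 1)) q).source) (h0 : ∀ p ∉ S, θ p = 0) :
    HasCompactSupport (boundaryDensity q θ) :=
  .intro (isClosedEmbedding_consZeroL.isCompact_preimage (isCompact_image_extChartAt q hS hSq))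
    fun z hz => by
      rw [boundaryDensity, chartRepExtension_eq_zero h0 hz]
      rfl

end BoundaryDensity

variable {k : ℕ} {M : Type*} [TopologicalSpace M]
  [ChartedSpace (EuclideanHalfSpace (1 + k + 1)) M]
  [IsManifold (𝓡∂ (1 + k + 1)) ∞ M] [T2Space M] [SigmaCompactSpace M]

theorem covec_comp_consZeroL_eq_zero (hM : IsOrientedAtlas (𝓡∂ (1 + k + 1)) M)
    {η : Form (𝓡∂ (1 + k + 1)) M k} (hη : IsSmoothForm η)
    (h : ∀ (S : Set M) (x : Form (𝓡∂ (1 + k + 1)) M 1), IsCompact S → IsSmoothForm x →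
      (∀ p ∉ S, x p = 0) → integralOn S (extD (wedge x η)) = 0)
    {p : M} (hp : p ∈ (𝓡∂ (1 + k + 1)).boundary M) :
    (covec η p).compContinuousLinearMap (consZeroL (1 + k)) = 0 := by
  rw [← chartRep_self]
  refine eq_zero_of_forall_wedgeAlt_oneCovec (by simp) fun μ => eq_zero_of_map_basisFun_eq_zero ?_
  obtain ⟨lam, rfl⟩ := exists_comp_consZeroL_eq μ
  have hlam : oneCovec (lam ∘L consZeroL (1 + k)) =
    (oneCovec lam).compContinuousLinearMap (consZeroL (1 + k)) := rfl
  rw [hlam, ← wedgeAlt_compContinuousLinearMap]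
  obtain ⟨f, x, -, hx, hx0, hxη⟩ := exists_isSmoothForm_chartRep_wedge_eq hη p Filter.univ_mem lam
    (fun i => consZeroL (1 + k) (EuclideanSpace.basisFun (Fin (1 + k)) ℝ i))
  have hf_compact : IsCompact (tsupport f) := f.hasCompactSupport
  have hf_source := f.tsupport_subset_extChartAt_source
  have hwedge_zero (r : M) (hr : r ∉ tsupport f) : wedge x η r = 0 :=
    wedge_apply_eq_zero (hx0 r hr) η
  have hint : ∫ z, boundaryDensity p (wedge x η) z = 0 := by
    rw [← neg_eq_zero, ← integralOn_extD hM hf_compact hf_compact Subset.rfl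
      f.tsupport_subset_chartAt_source (hx.wedge hη) hwedge_zero]
    exact h (tsupport f) x hf_compact hx hx0
  have hnonneg : 0 ≤ boundaryDensity p (wedge x η) := fun z => by
    rw [boundaryDensity]
    by_cases hz : consZeroL (1 + k) z ∈ (extChartAt (𝓡∂ (1 + k + 1)) p).target
    · rw [chartRepExtension_of_mem hz, hxη _ hz]
      exact mul_nonneg f.nonneg (sq_nonneg _)
    · rw [chartRepExtension_of_notMem hz]
      rfl
  obtain ⟨z, hz⟩ := exists_consZeroL_eq
    ((mem_boundary_iff_extChartAt p (mem_chart_source _ p)).1 hp)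
  have hzero : boundaryDensity p (wedge x η) z = 0 := by
    by_contra hne
    exact ((continuous_boundaryDensity hf_compact hf_source (hx.wedge hη)
      hwedge_zero).integral_pos_of_hasCompactSupport_nonneg_nonzero
        (hasCompactSupport_boundaryDensity hf_compact hf_source hwedge_zero) hnonneg hne).ne' hint
  have hp_target := mem_extChartAt_target (I := 𝓡∂ (1 + k + 1)) p
  rw [boundaryDensity, hz, chartRepExtension_of_mem hp_target, hxη _ hp_target, extChartAt_to_inv,
    f.eq_one, one_mul] at hzero
  exact pow_eq_zero_iff two_ne_zero |>.1 hzero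

end Boundary

/-! ### Pullback to the boundary -/

section Pullback

variable {n : ℕ} {M : Type*} [TopologicalSpace M] [ChartedSpace (EuclideanHalfSpace (n + 1)) M]
  [IsManifold (𝓡∂ (n + 1)) ∞ M]

theorem consZeroL_mem_target {x : Boundary n M} {y : EuclideanSpace ℝ (Fin n)}
    (hy : y ∈ (extChartAt (𝓡 n) x).target) :
    consZeroL n y ∈ (extChartAt (𝓡∂ (n + 1)) x.1).target := by
  rw [extChartAt_target] at hy ⊢
  refine ⟨?_, consZeroL_mem_range y⟩
  have h_symm : (𝓡∂ (n + 1)).symm (consZeroL n y) = consZero y :=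
    (𝓡∂ (n + 1)).left_inv (consZero y)
  rw [mem_preimage, h_symm]
  exact hy.1

theorem coe_extChartAt_symm {x : Boundary n M} {y : EuclideanSpace ℝ (Fin n)}
    (hy : y ∈ (extChartAt (𝓡 n) x).target) :
    ((extChartAt (𝓡 n) x).symm y).1 = (extChartAt (𝓡∂ (n + 1)) x.1).symm (consZeroL n y) := by
  classical
  have h_symm : (extChartAt (𝓡∂ (n + 1)) x.1).symm (consZeroL n y) =
      (chartAt (EuclideanHalfSpace (n + 1)) x.1).symm (consZero y) :=
    congrArg (chartAt (EuclideanHalfSpace (n + 1)) x.1).symm ((𝓡∂ (n + 1)).left_inv (consZero y))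
  have h_boundary := (extChartAt_symm_mem_boundary_iff x.1 (consZeroL_mem_target hy)).2
    (consZeroL_apply_zero y)
  rw [h_symm] at h_boundary ⊢
  exact congrArg Subtype.val (dif_pos h_boundary)

theorem consZeroL_extChartAt {x r : Boundary n M}
    (hr : r.1 ∈ (chartAt (EuclideanHalfSpace (n + 1)) x.1).source) :
    consZeroL n (extChartAt (𝓡 n) x r) = extChartAt (𝓡∂ (n + 1)) x.1 r.1 :=
  congrArg Subtype.val (consZero_dropZero ((mem_boundary_iff (chart_mem_atlas _ x.1) hr).1 r.2))

theorem consZeroL_coordChange (q x : Boundary n M) {y : EuclideanSpace ℝ (Fin n)}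
    (hy : y ∈ (extChartAt (𝓡 n) x).target)
    (hq : ((extChartAt (𝓡 n) x).symm y).1 ∈ (chartAt (EuclideanHalfSpace (n + 1)) q.1).source) :
    consZeroL n ((extChartAt (𝓡 n) q ∘ (extChartAt (𝓡 n) x).symm) y) =
      (extChartAt (𝓡∂ (n + 1)) q.1 ∘ (extChartAt (𝓡∂ (n + 1)) x.1).symm) (consZeroL n y) := by
  rw [comp_apply, comp_apply, ← coe_extChartAt_symm hy, consZeroL_extChartAt hq]

instance isManifold_boundary : IsManifold (𝓡 n) ∞ (Boundary n M) := by
  refine isManifold_of_contDiffOn _ _ _ ?_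
  rintro _ _ ⟨x, rfl⟩ ⟨q, rfl⟩ y hy
  have h_target {w : EuclideanSpace ℝ (Fin n)}
      (hw : w ∈ (boundaryChart x (chartAt (EuclideanHalfSpace (n + 1)) x.1)
        (chart_mem_atlas _ x.1)).target) : w ∈ (extChartAt (𝓡 n) x).target := by
    rw [extChartAt_target]
    exact ⟨hw, mem_range_self w⟩
  obtain ⟨g, hg⟩ := exists_leftInverse_consZeroL (n := n)
  have hq : (extChartAt (𝓡∂ (n + 1)) x.1).symm (consZeroL n y) ∈
      (chartAt (EuclideanHalfSpace (n + 1)) q.1).source := by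
    exact coe_extChartAt_symm (h_target hy.1.1) ▸ hy.1.2
  refine (g.contDiff.contDiffWithinAt.comp y ((contDiffWithinAt_coordChange q.1 x.1
    (consZeroL_mem_target (h_target hy.1.1)) hq).comp y (consZeroL n).contDiff.contDiffWithinAt
      fun w _ => consZeroL_mem_range w) (mapsTo_univ _ _)).congr_of_mem (fun w hw => ?_) hy
  exact (hg _).symm.trans (congrArg g (consZeroL_coordChange q x (h_target hw.1.1) hw.1.2))

theorem consZeroL_comp_fderivWithin_coordChange (q x : Boundary n M)
    {y : EuclideanSpace ℝ (Fin n)} (hy : y ∈ (extChartAt (𝓡 n) x).target)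
    (hq : (extChartAt (𝓡 n) x).symm y ∈ (chartAt (EuclideanSpace ℝ (Fin n)) q).source) :
    consZeroL n ∘L fderivWithin ℝ (extChartAt (𝓡 n) q ∘ (extChartAt (𝓡 n) x).symm)
        (range (𝓡 n)) y =
      fderivWithin ℝ (extChartAt (𝓡∂ (n + 1)) q.1 ∘ (extChartAt (𝓡∂ (n + 1)) x.1).symm)
        (range (𝓡∂ (n + 1))) (consZeroL n y) ∘L consZeroL n := by
  have hq' : (extChartAt (𝓡∂ (n + 1)) x.1).symm (consZeroL n y) ∈
      (chartAt (EuclideanHalfSpace (n + 1)) q.1).source := by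
    rw [← coe_extChartAt_symm hy]
    exact hq
  have h_left := (consZeroL n).hasFDerivAt.comp_hasFDerivWithinAt y
    ((contDiffWithinAt_coordChange q x hy hq).differentiableWithinAt (by simp)).hasFDerivWithinAt
  have h_right := ((contDiffWithinAt_coordChange q.1 x.1 (consZeroL_mem_target hy)
    hq').differentiableWithinAt (by simp)).hasFDerivWithinAt.comp (s := range (𝓡 n)) y
      (consZeroL n).hasFDerivWithinAt fun w _ => consZeroL_mem_range w
  refine (uniqueDiffWithinAt_range hy).eq h_left (h_right.congr_of_eventuallyEq ?_
    (consZeroL_coordChange q x hy hq))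
  exact (eventually_mem_source q x hy hq).mono fun w hw => consZeroL_coordChange q x hw.1 hw.2

theorem covec_boundaryPullback {k : ℕ} (η : Form (𝓡∂ (n + 1)) M k) (x : Boundary n M) :
    covec (boundaryPullback η) x = (covec η x.1).compContinuousLinearMap (consZeroL n) := by
  have h_written : writtenInExtChartAt (𝓡 n) (𝓡∂ (n + 1)) x (boundaryIncl n M)
      =ᶠ[𝓝 (extChartAt (𝓡 n) x x)] consZeroL n := by
    filter_upwards [extChartAt_target_mem_nhds (I := 𝓡 n) x] with y hy
    change extChartAt (𝓡∂ (n + 1)) x.1 ((extChartAt (𝓡 n) x).symm y).1 = _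
    rw [coe_extChartAt_symm hy, (extChartAt _ x.1).right_inv (consZeroL_mem_target hy)]
  have h_mfderiv : HasMFDerivAt (𝓡 n) (𝓡∂ (n + 1)) (boundaryIncl n M) x (consZeroL n) :=
    ⟨continuous_subtype_val.continuousAt,
      ((consZeroL n).hasFDerivAt.congr_of_eventuallyEq h_written).hasFDerivWithinAt⟩
  exact congrArg (covec η x.1).compContinuousLinearMap h_mfderiv.mfderiv

theorem boundaryPullback_eq_zero_iff {k : ℕ} (η : Form (𝓡∂ (n + 1)) M k) :
    boundaryPullback η = 0 ↔ ∀ p ∈ (𝓡∂ (n + 1)).boundary M,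
      (covec η p).compContinuousLinearMap (consZeroL n) = 0 := by
  refine ⟨fun h p hp => ?_,
    fun h => form_ext fun x => (covec_boundaryPullback η x).trans (h x.1 x.2)⟩
  rw [← covec_boundaryPullback η ⟨p, hp⟩, h]
  rfl

theorem chartRep_boundaryPullback {k : ℕ} (η : Form (𝓡∂ (n + 1)) M k) (x : Boundary n M)
    {y : EuclideanSpace ℝ (Fin n)} (hy : y ∈ (extChartAt (𝓡 n) x).target) :
    chartRep x (boundaryPullback η) y =
      (chartRep x.1 η (consZeroL n y)).compContinuousLinearMap (consZeroL n) := by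
  rw [chartRep_eq x _ hy, covec_boundaryPullback, chartRep_eq x.1 _ (consZeroL_mem_target hy),
    ← coe_extChartAt_symm hy]
  exact congrArg (covec η _).compContinuousLinearMap
    (consZeroL_comp_fderivWithin_coordChange _ x hy (mem_chart_source _ _))

theorem boundaryPullback_extD {k : ℕ} {η : Form (𝓡∂ (n + 1)) M k} (hη : IsSmoothForm η) :
    boundaryPullback (extD η) = extD (boundaryPullback η) := by
  refine form_ext fun x => ?_
  have hx := mem_extChartAt_target (I := 𝓡 n) x
  have hx_range : extChartAt (𝓡 n) x x ∈ range (𝓡 n) := extChartAt_target_subset_range x hx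
  have h_fderiv (w : EuclideanSpace ℝ (Fin n)) (hw : w ∈ range (𝓡 n)) :
      fderivWithin ℝ (consZeroL n) (range (𝓡 n)) w = consZeroL n :=
    (consZeroL n).fderivWithin ((𝓡 n).uniqueDiffOn w hw)
  have h_pullback := extDerivWithin_pullback (r := ∞) (s := range (𝓡 n))
    (x := extChartAt (𝓡 n) x x) (f := consZeroL n) (t := range (𝓡∂ (n + 1)))
    (hη.differentiableWithinAt (consZeroL_mem_target hx))
    (consZeroL n).contDiff.contDiffWithinAt minSmoothness_two_le_infty
    (𝓡 n).uniqueDiffOn ((𝓡 n).range_subset_closure_interior hx_range) hx_range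
    fun w _ => consZeroL_mem_range w
  rw [h_fderiv _ hx_range] at h_pullback
  rw [covec_boundaryPullback, covec_extD, covec_extD,
    ← consZeroL_extChartAt (mem_chart_source (EuclideanHalfSpace (n + 1)) x.1), ← h_pullback]
  refine Filter.EventuallyEq.extDerivWithin_eq_of_mem ?_ hx_range
  filter_upwards [extChartAt_target_mem_nhdsWithin x, self_mem_nhdsWithin] with w hw hw_range
  rw [chartRep_boundaryPullback η x hw, h_fderiv w hw_range]

end Pullback

section PullbackAlgebra

variable {n : ℕ} {M : Type*} [TopologicalSpace M] [ChartedSpace (EuclideanHalfSpace (n + 1)) M]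
  [IsManifold (𝓡∂ (n + 1)) ∞ M] {k l : ℕ}

theorem boundaryPullback_add (η ζ : Form (𝓡∂ (n + 1)) M k) :
    boundaryPullback (η + ζ) = boundaryPullback η + boundaryPullback ζ := rfl

theorem boundaryPullback_smul (c : ℝ) (η : Form (𝓡∂ (n + 1)) M k) :
    boundaryPullback (c • η) = c • boundaryPullback η := rfl

theorem boundaryPullback_smul_eq_zero_iff {c : ℝ} (hc : c ≠ 0) (η : Form (𝓡∂ (n + 1)) M k) :
    boundaryPullback (c • η) = 0 ↔ boundaryPullback η = 0 := by
  rw [boundaryPullback_smul]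
  exact smul_eq_zero_iff_right hc

theorem boundaryPullback_sum {ι : Type*} (s : Finset ι) (η : ι → Form (𝓡∂ (n + 1)) M k) :
    boundaryPullback (∑ i ∈ s, η i) = ∑ i ∈ s, boundaryPullback (η i) :=
  map_sum (AddMonoidHom.mk' (fun β : Form (𝓡∂ (n + 1)) M k => boundaryPullback β)
    boundaryPullback_add) η s

theorem boundaryPullback_wedge (η : Form (𝓡∂ (n + 1)) M k) (ζ : Form (𝓡∂ (n + 1)) M l) :
    boundaryPullback (wedge η ζ) = wedge (boundaryPullback η) (boundaryPullback ζ) :=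
  funext fun _ => wedgeAlt_compContinuousLinearMap _ _ _

theorem boundaryPullback_bracket (a : Fin 3 → Form (𝓡∂ (n + 1)) M k)
    (b : Fin 3 → Form (𝓡∂ (n + 1)) M l) (i : Fin 3) :
    boundaryPullback (bracket a b i) =
      bracket (fun i => boundaryPullback (a i)) (fun i => boundaryPullback (b i)) i := by
  simp only [bracket, boundaryPullback_sum, boundaryPullback_smul, boundaryPullback_wedge]

theorem boundaryPullback_epsWedge (e : Fin 3 → Form (𝓡∂ (n + 1)) M 1) (i : Fin 3) :
    boundaryPullback (epsWedge e i) = epsWedge (fun i => boundaryPullback (e i)) i :=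
  boundaryPullback_bracket e e i

variable {e A : Fin 3 → Form (𝓡∂ (n + 1)) M 1}

theorem boundaryPullback_curv (hA : ∀ i, IsSmoothForm (A i)) (i : Fin 3) :
    boundaryPullback (curv A i) = curv (fun i => boundaryPullback (A i)) i := by
  change boundaryPullback (extD (A i) + (1 / 2 : ℝ) • (bracket A A i : Form _ M 2)) = _
  rw [boundaryPullback_add, boundaryPullback_smul, boundaryPullback_extD (hA i),
    boundaryPullback_bracket]
  rfl

theorem boundaryPullback_covD (he : ∀ i, IsSmoothForm (e i)) (i : Fin 3) :
    boundaryPullback (covD A e i) =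
      covD (fun i => boundaryPullback (A i)) (fun i => boundaryPullback (e i)) i := by
  change boundaryPullback (extD (e i) + (bracket A e i : Form _ M 2)) = _
  rw [boundaryPullback_add, boundaryPullback_extD (he i), boundaryPullback_bracket]
  rfl

end PullbackAlgebra

/-! ### Stationarity and the field equations -/

section TestEquations

variable {k : ℕ} {M : Type*} [TopologicalSpace M]
  [ChartedSpace (EuclideanHalfSpace (1 + k + 1)) M]
  [IsManifold (𝓡∂ (1 + k + 1)) ∞ M] [T2Space M] [SigmaCompactSpace M]

theorem integralOn_extD_wedge_eq_zero (hM : IsOrientedAtlas (𝓡∂ (1 + k + 1)) M) {K : Set M}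
    (hK : IsCompact K) {x : Form (𝓡∂ (1 + k + 1)) M 1} {η : Form (𝓡∂ (1 + k + 1)) M k}
    (hx : IsSmoothForm x) (hη : IsSmoothForm η) (hx0 : ∀ p ∉ K, x p = 0)
    (h : ∀ p ∈ (𝓡∂ (1 + k + 1)).boundary M, x p = 0 ∨
      (covec η p).compContinuousLinearMap (consZeroL (1 + k)) = 0) :
    integralOn K (extD (wedge x η)) = 0 := by
  refine integralOn_extD_eq_zero hM hK (hx.wedge hη)
    (fun p hp => wedge_apply_eq_zero (hx0 p hp) η) fun p hp => ?_
  rcases h p hp with hxp | hηp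
  · exact congrArg (fun f => f.compContinuousLinearMap (consZeroL (1 + k)))
      (wedge_apply_eq_zero hxp η)
  · refine (wedgeAlt_compContinuousLinearMap (covec x p) (covec η p) _).trans ?_
    rw [hηp]
    exact wedgeAlt_zero_right _

theorem eq_zero_of_integralOn_wedge_add_extD (hM : IsOrientedAtlas (𝓡∂ (1 + k + 1)) M)
    {P : Form (𝓡∂ (1 + k + 1)) M (k + 1)} {B : Form (𝓡∂ (1 + k + 1)) M k}
    (hP : IsSmoothForm P) (hB : IsSmoothForm B)
    (h : ∀ (K : Set M) (x : Form (𝓡∂ (1 + k + 1)) M 1), IsCompact K → IsSmoothForm x →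
      (∀ p ∉ K, x p = 0) →
      integralOn K ((wedge x P : Form (𝓡∂ (1 + k + 1)) M (1 + (k + 1))) + extD (wedge x B)) = 0) :
    P = 0 ∧ boundaryPullback (n := 1 + k) B = 0 := by
  have hP0 : P = 0 := by
    refine eq_zero_of_covec_eq_zero hP fun p hp =>
      covec_eq_zero_of_integralOn_wedge (k := k + 1) hM hP
        (((𝓡∂ (1 + k + 1)).isClosed_boundary (M := M) (n := ∞) (by simp)).isOpen_compl.mem_nhds hp)
        fun S x hS hSb hx hx0 => ?_
    have hstokes : integralOn S (extD (wedge x B)) = 0 :=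
      integralOn_extD_wedge_eq_zero hM hS hx hB hx0 fun r hr =>
        Or.inl (hx0 r fun hrS => hSb hrS hr)
    have hsum := h S x hS hx hx0
    rwa [integralOn_add hS (hx.wedge hP) (hx.wedge hB).extD, hstokes, add_zero] at hsum
  subst hP0
  refine ⟨rfl, (boundaryPullback_eq_zero_iff B).2 fun p hp =>
    covec_comp_consZeroL_eq_zero hM hB (fun S x hS hx hx0 => ?_) hp⟩
  have hsum := h S x hS hx hx0
  rwa [show (wedge x (0 : Form (𝓡∂ (1 + k + 1)) M (k + 1)) : Form _ M (1 + (k + 1))) = 0 from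
    wedge_zero_right x, zero_add] at hsum

theorem forall_integralOn_sum_wedge_add_extD_eq_zero_iff
    (hM : IsOrientedAtlas (𝓡∂ (1 + k + 1)) M) {ι : Type*} [Fintype ι]
    {P : ι → Form (𝓡∂ (1 + k + 1)) M (k + 1)} {B : ι → Form (𝓡∂ (1 + k + 1)) M k}
    (hP : ∀ i, IsSmoothForm (P i)) (hB : ∀ i, IsSmoothForm (B i)) :
    (∀ (K : Set M) (x : ι → Form (𝓡∂ (1 + k + 1)) M 1), IsCompact K →
        (∀ i, IsSmoothForm (x i)) → (∀ p ∉ K, ∀ i, x i p = 0) →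
        integralOn K ((∑ i, wedge (x i) (P i) : Form (𝓡∂ (1 + k + 1)) M (1 + (k + 1))) +
          extD (∑ i, wedge (x i) (B i))) = 0) ↔
      (∀ i, P i = 0) ∧ ∀ i, boundaryPullback (n := 1 + k) (B i) = 0 := by
  classical
  constructor
  · refine fun h => forall_and.1 fun i =>
      eq_zero_of_integralOn_wedge_add_extD hM (hP i) (hB i) fun K x hK hx hx0 => ?_
    have hsmooth (j : ι) : IsSmoothForm ((Pi.single i x : ι → Form _ M 1) j) := by
      rw [Pi.single_apply]
      split_ifs
      exacts [hx, isSmoothForm_zero]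
    have hvanish (p : M) (hp : p ∉ K) (j : ι) : (Pi.single i x : ι → Form _ M 1) j p = 0 := by
      rw [Pi.single_apply]
      split_ifs
      exacts [hx0 p hp, rfl]
    have hsingle {l : ℕ} (C : ι → Form (𝓡∂ (1 + k + 1)) M l) :
        ∑ j, wedge ((Pi.single i x : ι → Form _ M 1) j) (C j) = wedge x (C i) := by
      rw [Finset.sum_eq_single i (fun j _ hj => ?_) (by simp), Pi.single_eq_same]
      rw [Pi.single_eq_of_ne hj, wedge_zero_left]
    have := h K (Pi.single i x) hK hsmooth hvanish
    rwa [hsingle, hsingle] at this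
  · rintro ⟨hP0, hB0⟩ K x hK hx hx0
    have hbulk : (∑ i, wedge (x i) (P i) : Form (𝓡∂ (1 + k + 1)) M (1 + (k + 1))) = 0 :=
      Finset.sum_eq_zero fun i _ => by rw [hP0 i]; exact wedge_zero_right (x i)
    rw [hbulk, zero_add, extD_sum fun i _ => (hx i).wedge (hB i),
      integralOn_sum hK fun i _ => ((hx i).wedge (hB i)).extD]
    exact Finset.sum_eq_zero fun i _ =>
      integralOn_extD_wedge_eq_zero hM hK (hx i) (hB i) (fun p hp => hx0 p hp i) fun p hp =>
        Or.inr ((boundaryPullback_eq_zero_iff (B i)).1 (hB0 i) p hp)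

end TestEquations

section FieldEquations

variable {M : Type*} [TopologicalSpace M] [ChartedSpace (EuclideanHalfSpace 4) M]
  [IsManifold (𝓡∂ 4) ∞ M]

theorem boundary_equations_iff_euclideanGR3 {e A : Fin 3 → Form (𝓡∂ 4) M 1}
    (he : ∀ i, IsSmoothForm (e i)) (hA : ∀ i, IsSmoothForm (A i)) :
    ((∀ i, boundaryPullback (n := 3) (covD A e i) = 0) ∧
        (∀ i, boundaryPullback (n := 3) (curv A i + (1 / 8 : ℝ) • epsWedge e i) = 0)) ↔
      EuclideanGR3 (1 / 4) (fun i => boundaryPullback (n := 3) (e i))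
        (fun i => boundaryPullback (n := 3) (A i)) := by
  refine and_congr (forall_congr' fun i => ?_) (forall_congr' fun i => ?_)
  · rw [boundaryPullback_covD he]
  · rw [boundaryPullback_add, boundaryPullback_smul, boundaryPullback_curv hA,
      boundaryPullback_epsWedge, show (1 / 4 / 2 : ℝ) = 1 / 8 by norm_num]

variable [T2Space M] [SigmaCompactSpace M]

theorem forall_integralOn_pair_add_extD_eq_zero_iff (hM : IsOrientedAtlas (𝓡∂ 4) M)
    {P Q : Fin 3 → Form (𝓡∂ 4) M 3} {B C : Fin 3 → Form (𝓡∂ 4) M 2}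
    (hP : ∀ i, IsSmoothForm (P i)) (hQ : ∀ i, IsSmoothForm (Q i))
    (hB : ∀ i, IsSmoothForm (B i)) (hC : ∀ i, IsSmoothForm (C i)) :
    (∀ (K : Set M) (x a : Fin 3 → Form (𝓡∂ 4) M 1), IsCompact K →
        (∀ i, IsSmoothForm (x i)) → (∀ i, IsSmoothForm (a i)) →
        (∀ p ∉ K, ∀ i, x i p = 0 ∧ a i p = 0) →
        integralOn K ((pair x P + pair a Q : Form (𝓡∂ 4) M 4) +
          extD (pair x B + pair a C : Form (𝓡∂ 4) M 3)) = 0) ↔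
      ((∀ i, P i = 0) ∧ ∀ i, Q i = 0) ∧
        ((∀ i, boundaryPullback (n := 3) (B i) = 0) ∧
          ∀ i, boundaryPullback (n := 3) (C i) = 0) := by
  have hiff := forall_integralOn_sum_wedge_add_extD_eq_zero_iff (k := 2) hM
    (P := Sum.elim P Q) (B := Sum.elim B C) (Sum.forall.2 ⟨hP, hQ⟩) (Sum.forall.2 ⟨hB, hC⟩)
  simp only [Sum.forall, Sum.elim_inl, Sum.elim_inr] at hiff
  rw [← hiff]
  constructor
  · intro h K y hK hy hy0
    simp only [Fintype.sum_sum_type]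
    exact h K (y ∘ Sum.inl) (y ∘ Sum.inr) hK hy.1 hy.2
      fun p hp i => ⟨(hy0 p hp).1 i, (hy0 p hp).2 i⟩
  · intro h K x a hK hx ha hxa
    have := h K (Sum.elim x a) hK ⟨hx, ha⟩
      fun p hp => ⟨fun i => (hxa p hp i).1, fun i => (hxa p hp i).2⟩
    rwa [Fintype.sum_sum_type, Fintype.sum_sum_type] at this

theorem isStationary_lagrangian_iff_fieldEquations (hM : IsOrientedAtlas (𝓡∂ 4) M)
    (α₁ α₂ α₃ α₄ α₅ : ℝ) {e A : Fin 3 → Form (𝓡∂ 4) M 1}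
    (he : ∀ i, IsSmoothForm (e i)) (hA : ∀ i, IsSmoothForm (A i)) :
    IsStationary (lagrangian α₁ α₂ α₃ α₄ α₅) e A ↔
      ((∀ i, (α₁ - α₂) • hkCurv e A i = 0) ∧ (∀ i, (α₁ - α₂) • hkTorsion e A i = 0)) ∧
        ((∀ i, boundaryPullback (n := 3) ((2 * α₂) • covD A e i + α₄ • epsWedge e i +
            α₅ • curv A i) = 0) ∧
          (∀ i, boundaryPullback (n := 3) (α₁ • epsWedge e i + (2 * α₃) • curv A i +
            α₅ • covD A e i) = 0)) := by
  have hcurv (i : Fin 3) : IsSmoothForm (((2 * (α₁ - α₂)) • hkCurv e A) i) :=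
    (IsSmoothForm.bracket he (IsSmoothForm.curv hA) i).smul _
  have htorsion (i : Fin 3) : IsSmoothForm (((2 * (α₁ - α₂)) • hkTorsion e A) i) :=
    (IsSmoothForm.bracket (IsSmoothForm.covD hA he) he i).smul _
  have drop_two (η : Form (𝓡∂ 4) M 3) : (2 * (α₁ - α₂)) • η = 0 ↔ (α₁ - α₂) • η = 0 := by
    rw [mul_smul]
    exact smul_eq_zero_iff_right two_ne_zero
  have reorder (i : Fin 3) : boundaryForm α₅ α₁ (2 * α₃) e A i =
      α₁ • epsWedge e i + (2 * α₃) • curv A i + α₅ • covD A e i := by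
    simp only [boundaryForm, Pi.add_apply, Pi.smul_apply]
    abel
  have hvariation := forall_integralOn_pair_add_extD_eq_zero_iff hM hcurv htorsion
    (IsSmoothForm.boundaryForm (2 * α₂) α₄ α₅ he hA)
    (IsSmoothForm.boundaryForm α₅ α₁ (2 * α₃) he hA)
  simp only [Pi.smul_apply, drop_two, reorder] at hvariation
  rw [isStationary_lagrangian_iff α₁ α₂ α₃ α₄ α₅ he hA]
  refine Iff.trans ?_ hvariation
  refine forall₃_congr fun K x a => forall₄_congr fun _ hx ha _ => ?_
  rw [firstVariation_eq α₁ α₂ α₃ α₄ α₅ he hA hx ha, smul_add, ← pair_smul_right, ← pair_smul_right]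

theorem isStationary_twoConnLagrangian_iff_fieldEquations (hM : IsOrientedAtlas (𝓡∂ 4) M)
    {e A : Fin 3 → Form (𝓡∂ 4) M 1}
    (he : ∀ i, IsSmoothForm (e i)) (hA : ∀ i, IsSmoothForm (A i)) :
    IsStationary twoConnLagrangian (A + (1 / 2 : ℝ) • e) (A + (-(1 / 2) : ℝ) • e) ↔
      ((∀ i, hkCurv e A i = 0) ∧ (∀ i, hkTorsion e A i = 0)) ∧
        ((∀ i, boundaryPullback (n := 3) (covD A e i) = 0) ∧
          (∀ i, boundaryPullback (n := 3) (curv A i + (1 / 8 : ℝ) • epsWedge e i) = 0)) := by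
  have bulk (η : Form (𝓡∂ 4) M 3) : (1 / 4 - -(1 / 4) : ℝ) • η = 0 ↔ η = 0 :=
    smul_eq_zero_iff_right (by norm_num)
  have torsion (i : Fin 3) : (2 * -(1 / 4) : ℝ) • covD A e i + (0 : ℝ) • epsWedge e i +
      (0 : ℝ) • curv A i = (-(1 / 2) : ℝ) • covD A e i := by
    module
  have curvature (i : Fin 3) : (1 / 4 : ℝ) • epsWedge e i + (2 * 1 : ℝ) • curv A i +
      (0 : ℝ) • covD A e i = (2 : ℝ) • (curv A i + (1 / 8 : ℝ) • epsWedge e i) := by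
    module
  rw [isStationary_twoConnLagrangian_iff he hA,
    isStationary_lagrangian_iff_fieldEquations hM _ _ _ _ _ he hA]
  simp only [bulk, torsion, curvature,
    boundaryPullback_smul_eq_zero_iff (n := 3) (show (-(1 / 2) : ℝ) ≠ 0 by norm_num),
    boundaryPullback_smul_eq_zero_iff (n := 3) (two_ne_zero (α := ℝ))]

end FieldEquations

end HKModel

end

theorem mainTheorem2
    {M : Type*} [TopologicalSpace M] [ChartedSpace (EuclideanHalfSpace 4) M]
    [IsManifold (𝓡∂ 4) ∞ M] [T2Space M] [SigmaCompactSpace M]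
    (hM : HKModel.IsOrientedAtlas (𝓡∂ 4) M) :
    (∀ (α₁ α₂ α₃ α₄ α₅ : ℝ) (e A : Fin 3 → HKModel.Form (𝓡∂ 4) M 1),
      (∀ i, HKModel.IsSmoothForm (e i)) → (∀ i, HKModel.IsSmoothForm (A i)) →
      (HKModel.IsStationary (HKModel.lagrangian α₁ α₂ α₃ α₄ α₅) e A ↔
        ((∀ i, (α₁ - α₂) • HKModel.hkCurv e A i = 0) ∧
          (∀ i, (α₁ - α₂) • HKModel.hkTorsion e A i = 0)) ∧
        ((∀ i, HKModel.boundaryPullback (n := 3) ((2 * α₂) • HKModel.covD A e i +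
            α₄ • HKModel.epsWedge e i + α₅ • HKModel.curv A i) = 0) ∧
          (∀ i, HKModel.boundaryPullback (n := 3) (α₁ • HKModel.epsWedge e i +
            (2 * α₃) • HKModel.curv A i + α₅ • HKModel.covD A e i) = 0)))) ∧
    (∀ Ap Am e A : Fin 3 → HKModel.Form (𝓡∂ 4) M 1,
      (∀ i, HKModel.IsSmoothForm (Ap i)) → (∀ i, HKModel.IsSmoothForm (Am i)) →
      e = Ap - Am → A = (1 / 2 : ℝ) • Am + (1 - 1 / 2 : ℝ) • Ap →
      (HKModel.IsStationary HKModel.twoConnLagrangian Ap Am ↔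
        ((∀ i, HKModel.hkCurv e A i = 0) ∧ (∀ i, HKModel.hkTorsion e A i = 0)) ∧
        ((∀ i, HKModel.boundaryPullback (n := 3) (HKModel.covD A e i) = 0) ∧
          (∀ i, HKModel.boundaryPullback (n := 3)
            (HKModel.curv A i + (1 / 8 : ℝ) • HKModel.epsWedge e i) = 0))) ∧
      (((∀ i, HKModel.boundaryPullback (n := 3) (HKModel.covD A e i) = 0) ∧
          (∀ i, HKModel.boundaryPullback (n := 3)
            (HKModel.curv A i + (1 / 8 : ℝ) • HKModel.epsWedge e i) = 0)) ↔
        HKModel.EuclideanGR3 (1 / 4)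
          (fun i => HKModel.boundaryPullback (n := 3) (e i))
          (fun i => HKModel.boundaryPullback (n := 3) (A i)))) := by
  refine ⟨fun α₁ α₂ α₃ α₄ α₅ e A he hA =>
    HKModel.isStationary_lagrangian_iff_fieldEquations hM α₁ α₂ α₃ α₄ α₅ he hA,
    fun Ap Am e A hAp hAm he hA => ?_⟩
  have he_smooth : ∀ i, HKModel.IsSmoothForm (e i) := fun i => he ▸ (hAp i).sub (hAm i)
  have hA_smooth : ∀ i, HKModel.IsSmoothForm (A i) := fun i =>
    hA ▸ ((hAm i).smul _).add ((hAp i).smul _)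
  have hAp_eq : Ap = A + (1 / 2 : ℝ) • e := by rw [he, hA]; module
  have hAm_eq : Am = A + (-(1 / 2) : ℝ) • e := by rw [he, hA]; module
  refine ⟨?_, HKModel.boundary_equations_iff_euclideanGR3 he_smooth hA_smooth⟩
  rw [hAp_eq, hAm_eq]
  exact HKModel.isStationary_twoConnLagrangian_iff_fieldEquations hM he_smooth hA_smooth
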